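/- Let $f,g$ be two probability densities with respect to a common measure $\lambda$ on a measurable space, with $\{f>0\}=\{g>0\}$ up to a $\lambda$-null set. Let $X_1,X_2,\dots$ be independent; under $\mathsf P_\nu$ ($0\le\nu\le\infty$) the observations $X_i$ with $i\le\nu$ have density $f$ and those with $i>\nu$ have density $g$. Put $\Lambda_i=g(X_i)/f(X_i)$. For $r\ge 0$ and a threshold $A$ let $R^r_0=r$, $R^r_{n+1}=(1+R^r_n)\Lambda_{n+1}$ and $T^r_A=\inf\{n\ge1: R^r_n\ge A\}$ (the SR--$r$ procedure; $r=0$ is the SR procedure). The quasi-stationary distribution $\mathsf Q_A$ for the threshold $A$ is said to exist if $\mathsf P_\infty(T^0_A>n)>0$ for all $n$ and there is a probability distribution with distribution function $$\mathsf Q_A(x)=\lim_{n\to\infty}\mathsf P_\infty(R^r_n\le x\mid T^r_A>n)\qquad\text{for all }x,$$ for every $r\ge 0$ with $\mathsf P_\infty(T^r_A>n)>0$ for all $n$. In that case $T_A^{\mathsf Q_A}$ (the SRP procedure) is the stopping time obtained in the same way from a random $R_0\sim\mathsf Q_A$ independent of the observations. For a procedure $T$ the average run length (ARL) to false alarm is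 $\mathsf E_\infty T$, and $\mathsf{ADD}_\infty(T)=\lim_{\nu\to\infty}\mathsf E_\nu(T-\nu\mid T>\nu)$. Suppose that the cdf of $\log\Lambda_1$ is log-concave both under $\mathsf P_\infty$ (pre-change) and under $\mathsf P_0$ (post-change). Let $1<\gamma<\infty$ be fixed, let $S\subseteq[0,\infty)$ (for instance $S=[0,\infty)$), and for each $r\in S$ let $A^r_\gamma$ be a threshold with $\mathsf E_\infty T^r_{A^r_\gamma}=\gamma$ for which the quasi-stationary distribution $\mathsf Q_{A^r_\gamma}$ exists. Then $\mathsf{ADD}_\infty(T^r_{A^r_\gamma})$ exists and is finite for every $r\in S$, and it is a strictly increasing function of $r\in S$. If moreover $0\in S$, then $$\min_{r\in S}\mathsf{ADD}_\infty(T^r_{A^r_\gamma})=\mathsf{ADD}_\infty(T^0_{A^0_\gamma}),$$ and for every threshold $A_{\mathsf Q}$ for which the quasi-stationary distribution exists and for which $\mathsf E_\infty T^{\mathsf Q_{A_{\mathsf Q}}}_{A_{\mathsf Q}}=\gamma$, the limit $\mathsf{ADD}_\infty(T^{\mathsf Q_{A_{\mathsf Q}}}_{A_{\mathsf Q}})$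 exists, is finite, and $$\mathsf{ADD}_\infty(T^0_{A^0_\gamma})<\mathsf{ADD}_\infty(T^{\mathsf Q_{A_{\mathsf Q}}}_{A_{\mathsf Q}}).$$ -/

import Mathlib

open MeasureTheory ProbabilityTheory Filter Topology
open scoped ENNReal NNReal

noncomputable section

/-- The law on the observation space with density `f` with respect to the dominating measure. -/
def densityLaw {𝓧 : Type*} [MeasurableSpace 𝓧] (lam : Measure 𝓧) (f : 𝓧 → ℝ) : Measure 𝓧 :=
  lam.withDensity fun x => ENNReal.ofReal (f x)

/-- `changeLaw lam f g ν` is the law of the observations when the changepoint is `ν`: they are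
independent, the first `ν` of them have density `f`, and all the later ones have density `g`.
Coordinate `i` of a sequence is the observation number `i + 1`; `ν = ⊤` means no change. -/
def changeLaw {𝓧 : Type*} [MeasurableSpace 𝓧] (lam : Measure 𝓧) (f g : 𝓧 → ℝ) (ν : ℕ∞) :
    Measure (ℕ → 𝓧) :=
  open Classical in
  Measure.infinitePi fun i : ℕ =>
    if (i : ℕ∞) < ν then densityLaw lam f else densityLaw lam g

/-- The likelihood ratio of one observation. -/
def likRatio {𝓧 : Type*} (f g : 𝓧 → ℝ) (x : 𝓧) : ℝ := g x / f x

/-- The cumulative distribution function of the log-likelihood ratio of one observation whose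
law is `P`. -/
def logLikRatioCdf {𝓧 : Type*} [MeasurableSpace 𝓧] (f g : 𝓧 → ℝ) (P : Measure 𝓧) (t : ℝ) : ℝ :=
  cdf (P.map fun x => Real.log (likRatio f g x)) t

/-- `log F` is concave, for a distribution function `F` (with `log 0 = -∞`): since `F` is monotone,
`{F > 0}` is an interval unbounded to the right, and it suffices to ask for concavity there. -/
def LogConcaveCdf (F : ℝ → ℝ) : Prop :=
  ConcaveOn ℝ {t | 0 < F t} fun t => Real.log (F t)

/-- The Shiryaev--Roberts statistic with head start `r`:
`R 0 = r` and `R (n + 1) = (1 + R n) * Λ (n + 1)`. -/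
def srStat {𝓧 : Type*} (f g : 𝓧 → ℝ) (r : ℝ) (ω : ℕ → 𝓧) : ℕ → ℝ
  | 0 => r
  | n + 1 => (1 + srStat f g r ω n) * likRatio f g (ω n)

/-- The stopping time `inf {n ≥ 1 : R n ≥ A}` of the SR procedure with head start `r` and
threshold `A`; it is `⊤` if the level is never reached. -/
def srTime {𝓧 : Type*} (f g : 𝓧 → ℝ) (A r : ℝ) (ω : ℕ → 𝓧) : ℕ∞ :=
  ⨅ (n : ℕ) (_ : 1 ≤ n ∧ A ≤ srStat f g r ω n), (n : ℕ∞)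

/-- The expectation of a random time. -/
def meanTime {Ω : Type*} [MeasurableSpace Ω] (P : Measure Ω) (T : Ω → ℕ∞) : ℝ≥0∞ :=
  ∫⁻ ω, ((T ω : ℕ∞) : ℝ≥0∞) ∂P

/-- The conditional expectation `E (T - ν | T > ν)`. -/
def meanDelay {Ω : Type*} [MeasurableSpace Ω] (P : Measure Ω) (T : Ω → ℕ∞) (ν : ℕ) : ℝ≥0∞ :=
  ∫⁻ ω, ((T ω - (ν : ℕ∞) : ℕ∞) : ℝ≥0∞) ∂(cond P {ω | (ν : ℕ∞) < T ω})

/-- The average run length to false alarm of the SR--`r` procedure with threshold `A`. -/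
def srARL {𝓧 : Type*} [MeasurableSpace 𝓧] (lam : Measure 𝓧) (f g : 𝓧 → ℝ) (A r : ℝ) : ℝ≥0∞ :=
  meanTime (changeLaw lam f g ⊤) (srTime f g A r)

/-- `d` is the average delay to detection at infinity of the SR--`r` procedure with
threshold `A`: the limit of `E_ν (T - ν | T > ν)` as `ν → ∞` exists and equals `d`. -/
def IsSRDelayAtInfinity {𝓧 : Type*} [MeasurableSpace 𝓧] (lam : Measure 𝓧) (f g : 𝓧 → ℝ)
    (A r : ℝ) (d : ℝ≥0) : Prop :=
  Tendsto (fun ν : ℕ => meanDelay (changeLaw lam f g ν) (srTime f g A r) ν) atTop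
    (𝓝 (d : ℝ≥0∞))

/-- The average run length to false alarm of the SR procedure with threshold `A` whose head start
is random with law `Q`, independent of the observations. -/
def srpARL {𝓧 : Type*} [MeasurableSpace 𝓧] (lam : Measure 𝓧) (f g : 𝓧 → ℝ) (A : ℝ)
    (Q : Measure ℝ) : ℝ≥0∞ :=
  meanTime (Q.prod (changeLaw lam f g ⊤)) fun p => srTime f g A p.1 p.2

/-- `d` is the average delay to detection at infinity of the SR procedure with threshold `A`
whose head start is random with law `Q`, independent of the observations. -/
def IsSRPDelayAtInfinity {𝓧 : Type*} [MeasurableSpace 𝓧] (lam : Measure 𝓧) (f g : 𝓧 → ℝ)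
    (A : ℝ) (Q : Measure ℝ) (d : ℝ≥0) : Prop :=
  Tendsto (fun ν : ℕ =>
      meanDelay (Q.prod (changeLaw lam f g ν)) (fun p => srTime f g A p.1 p.2) ν) atTop
    (𝓝 (d : ℝ≥0∞))

/-- `Q` is the quasi-stationary distribution of the SR statistic for the threshold `A`: a
probability law with `Q (-∞, x] = lim P_∞ (R n ≤ x | T > n)` for every `x`, whatever the head start
`r ≥ 0` is. The conditional probabilities have to make sense for all `n`: this is required for the
head start `0`, and other head starts are considered only if it holds for them. -/
structure IsQuasiStationary {𝓧 : Type*} [MeasurableSpace 𝓧] (lam : Measure 𝓧) (f g : 𝓧 → ℝ)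
    (A : ℝ) (Q : Measure ℝ) : Prop where
  isProbabilityMeasure : IsProbabilityMeasure Q
  survives : ∀ n : ℕ, changeLaw lam f g ⊤ {ω | (n : ℕ∞) < srTime f g A 0 ω} ≠ 0
  tendsto : ∀ r : ℝ, 0 ≤ r →
    (∀ n : ℕ, changeLaw lam f g ⊤ {ω | (n : ℕ∞) < srTime f g A r ω} ≠ 0) →
    ∀ x : ℝ, Tendsto
      (fun n : ℕ => cond (changeLaw lam f g ⊤) {ω | (n : ℕ∞) < srTime f g A r ω}
        {ω | srStat f g r ω n ≤ x}) atTop (𝓝 (Q (Set.Iic x)))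

end

/-! Write `F` and `G` for the laws of the likelihood ratio before and after the change. The argument
rests on two facts. First, the delay at infinity depends on the head start only through the
threshold: before the change the statistic, given no alarm, settles to the same limit law for every
surviving head start, and the delay is the sum over `k` of the limiting probabilities to survive `k`
further steps under `G`. Second, with the average run length held fixed, a larger head start
requires a strictly larger threshold (`SRViable.threshold_lt`). It remains to show that the delay is
strictly increasing in the threshold (`SRDelayTerms.tsum_lt_tsum`).

Let `A' < A` and `c = A / A'`. A chain below `A'` multiplied by `c` is compared with a chain below
`A`. Since `1 + c * y ≤ c * (1 + y)`, survival from `y` below `A'` is at most survival from `c * y`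
below `A`. It is also needed that `c` times the conditional law for `A'` is stochastically above the
conditional law for `A`. Stochastic order does not survive conditioning, so the induction is run in
the reversed hazard rate order. Multiplication by an independent ratio preserves it because `F` is
log-concave, and so does killing. The map `R ↦ 1 + R` preserves it when the law of the chain is
itself log-concave, and that is the same comparison with equal thresholds, so one induction gives
both (`revHazardScaledLE_srChain`).

Strictness comes from the term `k = 1`. The conditional laws increase with time, hence keep a fixed
mass on a region where an alarm is possible, and log-concavity of `G` gives a uniform gap in
one-step survival there. Finiteness holds because ratios at least `1` have positive probability and
each of them raises the statistic by at least `1`, so survival decays geometrically.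

For the procedure with random head start, the quasi-stationary law is an eigenmeasure of the killed
chain, except in a boundary case where it sits at the threshold and the run length is `1`. It
charges only positive head starts, so its threshold exceeds the one for head start `0`. -/

noncomputable section

open Set

/-! ### Reversed hazard rate order -/

/-- `m` is below `m'` in the reversed hazard rate order: `m' (-∞, t) / m (-∞, t)` is monotone. -/
def RevHazardLE (m m' : Measure ℝ) : Prop :=
  ∀ s t : ℝ, s ≤ t → m (Iio t) * m' (Iio s) ≤ m (Iio s) * m' (Iio t)

/-- `m` is below the image of `m'` under multiplication by `c` in the reversed hazard rate order. -/
def RevHazardScaledLE (c : ℝ) (m m' : Measure ℝ) : Prop :=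
  ∀ s t : ℝ, s ≤ t → m (Iio t) * m' (Iio (s / c)) ≤ m (Iio s) * m' (Iio (t / c))

/-- The distribution function of `P`, in the logarithmic scale, is log-concave. -/
def LogConcaveLaw (P : Measure ℝ) : Prop :=
  ∀ c : ℝ, 1 ≤ c → RevHazardScaledLE c P P

lemma tendsto_measure_Iio_add (m : Measure ℝ) [IsFiniteMeasure m] (a : ℝ) :
    Tendsto (fun n : ℕ => m (Iio (a + 1 / (n + 1 : ℝ)))) atTop (𝓝 (m (Iic a))) := by
  have h : Iic a = ⋂ n : ℕ, Iio (a + 1 / (n + 1 : ℝ)) := by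
    ext x
    simp only [mem_Iic, mem_iInter, mem_Iio]
    constructor
    · intro hx n
      have : (0 : ℝ) < 1 / (n + 1 : ℝ) := by positivity
      linarith
    · intro hx
      by_contra! hlt
      obtain ⟨n, hn⟩ := exists_nat_one_div_lt (sub_pos.2 hlt)
      have := hx n
      linarith
  rw [h]
  refine tendsto_measure_iInter_atTop (fun n => measurableSet_Iio.nullMeasurableSet) ?_
    ⟨0, measure_ne_top _ _⟩
  intro i j hij
  refine Iio_subset_Iio ?_
  have : 1 / ((j : ℝ) + 1) ≤ 1 / ((i : ℝ) + 1) := by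
    apply one_div_le_one_div_of_le (by positivity)
    have : (i : ℝ) ≤ j := by exact_mod_cast hij
    linarith
  linarith

lemma tendsto_measure_Iio_nat (m : Measure ℝ) :
    Tendsto (fun n : ℕ => m (Iio (n : ℝ))) atTop (𝓝 (m univ)) := by
  have h : (univ : Set ℝ) = ⋃ n : ℕ, Iio (n : ℝ) := by
    ext x
    simpa using exists_nat_gt x
  rw [h]
  refine tendsto_measure_iUnion_atTop ?_
  intro i j hij
  exact Iio_subset_Iio (by exact_mod_cast hij)

/-- A lower set of the line is empty, a half-line or everything; closed half-lines and the whole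
line are monotone limits of open half-lines. -/
lemma measure_lowerSet_le {α β : Measure ℝ} [IsFiniteMeasure α] [IsFiniteMeasure β]
    (h : ∀ s, α (Iio s) ≤ β (Iio s)) {U : Set ℝ} (hU : IsLowerSet U) : α U ≤ β U := by
  by_cases hb : BddAbove U
  · rcases U.eq_empty_or_nonempty with rfl | hne
    · simp
    by_cases hs : sSup U ∈ U
    · have : U = Iic (sSup U) := by
        ext x
        exact ⟨fun hx => le_csSup hb hx, fun hx => hU hx hs⟩
      rw [this]
      exact le_of_tendsto_of_tendsto' (tendsto_measure_Iio_add α _) (tendsto_measure_Iio_add β _)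
        fun n => h _
    · have : U = Iio (sSup U) := by
        ext x
        refine ⟨fun hx => lt_of_le_of_ne (le_csSup hb hx) ?_, fun hx => ?_⟩
        · rintro rfl
          exact hs hx
        · obtain ⟨y, hy, hxy⟩ := exists_lt_of_lt_csSup hne hx
          exact hU hxy.le hy
      rw [this]
      exact h _
  · have : U = univ := by
      ext x
      simp only [mem_univ, iff_true]
      rw [not_bddAbove_iff] at hb
      obtain ⟨y, hy, hxy⟩ := hb x
      exact hU hxy.le hy
    rw [this]
    exact le_of_tendsto_of_tendsto' (tendsto_measure_Iio_nat α) (tendsto_measure_Iio_nat β)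
      fun n => h _

lemma lintegral_eq_lintegral_meas_le_of_le_one (m : Measure ℝ) {ρ : ℝ → ℝ≥0∞}
    (hρ : Measurable ρ) (h1 : ∀ y, ρ y ≤ 1) :
    ∫⁻ y, ρ y ∂m = ∫⁻ t in Ioi (0 : ℝ), m {y | ENNReal.ofReal t ≤ ρ y} := by
  have h : ∀ y, ρ y = ENNReal.ofReal (ρ y).toReal := fun y =>
    (ENNReal.ofReal_toReal ((h1 y).trans_lt ENNReal.one_lt_top).ne).symm
  calc ∫⁻ y, ρ y ∂m = ∫⁻ y, ENNReal.ofReal (ρ y).toReal ∂m := by simp_rw [← h]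
    _ = ∫⁻ t in Ioi (0 : ℝ), m {y | t ≤ (ρ y).toReal} :=
      lintegral_eq_lintegral_meas_le m (ae_of_all _ fun y => ENNReal.toReal_nonneg)
        hρ.ennreal_toReal.aemeasurable
    _ = _ := by
      refine lintegral_congr fun t => ?_
      congr 1
      ext y
      simp only [mem_ofPred_eq]
      rw [ENNReal.ofReal_le_iff_le_toReal ((h1 y).trans_lt ENNReal.one_lt_top).ne]

/-- By the layer-cake formula it suffices to compare the sets `{ρ ≥ t}`, which are lower sets. The
total masses need not agree, which allows unnormalised measures below. -/
lemma lintegral_antitone_le {α β : Measure ℝ} [IsFiniteMeasure α] [IsFiniteMeasure β]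
    (h : ∀ s, α (Iio s) ≤ β (Iio s)) {ρ : ℝ → ℝ≥0∞} (hρ : Antitone ρ) (h1 : ∀ y, ρ y ≤ 1) :
    ∫⁻ y, ρ y ∂α ≤ ∫⁻ y, ρ y ∂β := by
  rw [lintegral_eq_lintegral_meas_le_of_le_one α hρ.measurable h1,
    lintegral_eq_lintegral_meas_le_of_le_one β hρ.measurable h1]
  refine lintegral_mono fun t => measure_lowerSet_le h ?_
  intro y x hxy hy
  exact le_trans (b := ρ y) hy (hρ hxy)

lemma isFiniteMeasure_withDensity_of_le_one (m : Measure ℝ) [IsFiniteMeasure m] {ψ : ℝ → ℝ≥0∞}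
    (h1 : ∀ y, ψ y ≤ 1) : IsFiniteMeasure (m.withDensity ψ) := by
  refine isFiniteMeasure_withDensity ?_
  refine ne_top_of_le_ne_top (measure_ne_top m univ) ?_
  calc ∫⁻ y, ψ y ∂m ≤ ∫⁻ _, 1 ∂m := lintegral_mono h1
    _ = m univ := by simp

/-- Reweighting both measures by the antitone `ψ` and normalising leaves the first stochastically
below the second. The mass is cut at `s` and the two parts are compared separately. -/
lemma RevHazardLE.setLIntegral_mul_le {m₁ m₂ : Measure ℝ} [IsFiniteMeasure m₁]
    [IsFiniteMeasure m₂] (h : RevHazardLE m₁ m₂) {ψ : ℝ → ℝ≥0∞} (hψ : Antitone ψ)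
    (h1 : ∀ y, ψ y ≤ 1) (s : ℝ) :
    (∫⁻ y, ψ y ∂m₁) * ∫⁻ y in Iio s, ψ y ∂m₂ ≤ (∫⁻ y in Iio s, ψ y ∂m₁) * ∫⁻ y, ψ y ∂m₂ := by
  have hfin : ∀ (a : ℝ≥0∞) (μ : Measure ℝ) [IsFiniteMeasure μ], a ≠ ∞ → IsFiniteMeasure (a • μ) :=
    fun a μ _ ha => Measure.smul_finite μ ha
  have inst1 := hfin (m₁ (Iio s)) (m₂.restrict (Iio s)) (measure_ne_top _ _)
  have inst2 := hfin (m₂ (Iio s)) (m₁.restrict (Iio s)) (measure_ne_top _ _)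
  have inst3 := hfin (m₂ (Iio s)) (m₁.restrict (Ici s)) (measure_ne_top _ _)
  have inst4 := hfin (m₁ (Iio s)) (m₂.restrict (Ici s)) (measure_ne_top _ _)
  -- Conditioned to lie below `s`, `m₂` is stochastically above `m₁`, so it gives the smaller
  -- integral to an antitone function.
  have hI : m₁ (Iio s) * ∫⁻ y in Iio s, ψ y ∂m₂ ≤ m₂ (Iio s) * ∫⁻ y in Iio s, ψ y ∂m₁ := by
    rw [← smul_eq_mul, ← smul_eq_mul, ← lintegral_smul_measure, ← lintegral_smul_measure]
    refine lintegral_antitone_le (fun u => ?_) hψ h1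
    simp only [Measure.smul_apply, smul_eq_mul, Measure.restrict_apply measurableSet_Iio,
      Iio_inter_Iio]
    have := h (min u s) s (min_le_right _ _)
    rwa [mul_comm (m₂ (Iio s))]
  -- Relative to the mass below `s`, `m₂` puts at least as much mass as `m₁` on each `[s, u)`.
  have hII : m₂ (Iio s) * ∫⁻ y in Ici s, ψ y ∂m₁ ≤ m₁ (Iio s) * ∫⁻ y in Ici s, ψ y ∂m₂ := by
    rw [← smul_eq_mul, ← smul_eq_mul, ← lintegral_smul_measure, ← lintegral_smul_measure]
    refine lintegral_antitone_le (fun u => ?_) hψ h1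
    simp only [Measure.smul_apply, smul_eq_mul, Measure.restrict_apply measurableSet_Iio]
    rcases le_total u s with hus | hus
    · have : Iio u ∩ Ici s = ∅ := by
        ext x
        simp only [mem_inter_iff, mem_Iio, mem_Ici, mem_empty_iff_false, iff_false, not_and, not_le]
        intro hx
        linarith
      simp [this]
    · have hd : Iio u ∩ Ici s = Iio u \ Iio s := by
        ext x
        simp [and_comm]
      rw [hd, measure_sdiff (Iio_subset_Iio hus) measurableSet_Iio.nullMeasurableSet
        (measure_ne_top _ _), measure_sdiff (Iio_subset_Iio hus)
        measurableSet_Iio.nullMeasurableSet (measure_ne_top _ _),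
        ENNReal.mul_sub (fun _ _ => measure_ne_top _ _),
        ENNReal.mul_sub (fun _ _ => measure_ne_top _ _), mul_comm (m₂ (Iio s)) (m₁ (Iio s)),
        mul_comm (m₂ (Iio s))]
      exact tsub_le_tsub_right (h s u hus) _
  have hsplit : ∀ m : Measure ℝ, ∫⁻ y, ψ y ∂m
      = ∫⁻ y in Iio s, ψ y ∂m + ∫⁻ y in Ici s, ψ y ∂m := by
    intro m
    rw [← compl_Iio, lintegral_add_compl _ measurableSet_Iio]
  set a₁ := ∫⁻ y in Iio s, ψ y ∂m₁
  set a₂ := ∫⁻ y in Iio s, ψ y ∂m₂ with ha₂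
  set b₁ := ∫⁻ y in Ici s, ψ y ∂m₁ with hb₁
  set b₂ := ∫⁻ y in Ici s, ψ y ∂m₂
  have key : b₁ * a₂ ≤ a₁ * b₂ := by
    by_cases h2 : m₂ (Iio s) = 0
    · have : a₂ = 0 := by
        rw [ha₂, Measure.restrict_eq_zero.2 h2, lintegral_zero_measure]
      simp [this]
    -- If `m₁` has no mass below `s` while `m₂` has some, the order forces `m₁ = 0`.
    by_cases h3 : m₁ (Iio s) = 0
    · have hz : ∀ u, m₁ (Iio u) = 0 := by
        intro u
        rcases le_total u s with hus | hus
        · exact measure_mono_null (Iio_subset_Iio hus) h3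
        · have := h s u hus
          rw [h3, zero_mul, nonpos_iff_eq_zero, mul_eq_zero] at this
          exact this.resolve_right h2
      have hm : m₁ univ = 0 := by
        have := tendsto_measure_Iio_nat m₁
        simp only [hz] at this
        exact (tendsto_nhds_unique this tendsto_const_nhds)
      have : b₁ = 0 := by
        rw [hb₁, Measure.measure_univ_eq_zero.1 hm]
        simp
      simp [this]
    have hmul := mul_le_mul' hI hII
    have hc0 : m₁ (Iio s) * m₂ (Iio s) ≠ 0 := mul_ne_zero h3 h2
    have hct : m₁ (Iio s) * m₂ (Iio s) ≠ ∞ :=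
      ENNReal.mul_ne_top (measure_ne_top _ _) (measure_ne_top _ _)
    refine (ENNReal.mul_le_mul_iff_right hc0 hct).1 ?_
    calc m₁ (Iio s) * m₂ (Iio s) * (b₁ * a₂) = m₁ (Iio s) * a₂ * (m₂ (Iio s) * b₁) := by ring
      _ ≤ m₂ (Iio s) * a₁ * (m₁ (Iio s) * b₂) := hmul
      _ = _ := by ring
  rw [hsplit m₁, hsplit m₂, add_mul, mul_add]
  gcongr

/-- Total positivity of order two is preserved under integration against measures that are ordered
by the reversed hazard rate. -/
lemma RevHazardLE.lintegral_mul_le {m₁ m₂ : Measure ℝ} [IsFiniteMeasure m₁]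
    [IsFiniteMeasure m₂] (h : RevHazardLE m₁ m₂) {φ ψ : ℝ → ℝ≥0∞} (hψ : Antitone ψ)
    (h1 : ∀ y, ψ y ≤ 1) (hφ : ∀ y, φ y ≤ ψ y)
    (hr : ∀ x y, x ≤ y → φ y * ψ x ≤ φ x * ψ y) :
    (∫⁻ y, ψ y ∂m₁) * ∫⁻ y, φ y ∂m₂ ≤ (∫⁻ y, φ y ∂m₁) * ∫⁻ y, ψ y ∂m₂ := by
  have hψt : ∀ y, ψ y ≠ ∞ := fun y => ((h1 y).trans_lt ENNReal.one_lt_top).ne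
  have inst1 := isFiniteMeasure_withDensity_of_le_one m₁ h1
  have inst2 := isFiniteMeasure_withDensity_of_le_one m₂ h1
  -- The integrals of `φ` become integrals of the antitone ratio `ρ` against the reweighted
  -- measures, whose stochastic order is already known. Where `ψ` vanishes so does `φ`, and `0 / 0 =
  -- 0` is the right value.
  set ρ : ℝ → ℝ≥0∞ := fun y => φ y / ψ y with hρ
  have hmul : ∀ y, ψ y * ρ y = φ y := by
    intro y
    rcases eq_or_ne (ψ y) 0 with h0 | h0
    · have := hφ y
      rw [h0] at this
      simp [h0, nonpos_iff_eq_zero.1 this]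
    · exact ENNReal.mul_div_cancel h0 (hψt y)
  have hanti : Antitone ρ := by
    intro x y hxy
    rcases eq_or_ne (ψ y) 0 with h0 | h0
    · have := hφ y
      rw [h0] at this
      simp [hρ, h0, nonpos_iff_eq_zero.1 this]
    · have hx0 : ψ x ≠ 0 := fun hx => h0 (nonpos_iff_eq_zero.1 (hx ▸ hψ hxy))
      rw [hρ]
      simp only
      rw [ENNReal.div_le_iff h0 (hψt y), mul_comm, ← mul_div_assoc,
        ENNReal.le_div_iff_mul_le (Or.inl hx0) (Or.inl (hψt x)), mul_comm (ψ y)]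
      exact hr x y hxy
  have hρ1 : ∀ y, ρ y ≤ 1 := fun y => ENNReal.div_le_of_le_mul (by simpa using hφ y)
  have hint : ∀ m : Measure ℝ, ∫⁻ y, φ y ∂m = ∫⁻ y, ρ y ∂(m.withDensity ψ) := by
    intro m
    rw [lintegral_withDensity_eq_lintegral_mul _ hψ.measurable hanti.measurable]
    simp [hmul]
  have hu : ∀ m : Measure ℝ, ∫⁻ y, ψ y ∂m = m.withDensity ψ univ := by
    intro m
    simp
  have hs : ∀ (m : Measure ℝ) s, ∫⁻ y in Iio s, ψ y ∂m = m.withDensity ψ (Iio s) := by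
    intro m s
    rw [withDensity_apply _ measurableSet_Iio]
  rw [hint, hint, mul_comm (∫⁻ y, ρ y ∂(m₁.withDensity ψ)), ← smul_eq_mul, ← smul_eq_mul,
    ← lintegral_smul_measure, ← lintegral_smul_measure]
  have i1 : IsFiniteMeasure ((∫⁻ y, ψ y ∂m₁) • m₂.withDensity ψ) := by
    rw [hu]
    exact Measure.smul_finite _ (measure_ne_top _ _)
  have i2 : IsFiniteMeasure ((∫⁻ y, ψ y ∂m₂) • m₁.withDensity ψ) := by
    rw [hu]
    exact Measure.smul_finite _ (measure_ne_top _ _)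
  refine lintegral_antitone_le (fun s => ?_) hanti hρ1
  simp only [Measure.smul_apply, smul_eq_mul]
  have := h.setLIntegral_mul_le hψ h1 s
  rwa [hs, hs, mul_comm (m₁.withDensity ψ (Iio s))] at this

/-! ### Laws with a log-concave distribution function -/

/-- With `c = t / s`, the ratio of the distribution function at `c * x` and at `x` is nonincreasing
in `x`. If it equals one at `s`, it stays one along `s * c ^ n`, so the positive flat level must be
the total mass. -/
lemma LogConcaveLaw.measure_Iio_lt {P : Measure ℝ} [IsProbabilityMeasure P]
    (hP : LogConcaveLaw P) {s t : ℝ} (hs : 0 < s) (hst : s < t) (ht : P (Iio t) ≠ 0)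
    (hs1 : P (Iio s) ≠ 1) : P (Iio s) < P (Iio t) := by
  refine lt_of_le_of_ne (measure_mono (Iio_subset_Iio hst.le)) fun heq => hs1 ?_
  have hs0 : P (Iio s) ≠ 0 := heq ▸ ht
  set c := t / s with hc
  have hc1 : 1 < c := (one_lt_div hs).2 hst
  have hc0 : 0 < c := by linarith
  have hts : s * c = t := by
    rw [hc]
    field_simp
  have hall : ∀ n : ℕ, P (Iio (s * c ^ n)) = P (Iio s) ∧ P (Iio (s * c ^ (n + 1))) = P (Iio s) := by
    intro n
    induction n with
    | zero => simp [hts, heq]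
    | succ n ih =>
      refine ⟨ih.2, le_antisymm ?_ (measure_mono (Iio_subset_Iio ?_))⟩
      · have hle : s * c ^ (n + 1) ≤ s * c ^ (n + 2) :=
          mul_le_mul_of_nonneg_left (pow_le_pow_right₀ hc1.le (by omega)) hs.le
        have := hP c hc1.le _ _ hle
        have e1 : s * c ^ (n + 1) / c = s * c ^ n := by
          rw [pow_succ, ← mul_assoc, mul_div_cancel_right₀ _ hc0.ne']
        have e2 : s * c ^ (n + 2) / c = s * c ^ (n + 1) := by
          rw [pow_succ, ← mul_assoc, mul_div_cancel_right₀ _ hc0.ne']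
        rw [e1, e2, ih.1, ih.2] at this
        exact (ENNReal.mul_le_mul_iff_left hs0 (measure_ne_top _ _)).1 this
      · nlinarith [one_le_pow₀ hc1.le (n := n + 1 + 1)]
  have hlim : Tendsto (fun n : ℕ => P (Iio (s * c ^ n))) atTop (𝓝 (P univ)) := by
    have hU : (univ : Set ℝ) = ⋃ n : ℕ, Iio (s * c ^ n) := by
      ext x
      simp only [mem_univ, mem_iUnion, mem_Iio, true_iff]
      have := (tendsto_pow_atTop_atTop_of_one_lt hc1).const_mul_atTop hs
      exact (this.eventually_gt_atTop x).exists
    rw [hU]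
    refine tendsto_measure_iUnion_atTop ?_
    intro i j hij
    exact Iio_subset_Iio (mul_le_mul_of_nonneg_left (pow_le_pow_right₀ hc1.le hij) hs.le)
  simp only [fun n => (hall n).1, measure_univ] at hlim
  exact tendsto_nhds_unique tendsto_const_nhds hlim

lemma tendsto_measure_Iio_left (m : Measure ℝ) {u : ℕ → ℝ} {z : ℝ} (hu : Monotone u)
    (hlt : ∀ n, u n < z) (hlim : Tendsto u atTop (𝓝 z)) :
    Tendsto (fun n => m (Iio (u n))) atTop (𝓝 (m (Iio z))) := by
  have h : Iio z = ⋃ n, Iio (u n) := by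
    ext x
    simp only [mem_Iio, mem_iUnion]
    exact ⟨fun hx => (hlim.eventually_const_lt hx).exists, fun ⟨n, hn⟩ => hn.trans (hlt n)⟩
  rw [h]
  exact tendsto_measure_iUnion_atTop fun i j hij => Iio_subset_Iio (hu hij)

lemma tendsto_measure_Iic_left (m : Measure ℝ) {u : ℕ → ℝ} {z : ℝ} (hu : Monotone u)
    (hlt : ∀ n, u n < z) (hlim : Tendsto u atTop (𝓝 z)) :
    Tendsto (fun n => m (Iic (u n))) atTop (𝓝 (m (Iio z))) := by
  have h : Iio z = ⋃ n, Iic (u n) := by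
    ext x
    simp only [mem_Iio, mem_iUnion, mem_Iic]
    exact ⟨fun hx => (hlim.eventually_const_le hx).exists, fun ⟨n, hn⟩ => hn.trans_lt (hlt n)⟩
  rw [h]
  exact tendsto_measure_iUnion_atTop fun i j hij => Iic_subset_Iic.2 (hu hij)

/-- A concave function is continuous inside its domain. An atom remains possible at the left end of
the support, which `h0` excludes. -/
lemma LogConcaveLaw.measure_singleton {P : Measure ℝ} [IsProbabilityMeasure P]
    (hP : LogConcaveLaw P) {z : ℝ} (hz : 0 < z) (h0 : P (Iio z) ≠ 0) : P {z} = 0 := by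
  set q : ℕ → ℝ := fun n => 1 / ((n : ℝ) + 1) with hq
  have hqpos : ∀ n, 0 < q n := fun n => by positivity
  have hqanti : Antitone q := fun i j hij =>
    one_div_le_one_div_of_le (by positivity) (by gcongr)
  have hqlim : Tendsto q atTop (𝓝 0) := tendsto_one_div_add_atTop_nhds_zero_nat
  have hle : ∀ n, P (Iic z) * P (Iio (z / (1 + q n))) ≤ P (Iio z) * P (Iio z) := by
    intro n
    have h1 : 1 ≤ 1 + q n := by linarith [hqpos n]
    have := hP (1 + q n) h1 z (z * (1 + q n)) (by nlinarith [hqpos n])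
    rw [mul_div_cancel_right₀ _ (by linarith [hqpos n])] at this
    refine le_trans ?_ this
    refine mul_le_mul_left (measure_mono fun x (hx : x ≤ z) => ?_) _
    exact lt_of_le_of_lt hx (by nlinarith [hqpos n])
  have hlim : Tendsto (fun n => P (Iio (z / (1 + q n)))) atTop (𝓝 (P (Iio z))) := by
    refine tendsto_measure_Iio_left P ?_ ?_ ?_
    · intro i j hij
      have := hqanti hij
      have := hqpos j
      exact div_le_div_of_nonneg_left hz.le (by linarith) (by linarith)
    · intro n
      rw [div_lt_iff₀ (by linarith [hqpos n])]
      nlinarith [hqpos n]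
    · have : Tendsto (fun n => z / (1 + q n)) atTop (𝓝 (z / (1 + 0))) :=
        tendsto_const_nhds.div (tendsto_const_nhds.add hqlim) (by norm_num)
      simpa using this
  have h2 : P (Iic z) * P (Iio z) ≤ P (Iio z) * P (Iio z) :=
    le_of_tendsto' (ENNReal.Tendsto.const_mul hlim (Or.inr (measure_ne_top _ _))) hle
  have h3 : P (Iic z) ≤ P (Iio z) := (ENNReal.mul_le_mul_iff_left h0 (measure_ne_top _ _)).1 h2
  have h4 : ({z} : Set ℝ) = Iic z \ Iio z := by
    ext x
    simp [le_antisymm_iff]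
  rw [h4, measure_sdiff (Iio_subset_Iic_self) measurableSet_Iio.nullMeasurableSet
    (measure_ne_top _ _)]
  exact tsub_eq_zero_of_le h3

/-- The bridge from concavity of the logarithm of the distribution function of `log X`. -/
lemma logConcaveLaw_of_concaveOn {P : Measure ℝ} [IsProbabilityMeasure P] (hpos : P (Iic 0) = 0)
    (F : ℝ → ℝ) (hF : ∀ t, P (Iic (Real.exp t)) = ENNReal.ofReal (F t)) (hF0 : ∀ t, 0 ≤ F t)
    (hc : LogConcaveCdf F) : LogConcaveLaw P := by
  have hmono : Monotone F := by
    intro a b hab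
    have : P (Iic (Real.exp a)) ≤ P (Iic (Real.exp b)) :=
      measure_mono (Iic_subset_Iic.2 (Real.exp_le_exp.2 hab))
    rw [hF, hF] at this
    exact (ENNReal.ofReal_le_ofReal_iff (hF0 b)).1 this
  -- The points `σ` and `τ - δ` are convex combinations of `σ - δ` and `τ` with complementary
  -- weights; adding the two concavity inequalities gives the claim.
  have key : ∀ σ τ δ : ℝ, σ ≤ τ → 0 ≤ δ → F τ * F (σ - δ) ≤ F σ * F (τ - δ) := by
    intro σ τ δ hστ hδ
    rcases (hF0 (σ - δ)).eq_or_lt with h0 | h0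
    · rw [← h0, mul_zero]
      exact mul_nonneg (hF0 _) (hF0 _)
    have h1 : 0 < F σ := h0.trans_le (hmono (by linarith))
    have h2 : 0 < F (τ - δ) := h0.trans_le (hmono (by linarith))
    have h3 : 0 < F τ := h1.trans_le (hmono hστ)
    rcases (by linarith : 0 ≤ τ - σ + δ).eq_or_lt with hd | hd
    · have e1 : σ = τ := by linarith
      have e2 : δ = 0 := by linarith
      subst e1 e2
      exact le_refl _
    set w := δ / (τ - σ + δ) with hw
    have hw0 : 0 ≤ w := div_nonneg hδ hd.le
    have hw1 : 0 ≤ 1 - w := by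
      rw [hw, sub_nonneg, div_le_one hd]
      linarith
    have hwd : w * (τ - σ + δ) = δ := div_mul_cancel₀ _ hd.ne'
    have c1 := hc.2 (x := σ - δ) h0 (y := τ) h3 hw1 hw0 (by ring)
    have c2 := hc.2 (x := σ - δ) h0 (y := τ) h3 hw0 hw1 (by ring)
    simp only [smul_eq_mul] at c1 c2
    have e1 : (1 - w) * (σ - δ) + w * τ = σ := by linarith
    have e2 : w * (σ - δ) + (1 - w) * τ = τ - δ := by linarith
    rw [e1] at c1
    rw [e2] at c2
    rw [← Real.log_le_log_iff (by positivity) (by positivity), Real.log_mul h3.ne' h0.ne',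
      Real.log_mul h1.ne' h2.ne']
    linarith
  have key2 : ∀ s t c : ℝ, 0 < s → s ≤ t → 1 ≤ c →
      P (Iic t) * P (Iic (s / c)) ≤ P (Iic s) * P (Iic (t / c)) := by
    intro s t c hs hst hc1
    have ht : 0 < t := hs.trans_le hst
    have hc0 : 0 < c := by linarith
    have := key (Real.log s) (Real.log t) (Real.log c) (Real.log_le_log hs hst)
      (Real.log_nonneg hc1)
    have e : ∀ x, 0 < x → P (Iic x) = ENNReal.ofReal (F (Real.log x)) := by
      intro x hx
      rw [← hF, Real.exp_log hx]
    rw [e t ht, e s hs, e _ (div_pos hs hc0), e _ (div_pos ht hc0),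
      Real.log_div hs.ne' hc0.ne', Real.log_div ht.ne' hc0.ne',
      ← ENNReal.ofReal_mul (hF0 _), ← ENNReal.ofReal_mul (hF0 _)]
    exact ENNReal.ofReal_le_ofReal this
  intro c hc1 s t hst
  have hc0 : 0 < c := by linarith
  rcases le_or_gt s 0 with hs | hs
  · have : P (Iio (s / c)) = 0 :=
      measure_mono_null (fun x hx =>
        (lt_of_lt_of_le hx (div_nonpos_of_nonpos_of_nonneg hs hc0.le)).le) hpos
    simp [this]
  have ht : 0 < t := hs.trans_le hst
  -- Factors increasing to `1` turn closed half-lines into open ones in the limit; the shift by `2`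
  -- keeps the first factor positive.
  set q : ℕ → ℝ := fun n => 1 - 1 / ((n : ℝ) + 2) with hq
  have hq0 : ∀ n, 0 < q n := by
    intro n
    have : 1 / ((n : ℝ) + 2) < 1 := by
      rw [div_lt_one (by positivity)]
      linarith [(Nat.cast_nonneg n : (0 : ℝ) ≤ n)]
    simp only [hq]
    linarith
  have hq1 : ∀ n, q n < 1 := by
    intro n
    have : 0 < 1 / ((n : ℝ) + 2) := by positivity
    simp only [hq]
    linarith
  have hqm : Monotone q := by
    intro i j hij
    have : 1 / ((j : ℝ) + 2) ≤ 1 / ((i : ℝ) + 2) :=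
      one_div_le_one_div_of_le (by positivity) (by gcongr)
    simp only [hq]
    linarith
  have hql : Tendsto q atTop (𝓝 1) := by
    have h := (tendsto_one_div_add_atTop_nhds_zero_nat (𝕜 := ℝ)).comp (tendsto_add_atTop_nat 1)
    have h' : Tendsto (fun n : ℕ => 1 - 1 / ((n : ℝ) + 2)) atTop (𝓝 (1 - 0)) := by
      refine tendsto_const_nhds.sub (h.congr fun n => ?_)
      simp only [Function.comp]
      push_cast
      ring
    simpa [hq] using h'
  have lim : ∀ z, 0 < z → Tendsto (fun n => P (Iic (z * q n))) atTop (𝓝 (P (Iio z))) := by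
    intro z hz
    refine tendsto_measure_Iic_left P (fun i j hij => mul_le_mul_of_nonneg_left (hqm hij) hz.le)
      (fun n => by nlinarith [hq1 n]) ?_
    simpa using hql.const_mul z
  have hlim2 : ∀ z, 0 < z → Tendsto (fun n => P (Iic (z * q n / c))) atTop
      (𝓝 (P (Iio (z / c)))) := by
    intro z hz
    refine (lim (z / c) (div_pos hz hc0)).congr fun n => ?_
    congr 2
    ring
  refine le_of_tendsto_of_tendsto'
    (ENNReal.Tendsto.mul (lim t ht) (Or.inr (measure_ne_top _ _)) (hlim2 s hs)
      (Or.inr (measure_ne_top _ _)))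
    (ENNReal.Tendsto.mul (lim s hs) (Or.inr (measure_ne_top _ _)) (hlim2 t ht)
      (Or.inr (measure_ne_top _ _))) fun n => ?_
  exact key2 _ _ c (mul_pos hs (hq0 n)) (mul_le_mul_of_nonneg_right hst (hq0 n).le) hc1

/-! ### The killed Shiryaev--Roberts chain -/

/-- One step `R ↦ (1 + R) * Λ` of the chain, where `Λ` has law `P`. -/
def srFreeStep (P m : Measure ℝ) : Measure ℝ := (m.prod P).map fun p => (1 + p.1) * p.2

/-- One step of the chain, killed on leaving `(-∞, A)`. -/
def srStep (A : ℝ) (P m : Measure ℝ) : Measure ℝ := (srFreeStep P m).restrict (Iio A)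

/-- The (subprobability) law of the killed chain after `n` steps, with initial law `m`. -/
def srChain (A : ℝ) (P m : Measure ℝ) : ℕ → Measure ℝ
  | 0 => m
  | n + 1 => srStep A P (srChain A P m n)

/-- The probability to survive `n` steps of the chain started at a given point. -/
def srSurv (A : ℝ) (P : Measure ℝ) : ℕ → ℝ → ℝ≥0∞
  | 0 => fun _ => 1
  | n + 1 => fun y => ∫⁻ x, (Iio A).indicator (srSurv A P n) ((1 + y) * x) ∂P

lemma measurable_srMap : Measurable fun p : ℝ × ℝ => (1 + p.1) * p.2 := by fun_prop

instance (P m : Measure ℝ) [IsFiniteMeasure m] [IsFiniteMeasure P] :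
    IsFiniteMeasure (srFreeStep P m) := by
  unfold srFreeStep
  infer_instance

instance (A : ℝ) (P m : Measure ℝ) [IsFiniteMeasure m] [IsFiniteMeasure P] :
    IsFiniteMeasure (srStep A P m) := by
  unfold srStep
  infer_instance

instance (A : ℝ) (P m : Measure ℝ) [IsFiniteMeasure m] [IsFiniteMeasure P] (n : ℕ) :
    IsFiniteMeasure (srChain A P m n) := by
  induction n with
  | zero => assumption
  | succ n ih =>
    rw [srChain]
    infer_instance

section

variable {A : ℝ} {P m : Measure ℝ}

lemma measurable_srBack [IsProbabilityMeasure P] {v : ℝ → ℝ≥0∞} (hv : Measurable v) :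
    Measurable fun y : ℝ => ∫⁻ x, (Iio A).indicator v ((1 + y) * x) ∂P :=
  Measurable.lintegral_prod_right' (f := fun p : ℝ × ℝ => (Iio A).indicator v ((1 + p.1) * p.2))
    ((hv.indicator measurableSet_Iio).comp measurable_srMap)

lemma measurable_srSurv [IsProbabilityMeasure P] (n : ℕ) : Measurable (srSurv A P n) := by
  induction n with
  | zero => exact measurable_const
  | succ n ih => exact measurable_srBack ih

lemma lintegral_srStep [IsProbabilityMeasure P] [IsFiniteMeasure m] {v : ℝ → ℝ≥0∞}
    (hv : Measurable v) :
    ∫⁻ z, v z ∂(srStep A P m) = ∫⁻ y, ∫⁻ x, (Iio A).indicator v ((1 + y) * x) ∂P ∂m := by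
  rw [srStep, ← lintegral_indicator measurableSet_Iio, srFreeStep,
    lintegral_map (hv.indicator measurableSet_Iio) measurable_srMap,
    lintegral_prod]
  exact ((hv.indicator measurableSet_Iio).comp measurable_srMap).aemeasurable

/-- `srChain` moves the law forward and `srSurv` moves the test function backward under adjoint
operators, so steps can be shifted from one to the other. -/
lemma lintegral_srSurv_srChain [IsProbabilityMeasure P] [IsFiniteMeasure m] (n k : ℕ) :
    ∫⁻ y, srSurv A P k y ∂(srChain A P m n) = ∫⁻ y, srSurv A P (k + n) y ∂m := by
  induction n generalizing k with
  | zero => rfl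
  | succ n ih =>
    rw [srChain, lintegral_srStep (measurable_srSurv k)]
    have := ih (k + 1)
    rw [show k + 1 + n = k + (n + 1) by ring] at this
    exact this

lemma srChain_univ [IsProbabilityMeasure P] [IsFiniteMeasure m] (n : ℕ) : srChain A P m n univ =
    ∫⁻ y, srSurv A P n y ∂m := by
  have := lintegral_srSurv_srChain (A := A) (P := P) (m := m) n 0
  rw [zero_add] at this
  rw [← this]
  simp [srSurv]

lemma srStep_univ [IsProbabilityMeasure P] [IsFiniteMeasure m] : srStep A P m univ = ∫⁻ y,
    srSurv A P 1 y ∂m := srChain_univ 1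

lemma srFreeStep_apply [IsProbabilityMeasure P] {s : Set ℝ} (hs : MeasurableSet s) :
    srFreeStep P m s = ∫⁻ y, P {x | (1 + y) * x ∈ s} ∂m := by
  rw [srFreeStep, Measure.map_apply measurable_srMap hs,
    Measure.prod_apply (measurable_srMap hs)]
  rfl

lemma srSurv_one (y : ℝ) : srSurv A P 1 y = P {x | (1 + y) * x < A} := by
  have hs : MeasurableSet {x : ℝ | (1 + y) * x < A} :=
    measurableSet_lt (by fun_prop) measurable_const
  rw [← lintegral_indicator_one hs]
  refine lintegral_congr fun x => ?_
  simp only [indicator, mem_Iio, srSurv, mem_ofPred_eq, Pi.one_apply]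

lemma setOf_mul_lt {y s : ℝ} (hy : 0 ≤ y) : {x : ℝ | (1 + y) * x < s} = Iio (s / (1 + y)) := by
  ext x
  rw [mem_ofPred_eq, mem_Iio, lt_div_iff₀ (by linarith), mul_comm]

lemma srSurv_one_eq {y : ℝ} (hy : 0 ≤ y) : srSurv A P 1 y = P (Iio (A / (1 + y))) := by
  rw [srSurv_one, setOf_mul_lt hy]

lemma srSurv_le_one [IsProbabilityMeasure P] (n : ℕ) (y : ℝ) : srSurv A P n y ≤ 1 := by
  induction n generalizing y with
  | zero => exact le_refl _
  | succ n ih =>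
    calc srSurv A P (n + 1) y ≤ ∫⁻ _, 1 ∂P := by
          refine lintegral_mono fun x => ?_
          exact indicator_le_indicator_of_subset (subset_univ _) (fun _ => zero_le) _ |>.trans
            (by simpa using ih _)
      _ = 1 := by simp

lemma ae_nonneg_of_measure_Iio (hm : m (Iio 0) = 0) : ∀ᵐ y ∂m, 0 ≤ y := by
  rw [ae_iff]
  simpa [Iio] using hm

lemma ae_pos_of_measure_Iic (hP : P (Iic 0) = 0) : ∀ᵐ x ∂P, 0 < x := by
  rw [ae_iff]
  simpa [Iic] using hP

/-- The truncation `max y 0` changes nothing almost everywhere and makes the integrand antitone on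
the whole line when `t ≥ 0`. -/
lemma srFreeStep_Iio [IsProbabilityMeasure P] [IsFiniteMeasure m] (hm : m (Iio 0) = 0) (t : ℝ) :
    srFreeStep P m (Iio t) = ∫⁻ y, P (Iio (t / (1 + max y 0))) ∂m := by
  rw [srFreeStep_apply measurableSet_Iio]
  refine lintegral_congr_ae ?_
  filter_upwards [ae_nonneg_of_measure_Iio hm] with y hy
  rw [max_eq_left hy, ← setOf_mul_lt hy]
  rfl

lemma srFreeStep_Iic_zero [IsProbabilityMeasure P] [IsFiniteMeasure m] (hm : m (Iio 0) = 0)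
    (hP : P (Iic 0) = 0) :
    srFreeStep P m (Iic 0) = 0 := by
  rw [srFreeStep_apply measurableSet_Iic, lintegral_eq_zero_iff']
  · filter_upwards [ae_nonneg_of_measure_Iio hm] with y hy
    refine measure_mono_null (fun x hx => ?_) hP
    simp only [mem_Iic, mem_ofPred_eq] at hx ⊢
    by_contra! hx0
    have : 0 < (1 + y) * x := by positivity
    linarith
  · exact (measurable_measure_prodMk_left (measurable_srMap measurableSet_Iic)).aemeasurable

lemma srStep_Iic_zero [IsProbabilityMeasure P] [IsFiniteMeasure m] (hm : m (Iio 0) = 0)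
    (hP : P (Iic 0) = 0) : srStep A P m (Iic 0) = 0 :=
  nonpos_iff_eq_zero.1 ((Measure.restrict_apply_le _ _).trans (srFreeStep_Iic_zero hm hP).le)

lemma srChain_Iio_zero [IsProbabilityMeasure P] [IsFiniteMeasure m] (hm : m (Iio 0) = 0)
    (hP : P (Iic 0) = 0) (n : ℕ) :
    srChain A P m n (Iio 0) = 0 := by
  induction n with
  | zero => exact hm
  | succ n ih => exact measure_mono_null Iio_subset_Iic_self (srStep_Iic_zero ih hP)

lemma srChain_succ_Iic_zero [IsProbabilityMeasure P] [IsFiniteMeasure m] (hm : m (Iio 0) = 0)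
    (hP : P (Iic 0) = 0) (n : ℕ) :
    srChain A P m (n + 1) (Iic 0) = 0 :=
  srStep_Iic_zero (srChain_Iio_zero hm hP n) hP

lemma srChain_succ_Ici (n : ℕ) : srChain A P m (n + 1) (Ici A) = 0 := by
  rw [srChain, srStep, Measure.restrict_apply measurableSet_Ici, Ici_inter_Iio, Ico_self,
    measure_empty]

/-- The affine map `R ↦ 1 + R` of the chain improves the scaled comparison, if the larger law is
log-concave. -/
lemma RevHazardScaledLE.one_add {m' : Measure ℝ} [IsFiniteMeasure m'] {c : ℝ} (hc : 1 ≤ c)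
    (h : RevHazardScaledLE c m m') (hl : LogConcaveLaw m') (hm' : m' (Iio 0) = 0) :
    RevHazardLE m (m'.map fun y => c * (1 + y) - 1) := by
  have hc0 : 0 < c := by linarith
  have hmap : ∀ t, m'.map (fun y => c * (1 + y) - 1) (Iio t) = m' (Iio ((t + 1) / c - 1)) := by
    intro t
    rw [Measure.map_apply (by fun_prop) measurableSet_Iio]
    congr 1
    ext y
    simp only [mem_preimage, mem_Iio, sub_lt_iff_lt_add]
    rw [lt_sub_iff_add_lt, lt_div_iff₀ hc0]
    constructor <;> intro h' <;> linarith
  intro s t hst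
  rw [hmap, hmap]
  set S := (s + 1) / c - 1 with hS
  set T := (t + 1) / c - 1 with hT
  rcases le_or_gt S 0 with hS0 | hS0
  · rw [measure_mono_null (Iio_subset_Iio hS0) hm']
    simp
  by_cases hz : m' (Iio S) = 0
  · simp [hz]
  have hSc : c * S = s - (c - 1) := by
    rw [hS]
    field_simp
    ring
  have hTc : c * T = t - (c - 1) := by
    rw [hT]
    field_simp
    ring
  have hs0 : 0 < s := by nlinarith [mul_pos hc0 hS0]
  have hSle : S ≤ s / c := by
    rw [le_div_iff₀ hc0]
    linarith
  have hTle : s / c ≤ t / c := div_le_div_of_nonneg_right hst hc0.le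
  -- The dilation factor is the one that carries `s / c` to `S`. It carries `t / c` to at most `T`,
  -- since subtracting a constant removes a smaller fraction at `t` than at `s`.
  have h2 := hl (s / c / S) ((one_le_div hS0).2 hSle) (s / c) (t / c) hTle
  have e1 : s / c / (s / c / S) = S := by
    field_simp
  have e2 : t / c / (s / c / S) ≤ T := by
    have e3 : t / c / (s / c / S) = t * S / s := by
      field_simp
    rw [e3, div_le_iff₀ hs0]
    refine le_of_mul_le_mul_left ?_ hc0
    calc c * (t * S) = t * (c * S) := by ring
      _ = t * (s - (c - 1)) := by rw [hSc]
      _ ≤ (t - (c - 1)) * s := by nlinarith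
      _ = c * (T * s) := by rw [← hTc]; ring
  rw [e1] at h2
  have h3 : m' (Iio (t / c)) * m' (Iio S) ≤ m' (Iio (s / c)) * m' (Iio T) :=
    h2.trans (by gcongr)
  have h1 := h s t hst
  have hn1 : m' (Iio (s / c)) ≠ 0 :=
    fun h0 => hz (measure_mono_null (Iio_subset_Iio hSle) h0)
  have hn2 : m' (Iio (t / c)) ≠ 0 :=
    fun h0 => hn1 (measure_mono_null (Iio_subset_Iio hTle) h0)
  refine (ENNReal.mul_le_mul_iff_right (mul_ne_zero hn1 hn2)
    (ENNReal.mul_ne_top (measure_ne_top _ _) (measure_ne_top _ _))).1 ?_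
  calc m' (Iio (s / c)) * m' (Iio (t / c)) * (m (Iio t) * m' (Iio S))
      = (m (Iio t) * m' (Iio (s / c))) * (m' (Iio (t / c)) * m' (Iio S)) := by ring
    _ ≤ (m (Iio s) * m' (Iio (t / c))) * (m' (Iio (s / c)) * m' (Iio T)) := mul_le_mul' h1 h3
    _ = _ := by ring

lemma antitone_measure_Iio_div {s : ℝ} (hs : 0 ≤ s) :
    Antitone fun y : ℝ => P (Iio (s / (1 + max y 0))) := by
  intro x y hxy
  refine measure_mono (Iio_subset_Iio ?_)
  have : 0 ≤ max x 0 := le_max_right _ _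
  exact div_le_div_of_nonneg_left hs (by linarith) (by gcongr)

/-- Total positivity of order two of the one-step kernel: log-concavity with dilation factor `(1 +
max y 0) / (1 + max x 0)`. -/
lemma LogConcaveLaw.measure_Iio_div_mul_le (hP : LogConcaveLaw P) {s t : ℝ} (hst : s ≤ t)
    {x y : ℝ} (hxy : x ≤ y) :
    P (Iio (s / (1 + max y 0))) * P (Iio (t / (1 + max x 0)))
      ≤ P (Iio (s / (1 + max x 0))) * P (Iio (t / (1 + max y 0))) := by
  have hx : 0 < 1 + max x 0 := by linarith [le_max_right x 0]
  have hy : 0 < 1 + max y 0 := by linarith [le_max_right y 0]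
  have := hP ((1 + max y 0) / (1 + max x 0)) ((one_le_div hx).2 (by gcongr))
    (s / (1 + max x 0)) (t / (1 + max x 0)) (by gcongr)
  rw [div_div_div_cancel_right₀ hx.ne', div_div_div_cancel_right₀ hx.ne'] at this
  rwa [mul_comm]

/-- The scale `c` is moved from the level into the initial law: `c * (1 + y) - 1` is the point whose
increment by one is `c * (1 + y)`. -/
lemma srFreeStep_Iio_div [IsProbabilityMeasure P] [IsFiniteMeasure m] {c : ℝ} (hc : 1 ≤ c) {s : ℝ}
    (hm : m (Iio 0) = 0) :
    srFreeStep P m (Iio (s / c))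
      = ∫⁻ y, P (Iio (s / (1 + max y 0))) ∂(m.map fun y => c * (1 + y) - 1) := by
  have hc0 : 0 < c := by linarith
  rw [srFreeStep_Iio hm, lintegral_map _ (by fun_prop)]
  · refine lintegral_congr_ae ?_
    filter_upwards [ae_nonneg_of_measure_Iio hm] with y hy
    have : 0 ≤ c * (1 + y) - 1 := by nlinarith
    rw [max_eq_left hy, max_eq_left this, div_div]
    congr 3
    ring
  · rcases le_total 0 s with hs | hs
    · exact (antitone_measure_Iio_div hs).measurable
    · refine Monotone.measurable fun x y hxy => measure_mono (Iio_subset_Iio ?_)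
      have : 0 ≤ max x 0 := le_max_right _ _
      have hy : 0 ≤ max y 0 := le_max_right _ _
      have hxy' : max x 0 ≤ max y 0 := by gcongr
      rw [div_le_div_iff₀ (by linarith) (by linarith)]
      nlinarith

lemma RevHazardScaledLE.srFreeStep [IsProbabilityMeasure P] [IsFiniteMeasure m] {m' : Measure ℝ}
    [IsFiniteMeasure m'] {c : ℝ} (hc : 1 ≤ c)
    (hP : LogConcaveLaw P) (hP0 : P (Iic 0) = 0) (hm : m (Iio 0) = 0) (hm' : m' (Iio 0) = 0)
    (h : RevHazardScaledLE c m m') (hl : LogConcaveLaw m') :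
    RevHazardScaledLE c (srFreeStep P m) (srFreeStep P m') := by
  have hc0 : 0 < c := by linarith
  intro s t hst
  rcases le_or_gt s 0 with hs | hs
  · have : _root_.srFreeStep P m' (Iio (s / c)) = 0 :=
      measure_mono_null (fun x hx =>
        (lt_of_lt_of_le hx (div_nonpos_of_nonpos_of_nonneg hs hc0.le)).le)
        (srFreeStep_Iic_zero hm' hP0)
    simp [this]
  rw [srFreeStep_Iio hm, srFreeStep_Iio hm, srFreeStep_Iio_div hc hm', srFreeStep_Iio_div hc hm']
  refine (h.one_add hc hl hm').lintegral_mul_le (antitone_measure_Iio_div (hs.le.trans hst))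
    (fun y => prob_le_one) (fun y => measure_mono (Iio_subset_Iio ?_))
    (fun x y hxy => hP.measure_Iio_div_mul_le hst hxy)
  have : 0 ≤ max y 0 := le_max_right _ _
  gcongr

/-- Beyond `A` the denominator of the monotone ratio is frozen while the numerator can only grow; `A
≤ c * A'` ensures that the numerator is not frozen earlier. -/
lemma RevHazardScaledLE.restrict {m m' : Measure ℝ} {c A A' : ℝ} (hc : 0 < c)
    (hA : A ≤ c * A') (h : RevHazardScaledLE c m m') :
    RevHazardScaledLE c (m.restrict (Iio A)) (m'.restrict (Iio A')) := by
  intro s t hst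
  simp only [Measure.restrict_apply measurableSet_Iio, Iio_inter_Iio]
  rcases le_total s A with hsA | hsA
  · have := h s (min t A) (le_min hst hsA)
    rw [min_eq_left hsA]
    calc m (Iio (min t A)) * m' (Iio (min (s / c) A'))
        ≤ m (Iio (min t A)) * m' (Iio (s / c)) := by
          gcongr
          exact min_le_left _ _
      _ ≤ m (Iio s) * m' (Iio (min t A / c)) := this
      _ ≤ m (Iio s) * m' (Iio (min (t / c) A')) := by
          gcongr
          refine le_min (by gcongr; exact min_le_left _ _) ?_
          rw [div_le_iff₀ hc, mul_comm]
          exact (min_le_right _ _).trans hA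
  · rw [min_eq_right hsA, min_eq_right (hsA.trans hst)]
    gcongr

lemma RevHazardScaledLE.srStep [IsProbabilityMeasure P] [IsFiniteMeasure m] {m' : Measure ℝ}
    [IsFiniteMeasure m'] {c A A' : ℝ} (hc : 1 ≤ c)
    (hP : LogConcaveLaw P) (hP0 : P (Iic 0) = 0) (hm : m (Iio 0) = 0) (hm' : m' (Iio 0) = 0)
    (h : RevHazardScaledLE c m m') (hl : LogConcaveLaw m') (hA : A ≤ c * A') :
    RevHazardScaledLE c (srStep A P m) (srStep A' P m') :=
  (h.srFreeStep hc hP hP0 hm hm' hl).restrict (by linarith) hA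

end

/-! ### Chains started at 0, ordered in the threshold and in time. -/

section

variable {P : Measure ℝ} [IsProbabilityMeasure P]

lemma dirac_zero_Iio : Measure.dirac (0 : ℝ) (Iio 0) = 0 := by simp

/-- The killed chains started at `0` are ordered by the reversed hazard rate, in the scale of
their thresholds. -/
lemma revHazardScaledLE_srChain (hP : LogConcaveLaw P) (hP0 : P (Iic 0) = 0) {c A A' : ℝ}
    (hc : 1 ≤ c) (hA0 : 0 ≤ A') (hA : A ≤ c * A') (n : ℕ) :
    RevHazardScaledLE c (srChain A P (Measure.dirac 0) n) (srChain A' P (Measure.dirac 0) n) := by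
  induction n generalizing c A A' with
  | zero =>
    have hc0 : 0 < c := by linarith
    intro s t hst
    simp only [srChain]
    rcases le_or_gt s 0 with hs | hs
    · have : Measure.dirac (0 : ℝ) (Iio (s / c)) = 0 :=
        measure_mono_null (Iio_subset_Iio (div_nonpos_of_nonpos_of_nonneg hs hc0.le))
          dirac_zero_Iio
      simp [this]
    · have h : ∀ u : ℝ, 0 < u → Measure.dirac (0 : ℝ) (Iio u) = 1 := fun u hu => by
        rw [Measure.dirac_apply' _ measurableSet_Iio]
        simp [hu]
      rw [h _ hs, h _ (hs.trans_le hst), h _ (div_pos hs hc0), h _ (div_pos (hs.trans_le hst) hc0)]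
  | succ n ih =>
    -- The log-concavity required of the second chain is the induction hypothesis with both
    -- thresholds equal to `A'`; this is why `c`, `A` and `A'` are generalised.
    refine RevHazardScaledLE.srStep hc hP hP0 (srChain_Iio_zero dirac_zero_Iio hP0 n)
      (srChain_Iio_zero dirac_zero_Iio hP0 n) (ih hc hA0 hA) (fun k hk => ih hk hA0 ?_) hA
    nlinarith

lemma logConcaveLaw_srChain (hP : LogConcaveLaw P) (hP0 : P (Iic 0) = 0) {A : ℝ} (hA : 0 ≤ A)
    (n : ℕ) : LogConcaveLaw (srChain A P (Measure.dirac 0) n) :=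
  fun _ hc => revHazardScaledLE_srChain hP hP0 hc hA (by nlinarith) n

lemma revHazardScaledLE_one {m m' : Measure ℝ} :
    RevHazardScaledLE 1 m m' ↔ RevHazardLE m m' := by
  simp [RevHazardScaledLE, RevHazardLE]

/-- The chain starts at its lowest point, so times `0` and `1` are ordered; each further step
preserves the order. This gives monotonicity in time of the conditional laws. -/
lemma revHazardLE_srChain_succ (hP : LogConcaveLaw P) (hP0 : P (Iic 0) = 0) {A : ℝ} (hA : 0 ≤ A)
    (n : ℕ) : RevHazardLE (srChain A P (Measure.dirac 0) n)
      (srChain A P (Measure.dirac 0) (n + 1)) := by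
  rw [← revHazardScaledLE_one]
  induction n with
  | zero =>
    intro s t hst
    simp only [srChain, div_one]
    rcases le_or_gt s 0 with hs | hs
    · have : srStep A P (Measure.dirac 0) (Iio s) = 0 :=
        measure_mono_null (fun x hx => (lt_of_lt_of_le hx hs).le)
          (srStep_Iic_zero dirac_zero_Iio hP0)
      simp [this]
    · have h : ∀ u : ℝ, 0 < u → Measure.dirac (0 : ℝ) (Iio u) = 1 := fun u hu => by
        rw [Measure.dirac_apply' _ measurableSet_Iio]
        simp [hu]
      rw [h _ hs, h _ (hs.trans_le hst)]
      gcongr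
  | succ n ih =>
    exact RevHazardScaledLE.srStep le_rfl hP hP0 (srChain_Iio_zero dirac_zero_Iio hP0 n)
      (srChain_Iio_zero dirac_zero_Iio hP0 (n + 1)) ih (logConcaveLaw_srChain hP hP0 hA (n + 1))
      (by simp)

end

/-! ### Random times -/

lemma enat_toENNReal_eq_tsum (t : ℕ∞) :
    (t : ℝ≥0∞) = ∑' n : ℕ, if (n : ℕ∞) < t then (1 : ℝ≥0∞) else 0 := by
  induction t with
  | top => simp
  | coe k =>
    rw [tsum_eq_sum (s := Finset.range k)]
    · rw [Finset.sum_congr rfl (g := fun _ => 1)]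
      · simp
      · intro n hn
        simp [Finset.mem_range.1 hn]
    · intro n hn
      simp only [Finset.mem_range] at hn
      simp [hn]

lemma lintegral_enat_eq_tsum {Ω : Type*} [MeasurableSpace Ω] (P : Measure Ω) (T : Ω → ℕ∞)
    (hT : ∀ n : ℕ, MeasurableSet {ω | (n : ℕ∞) < T ω}) :
    ∫⁻ ω, ((T ω : ℕ∞) : ℝ≥0∞) ∂P = ∑' n : ℕ, P {ω | (n : ℕ∞) < T ω} := by
  simp_rw [enat_toENNReal_eq_tsum]
  rw [lintegral_tsum]
  · refine tsum_congr fun n => ?_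
    rw [← lintegral_indicator_one (hT n)]
    refine lintegral_congr fun ω => ?_
    simp [indicator]
  · exact fun n => (Measurable.ite (hT n) measurable_const measurable_const).aemeasurable

lemma meanTime_eq_tsum {Ω : Type*} [MeasurableSpace Ω] (P : Measure Ω) (T : Ω → ℕ∞)
    (hT : ∀ n : ℕ, MeasurableSet {ω | (n : ℕ∞) < T ω}) :
    meanTime P T = ∑' n : ℕ, P {ω | (n : ℕ∞) < T ω} :=
  lintegral_enat_eq_tsum P T hT

lemma meanDelay_eq_tsum {Ω : Type*} [MeasurableSpace Ω] (P : Measure Ω) (T : Ω → ℕ∞)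
    (hT : ∀ n : ℕ, MeasurableSet {ω | (n : ℕ∞) < T ω}) (ν : ℕ) :
    meanDelay P T ν
      = ∑' k : ℕ, (P {ω | (ν : ℕ∞) < T ω})⁻¹ * P {ω | ((ν + k : ℕ) : ℕ∞) < T ω} := by
  have hset : ∀ k : ℕ, {ω | (k : ℕ∞) < T ω - (ν : ℕ∞)} = {ω | ((ν + k : ℕ) : ℕ∞) < T ω} := by
    intro k
    ext ω
    simp only [mem_ofPred_eq]
    rw [lt_tsub_iff_left]
    push_cast
    rfl
  rw [meanDelay, lintegral_enat_eq_tsum]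
  · refine tsum_congr fun k => ?_
    rw [hset, cond_apply (hT ν), inter_eq_right.2]
    intro ω hω
    refine lt_of_le_of_lt ?_ (mem_ofPred_eq ▸ hω)
    exact_mod_cast Nat.le_add_right ν k
  · intro k
    rw [hset]
    exact hT _

/-! ### Resampling one coordinate of a product measure -/

/-- The form in which independence is used: a path functional may be integrated with a fresh draw in
coordinate `n`. -/
lemma infinitePi_map_update {X : ℕ → Type*} [∀ i, MeasurableSpace (X i)]
    (μ : (i : ℕ) → Measure (X i)) [∀ i, IsProbabilityMeasure (μ i)] (n : ℕ) :
    ((Measure.infinitePi μ).prod (μ n)).map (fun p => Function.update p.1 n p.2)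
      = Measure.infinitePi μ := by
  have hmeas : Measurable fun p : ((i : ℕ) → X i) × X n => Function.update p.1 n p.2 := by
    rw [measurable_pi_iff]
    intro i
    rcases eq_or_ne i n with rfl | hi
    · simpa using measurable_snd
    · simp only [Function.update_of_ne hi]
      fun_prop
  refine Measure.eq_infinitePi μ fun s t ht => ?_
  rw [Measure.map_apply hmeas (MeasurableSet.pi s.countable_toSet fun i _ => ht i)]
  have hpre : (fun p : ((i : ℕ) → X i) × X n => Function.update p.1 n p.2) ⁻¹' (Set.pi s t)
      = (Set.pi (s.erase n) t) ×ˢ (if n ∈ s then t n else univ) := by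
    ext p
    simp only [mem_preimage, Set.mem_pi, Finset.mem_coe, mem_prod, Finset.mem_erase]
    constructor
    · intro h
      refine ⟨fun i hi => ?_, ?_⟩
      · have := h i hi.2
        rwa [Function.update_of_ne hi.1] at this
      · split_ifs with hn
        · simpa using h n hn
        · trivial
    · rintro ⟨h1, h2⟩ i hi
      rcases eq_or_ne i n with rfl | hne
      · simpa [hi] using h2
      · rw [Function.update_of_ne hne]
        exact h1 i ⟨hne, hi⟩
  rw [hpre, Measure.prod_prod, Measure.infinitePi_pi μ fun i _ => ht i]
  split_ifs with hn
  · rw [Finset.prod_erase_mul s (fun i => μ i (t i)) hn]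
  · rw [measure_univ, mul_one, Finset.erase_eq_of_notMem hn]

/-! ### The statistic and its stopping time -/

section

variable {𝓧 : Type*} {f g : 𝓧 → ℝ} {A r : ℝ}

lemma lt_srTime_iff {ω : ℕ → 𝓧} {n : ℕ} :
    (n : ℕ∞) < srTime f g A r ω ↔ ∀ j, 1 ≤ j → j ≤ n → srStat f g r ω j < A := by
  rw [← ENat.add_one_le_iff (ENat.natCast_ne_top n), srTime, le_iInf₂_iff]
  constructor
  · intro h j h1 hj
    by_contra! hA
    have := h j ⟨h1, hA⟩
    have h2 : n + 1 ≤ j := by exact_mod_cast this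
    omega
  · intro h j hj
    by_contra! hlt
    have h2 : j < n + 1 := by exact_mod_cast hlt
    exact absurd (h j hj.1 (by omega)) (not_lt.2 hj.2)

lemma lt_srTime_succ_iff {ω : ℕ → 𝓧} {n : ℕ} :
    ((n + 1 : ℕ) : ℕ∞) < srTime f g A r ω
      ↔ (n : ℕ∞) < srTime f g A r ω ∧ srStat f g r ω (n + 1) < A := by
  rw [lt_srTime_iff, lt_srTime_iff]
  constructor
  · exact fun h => ⟨fun j h1 hj => h j h1 (by omega), h _ (by omega) le_rfl⟩
  · rintro ⟨h, hA⟩ j h1 hj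
    rcases Nat.lt_or_ge n j with hn | hn
    · obtain rfl : j = n + 1 := by omega
      exact hA
    · exact h j h1 hn

lemma srStat_update {ω : ℕ → 𝓧} {n : ℕ} (x : 𝓧) {j : ℕ} (hj : j ≤ n) :
    srStat f g r (Function.update ω n x) j = srStat f g r ω j := by
  induction j with
  | zero => rfl
  | succ j ih =>
    rw [srStat, srStat, ih (by omega), Function.update_of_ne (by omega)]

lemma lt_srTime_update_iff {ω : ℕ → 𝓧} {n : ℕ} (x : 𝓧) :
    (n : ℕ∞) < srTime f g A r (Function.update ω n x) ↔ (n : ℕ∞) < srTime f g A r ω := by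
  rw [lt_srTime_iff, lt_srTime_iff]
  refine forall_congr' fun j => imp_congr_right fun _ => ?_
  exact imp_congr_right fun hj => by rw [srStat_update x hj]

variable [MeasurableSpace 𝓧]

lemma measurable_likRatio (hf : Measurable f) (hg : Measurable g) :
    Measurable (likRatio f g) := hg.div hf

lemma measurable_srStat_prod (hf : Measurable f) (hg : Measurable g) (n : ℕ) :
    Measurable fun p : ℝ × (ℕ → 𝓧) => srStat f g p.1 p.2 n := by
  induction n with
  | zero => exact measurable_fst
  | succ n ih =>
    exact (measurable_const.add ih).mul
      ((measurable_likRatio hf hg).comp ((measurable_pi_apply n).comp measurable_snd))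

lemma measurable_srStat (hf : Measurable f) (hg : Measurable g) (r : ℝ) (n : ℕ) :
    Measurable fun ω : ℕ → 𝓧 => srStat f g r ω n :=
  (measurable_srStat_prod hf hg n).comp (measurable_const.prodMk measurable_id)

lemma measurableSet_lt_srTime_prod (hf : Measurable f) (hg : Measurable g) (A : ℝ) (n : ℕ) :
    MeasurableSet {p : ℝ × (ℕ → 𝓧) | (n : ℕ∞) < srTime f g A p.1 p.2} := by
  simp only [lt_srTime_iff, ofPred_forall]
  exact MeasurableSet.iInter fun j => MeasurableSet.iInter fun _ => MeasurableSet.iInter fun _ =>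
    measurableSet_lt (measurable_srStat_prod hf hg j) measurable_const

lemma measurableSet_lt_srTime (hf : Measurable f) (hg : Measurable g) (A r : ℝ) (n : ℕ) :
    MeasurableSet {ω : ℕ → 𝓧 | (n : ℕ∞) < srTime f g A r ω} :=
  (measurable_const.prodMk measurable_id) (measurableSet_lt_srTime_prod hf hg A n)

lemma isProbabilityMeasure_densityLaw {lam : Measure 𝓧} {h : 𝓧 → ℝ}
    (h1 : ∫⁻ x, ENNReal.ofReal (h x) ∂lam = 1) : IsProbabilityMeasure (densityLaw lam h) :=
  ⟨by rw [densityLaw, withDensity_apply _ MeasurableSet.univ, setLIntegral_univ, h1]⟩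

/-- The law of the likelihood ratio of one observation with density `h`. -/
def likLaw (lam : Measure 𝓧) (f g h : 𝓧 → ℝ) : Measure ℝ :=
  (densityLaw lam h).map (likRatio f g)

lemma isProbabilityMeasure_likLaw {lam : Measure 𝓧} {h : 𝓧 → ℝ} (hf : Measurable f)
    (hg : Measurable g) (h1 : ∫⁻ x, ENNReal.ofReal (h x) ∂lam = 1) :
    IsProbabilityMeasure (likLaw lam f g h) := by
  have := isProbabilityMeasure_densityLaw h1
  exact Measure.isProbabilityMeasure_map (measurable_likRatio hf hg).aemeasurable

/-- The law of the statistic after `n` observations, on the event that there was no alarm. -/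
def srPathLaw (μ : ℕ → Measure 𝓧) (f g : 𝓧 → ℝ) (A r : ℝ) (n : ℕ) : Measure ℝ :=
  ((Measure.infinitePi μ).restrict {ω | (n : ℕ∞) < srTime f g A r ω}).map
    fun ω => srStat f g r ω n

section

variable (μ : ℕ → Measure 𝓧) [∀ i, IsProbabilityMeasure (μ i)]

omit [∀ i, IsProbabilityMeasure (μ i)] in
lemma srPathLaw_apply (hf : Measurable f) (hg : Measurable g) (n : ℕ) {s : Set ℝ}
    (hs : MeasurableSet s) :
    srPathLaw μ f g A r n s = Measure.infinitePi μ
      ({ω | (n : ℕ∞) < srTime f g A r ω} ∩ {ω | srStat f g r ω n ∈ s}) := by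
  rw [srPathLaw, Measure.map_apply (measurable_srStat hf hg r n) hs,
    Measure.restrict_apply (measurable_srStat hf hg r n hs), inter_comm]
  rfl

omit [∀ i, IsProbabilityMeasure (μ i)] in
lemma srPathLaw_univ (hf : Measurable f) (hg : Measurable g) (n : ℕ) :
    srPathLaw μ f g A r n univ = Measure.infinitePi μ {ω | (n : ℕ∞) < srTime f g A r ω} := by
  simp [srPathLaw_apply μ hf hg n MeasurableSet.univ]

lemma srPathLaw_zero : srPathLaw μ f g A r 0 = Measure.dirac r := by
  have h : {ω : ℕ → 𝓧 | ((0 : ℕ) : ℕ∞) < srTime f g A r ω} = univ := by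
    ext ω
    simp only [mem_univ, iff_true, mem_ofPred_eq]
    rw [lt_srTime_iff]
    intro j h1 h2
    omega
  rw [srPathLaw, h, Measure.restrict_univ]
  simp only [srStat]
  rw [Measure.map_const, measure_univ, one_smul]

/-- The Markov property. The statistic at time `n` and the event of no alarm up to `n` ignore
coordinate `n`, which carries observation `n + 1`; resampling it supplies an independent ratio. -/
lemma srPathLaw_succ (hf : Measurable f) (hg : Measurable g) (n : ℕ) :
    srPathLaw μ f g A r (n + 1)
      = srStep A ((μ n).map (likRatio f g)) (srPathLaw μ f g A r n) := by
  have hL := measurable_likRatio hf hg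
  have hR := measurable_srStat hf hg r n
  have hT := measurableSet_lt_srTime hf hg A r n
  have instP : IsProbabilityMeasure ((μ n).map (likRatio f g)) :=
    Measure.isProbabilityMeasure_map hL.aemeasurable
  have instM : IsFiniteMeasure (srPathLaw μ f g A r n) := by
    unfold srPathLaw
    infer_instance
  ext s hs
  set v : ℝ → ℝ≥0∞ := s.indicator 1 with hv
  have hvm : Measurable v := measurable_const.indicator hs
  rw [← lintegral_indicator_one hs, ← lintegral_indicator_one hs, ← hv, lintegral_srStep hvm,
    srPathLaw, srPathLaw, lintegral_map (measurable_srBack hvm) hR, ← lintegral_indicator hT,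
    lintegral_map hvm (measurable_srStat hf hg r (n + 1)),
    ← lintegral_indicator (measurableSet_lt_srTime hf hg A r (n + 1))]
  have hF : Measurable ({ω | ((n + 1 : ℕ) : ℕ∞) < srTime f g A r ω}.indicator
      fun ω => v (srStat f g r ω (n + 1))) :=
    (hvm.comp (measurable_srStat hf hg r (n + 1))).indicator
      (measurableSet_lt_srTime hf hg A r (n + 1))
  have hup : Measurable fun p : (ℕ → 𝓧) × 𝓧 => Function.update p.1 n p.2 := by
    rw [measurable_pi_iff]
    intro i
    rcases eq_or_ne i n with rfl | hi
    · simpa using measurable_snd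
    · simp only [Function.update_of_ne hi]
      fun_prop
  conv_lhs => rw [← infinitePi_map_update μ n]
  rw [lintegral_map hF hup, lintegral_prod]
  · refine lintegral_congr fun ω => ?_
    have hval : ∀ x, srStat f g r (Function.update ω n x) (n + 1)
        = (1 + srStat f g r ω n) * likRatio f g x := by
      intro x
      rw [srStat, srStat_update x le_rfl, Function.update_self]
    by_cases hω : (n : ℕ∞) < srTime f g A r ω
    · rw [indicator_of_mem (s := {ω | (n : ℕ∞) < srTime f g A r ω}) hω, lintegral_map]
      · refine lintegral_congr fun x => ?_
        simp only [indicator, mem_ofPred_eq, lt_srTime_succ_iff, lt_srTime_update_iff, hω,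
          true_and, hval, mem_Iio]
      · exact (hvm.indicator measurableSet_Iio).comp (measurable_const.mul measurable_id)
      · exact hL
    · rw [indicator_of_notMem (s := {ω | (n : ℕ∞) < srTime f g A r ω}) hω]
      rw [lintegral_eq_zero_iff']
      · refine ae_of_all _ fun x => ?_
        simp only [indicator, mem_ofPred_eq, lt_srTime_succ_iff, lt_srTime_update_iff, hω,
          false_and, if_false, Pi.zero_apply]
      · exact (hF.comp (hup.comp (measurable_const.prodMk measurable_id))).aemeasurable
  · exact (hF.comp hup).aemeasurable

end

/-! ### The change-point model expressed through the killed chain. -/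

variable {lam : Measure 𝓧}

lemma changeLaw_eq (ν : ℕ∞) : ∃ μ : ℕ → Measure 𝓧,
    changeLaw lam f g ν = Measure.infinitePi μ ∧
    (∀ i : ℕ, (i : ℕ∞) < ν → μ i = densityLaw lam f) ∧
    (∀ i : ℕ, ¬ (i : ℕ∞) < ν → μ i = densityLaw lam g) := by
  classical
  refine ⟨fun i : ℕ => if (i : ℕ∞) < ν then densityLaw lam f else densityLaw lam g, ?_,
    fun i hi => if_pos hi, fun i hi => if_neg hi⟩
  rw [changeLaw]

variable (hf : Measurable f) (hg : Measurable g)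
  (hf1 : ∫⁻ x, ENNReal.ofReal (f x) ∂lam = 1) (hg1 : ∫⁻ x, ENNReal.ofReal (g x) ∂lam = 1)

include hf1 hg1 in
lemma isProbabilityMeasure_changeLaw (ν : ℕ∞) : IsProbabilityMeasure (changeLaw lam f g ν) := by
  obtain ⟨μ, hμ, h1, h2⟩ := changeLaw_eq (lam := lam) (f := f) (g := g) ν
  have : ∀ i, IsProbabilityMeasure (μ i) := by
    intro i
    by_cases hi : (i : ℕ∞) < ν
    · rw [h1 i hi]; exact isProbabilityMeasure_densityLaw hf1
    · rw [h2 i hi]; exact isProbabilityMeasure_densityLaw hg1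
  rw [hμ]
  infer_instance

include hf hg hf1 hg1

/-- Up to time `ν` only pre-change observations enter, so the change point plays no role. -/
lemma changeLaw_inter_eq (n : ℕ) (ν : ℕ∞) (hn : n ≤ ν) {s : Set ℝ} (hs : MeasurableSet s) :
    changeLaw lam f g ν
      ({ω | (n : ℕ∞) < srTime f g A r ω} ∩ {ω | srStat f g r ω n ∈ s})
      = srChain A (likLaw lam f g f) (Measure.dirac r) n s := by
  obtain ⟨μ, hμ, h1, h2⟩ := changeLaw_eq (lam := lam) (f := f) (g := g) ν
  have : ∀ i, IsProbabilityMeasure (μ i) := by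
    intro i
    by_cases hi : (i : ℕ∞) < ν
    · rw [h1 i hi]; exact isProbabilityMeasure_densityLaw hf1
    · rw [h2 i hi]; exact isProbabilityMeasure_densityLaw hg1
  have key : ∀ n : ℕ, n ≤ ν →
      srPathLaw μ f g A r n = srChain A (likLaw lam f g f) (Measure.dirac r) n := by
    intro n
    induction n with
    | zero => exact fun _ => srPathLaw_zero μ
    | succ n ih =>
      intro hn
      have hlt : (n : ℕ∞) < ν := lt_of_lt_of_le (by exact_mod_cast Nat.lt_succ_self n) hn
      rw [srPathLaw_succ μ hf hg, ih hlt.le, h1 n hlt]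
      rfl
  rw [hμ, ← srPathLaw_apply μ hf hg n hs, key n hn]

lemma changeLaw_top_inter_eq (n : ℕ) {s : Set ℝ} (hs : MeasurableSet s) :
    changeLaw lam f g ⊤
      ({ω | (n : ℕ∞) < srTime f g A r ω} ∩ {ω | srStat f g r ω n ∈ s})
      = srChain A (likLaw lam f g f) (Measure.dirac r) n s :=
  changeLaw_inter_eq hf hg hf1 hg1 n ⊤ le_top hs

lemma changeLaw_top_lt_srTime (n : ℕ) :
    changeLaw lam f g ⊤ {ω | (n : ℕ∞) < srTime f g A r ω}
      = srSurv A (likLaw lam f g f) n r := by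
  have := isProbabilityMeasure_likLaw (f := f) (g := g) hf hg hf1
  have h := changeLaw_top_inter_eq (A := A) (r := r) hf hg hf1 hg1 n MeasurableSet.univ
  simp only [mem_univ] at h
  rw [srChain_univ, lintegral_dirac' _ (measurable_srSurv n)] at h
  rw [← h]
  congr 1
  ext ω
  simp

/-- The pre-change part is kept as a law and the post-change part as a survival function; only the
former varies in the limit `ν → ∞`. -/
lemma changeLaw_lt_srTime (ν k : ℕ) :
    changeLaw lam f g ν {ω | ((ν + k : ℕ) : ℕ∞) < srTime f g A r ω}
      = ∫⁻ y, srSurv A (likLaw lam f g g) k y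
          ∂(srChain A (likLaw lam f g f) (Measure.dirac r) ν) := by
  have hPf := isProbabilityMeasure_likLaw (f := f) (g := g) hf hg hf1
  have hPg := isProbabilityMeasure_likLaw (f := f) (g := g) hf hg hg1
  obtain ⟨μ, hμ, h1, h2⟩ := changeLaw_eq (lam := lam) (f := f) (g := g) ν
  have : ∀ i, IsProbabilityMeasure (μ i) := by
    intro i
    by_cases hi : (i : ℕ∞) < ν
    · rw [h1 i hi]; exact isProbabilityMeasure_densityLaw hf1
    · rw [h2 i hi]; exact isProbabilityMeasure_densityLaw hg1
  have key : ∀ k : ℕ, srPathLaw μ f g A r (ν + k) = srChain A (likLaw lam f g g)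
      (srChain A (likLaw lam f g f) (Measure.dirac r) ν) k := by
    intro k
    induction k with
    | zero =>
      ext s hs
      rw [Nat.add_zero, srPathLaw_apply μ hf hg ν hs, ← hμ,
        changeLaw_inter_eq hf hg hf1 hg1 ν ν le_rfl hs]
      rfl
    | succ k ih =>
      have hlt : ¬ ((ν + k : ℕ) : ℕ∞) < ν := by
        rw [not_lt]
        exact_mod_cast Nat.le_add_right ν k
      rw [← Nat.add_assoc, srPathLaw_succ μ hf hg, ih, h2 _ hlt]
      rfl
  rw [hμ, ← srPathLaw_univ μ hf hg, key, srChain_univ]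

lemma changeLaw_lt_srTime_self (ν : ℕ) :
    changeLaw lam f g ν {ω | (ν : ℕ∞) < srTime f g A r ω}
      = srChain A (likLaw lam f g f) (Measure.dirac r) ν univ := by
  have := changeLaw_lt_srTime (A := A) (r := r) hf hg hf1 hg1 ν 0
  simpa [srSurv] using this

lemma srARL_eq_tsum :
    srARL lam f g A r = ∑' n : ℕ, srSurv A (likLaw lam f g f) n r := by
  rw [srARL, meanTime_eq_tsum _ _ (measurableSet_lt_srTime hf hg A r)]
  exact tsum_congr fun n => changeLaw_top_lt_srTime hf hg hf1 hg1 n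

lemma srMeanDelay_eq_tsum (ν : ℕ) :
    meanDelay (changeLaw lam f g ν) (srTime f g A r) ν
      = ∑' k : ℕ, (srChain A (likLaw lam f g f) (Measure.dirac r) ν univ)⁻¹ *
          ∫⁻ y, srSurv A (likLaw lam f g g) k y
            ∂(srChain A (likLaw lam f g f) (Measure.dirac r) ν) := by
  rw [meanDelay_eq_tsum _ _ (measurableSet_lt_srTime hf hg A r)]
  refine tsum_congr fun k => ?_
  rw [changeLaw_lt_srTime hf hg hf1 hg1, changeLaw_lt_srTime_self hf hg hf1 hg1]

omit hf hg hf1 hg1 in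
lemma lintegral_lintegral_srChain_dirac {P Q : Measure ℝ} [IsProbabilityMeasure P]
    [IsFiniteMeasure Q] {v : ℝ → ℝ≥0∞} (hv : Measurable v) (n : ℕ) :
    ∫⁻ r, ∫⁻ y, v y ∂(srChain A P (Measure.dirac r) n) ∂Q = ∫⁻ y, v y ∂(srChain A P Q n) := by
  induction n generalizing v with
  | zero =>
    refine lintegral_congr fun r => ?_
    exact lintegral_dirac' _ hv
  | succ n ih =>
    simp only [srChain, lintegral_srStep hv]
    exact ih (measurable_srBack hv)

lemma prod_changeLaw_lt_srTime (Q : Measure ℝ) [IsFiniteMeasure Q] (ν k : ℕ) :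
    (Q.prod (changeLaw lam f g ν)) {p | ((ν + k : ℕ) : ℕ∞) < srTime f g A p.1 p.2}
      = ∫⁻ y, srSurv A (likLaw lam f g g) k y ∂(srChain A (likLaw lam f g f) Q ν) := by
  have hPf := isProbabilityMeasure_likLaw (f := f) (g := g) hf hg hf1
  have hPg := isProbabilityMeasure_likLaw (f := f) (g := g) hf hg hg1
  have := isProbabilityMeasure_changeLaw (f := f) (g := g) (lam := lam) hf1 hg1 ν
  rw [Measure.prod_apply (measurableSet_lt_srTime_prod hf hg A _),
    ← lintegral_lintegral_srChain_dirac (measurable_srSurv k)]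
  exact lintegral_congr fun r => changeLaw_lt_srTime hf hg hf1 hg1 ν k

lemma srpMeanDelay_eq_tsum (Q : Measure ℝ) [IsFiniteMeasure Q] (ν : ℕ) :
    meanDelay (Q.prod (changeLaw lam f g ν)) (fun p => srTime f g A p.1 p.2) ν
      = ∑' k : ℕ, (srChain A (likLaw lam f g f) Q ν univ)⁻¹ *
          ∫⁻ y, srSurv A (likLaw lam f g g) k y ∂(srChain A (likLaw lam f g f) Q ν) := by
  rw [meanDelay_eq_tsum _ _ (measurableSet_lt_srTime_prod hf hg A)]
  refine tsum_congr fun k => ?_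
  have h0 := prod_changeLaw_lt_srTime (A := A) hf hg hf1 hg1 Q ν 0
  rw [prod_changeLaw_lt_srTime hf hg hf1 hg1]
  simp only [Nat.add_zero, srSurv, lintegral_const, one_mul] at h0
  rw [h0]

lemma srpARL_eq_lintegral (Q : Measure ℝ) [IsFiniteMeasure Q] :
    srpARL lam f g A Q = ∫⁻ r, srARL lam f g A r ∂Q := by
  have hPf := isProbabilityMeasure_likLaw (f := f) (g := g) hf hg hf1
  have := isProbabilityMeasure_changeLaw (f := f) (g := g) (lam := lam) hf1 hg1 ⊤
  rw [srpARL, meanTime_eq_tsum _ _ (measurableSet_lt_srTime_prod hf hg A)]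
  simp_rw [srARL_eq_tsum (A := A) hf hg hf1 hg1]
  rw [lintegral_tsum fun n => (measurable_srSurv n).aemeasurable]
  refine tsum_congr fun n => ?_
  rw [Measure.prod_apply (measurableSet_lt_srTime_prod hf hg A _)]
  exact lintegral_congr fun r => changeLaw_top_lt_srTime hf hg hf1 hg1 n

end

/-! ### Survival probabilities of the killed chain -/

section

variable {A : ℝ} {P : Measure ℝ}

/-- Run both chains with the same ratios: `z ≤ c * y` and `1 ≤ c` give `1 + z ≤ c * (1 + y)`, so the
scaled order persists and the second chain stays below `A` as long as the first stays below `A'`. -/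
lemma srSurv_le_srSurv (hP0 : P (Iic 0) = 0) {A' c : ℝ} (hc : 1 ≤ c) (hA : c * A' ≤ A) (n : ℕ)
    {y z : ℝ} (hy : 0 ≤ y) (hz : 0 ≤ z) (hzy : z ≤ c * y) :
    srSurv A' P n y ≤ srSurv A P n z := by
  induction n generalizing y z with
  | zero => exact le_refl _
  | succ n ih =>
    refine lintegral_mono_ae ?_
    filter_upwards [ae_pos_of_measure_Iic hP0] with x hx
    have h1 : (1 + z) * x ≤ c * ((1 + y) * x) := by nlinarith
    by_cases h : (1 + y) * x < A'
    · have h2 : (1 + z) * x < A := by nlinarith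
      rw [indicator_of_mem (mem_Iio.2 h), indicator_of_mem (mem_Iio.2 h2)]
      exact ih (by positivity) (by positivity) h1
    · rw [indicator_of_notMem (by simpa using h)]
      exact zero_le

lemma srSurv_antitoneOn (hP0 : P (Iic 0) = 0) (n : ℕ) : AntitoneOn (srSurv A P n) (Ici 0) :=
  fun _ hx _ hy hxy => srSurv_le_srSurv hP0 le_rfl (one_mul A).le n hy hx (by rwa [one_mul])

lemma srSurv_succ_le [IsProbabilityMeasure P] (n : ℕ) (y : ℝ) : srSurv A P
    (n + 1) y ≤ srSurv A P n y := by
  induction n generalizing y with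
  | zero => exact srSurv_le_one 1 y
  | succ n ih => exact lintegral_mono fun x => indicator_le_indicator (ih _)

lemma srSurv_anti [IsProbabilityMeasure P] (y : ℝ) : Antitone fun n => srSurv A P n y :=
  antitone_nat_of_succ_le fun n => srSurv_succ_le n y

/-- The threshold `A` is positive, and from each point below it the chain has a positive chance to
stay below it in one step (uniformly: `z` may be arbitrarily close to `A / (1 + A)`). -/
def SRViable (A : ℝ) (P : Measure ℝ) : Prop :=
  0 < A ∧ ∀ z, A / (1 + A) < z → P (Iio z) ≠ 0

lemma div_one_add_lt {A y : ℝ} (hA : 0 < A) (hy : 0 ≤ y) (hyA : y < A) :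
    A / (1 + A) < A / (1 + y) :=
  div_lt_div_of_pos_left hA (by linarith) (by linarith)

/-- Only the first step needs a separate hypothesis, because the head start may lie at or above the
threshold; afterwards viability applies. -/
lemma SRViable.srSurv_ne_zero [IsProbabilityMeasure P] (h : SRViable A P) (hP0 : P (Iic 0) = 0)
    (n : ℕ) {y : ℝ}
    (hy : 0 ≤ y) (h1 : P (Iio (A / (1 + y))) ≠ 0) : srSurv A P n y ≠ 0 := by
  induction n generalizing y with
  | zero => exact one_ne_zero
  | succ n ih =>
    intro h0
    apply h1
    rw [srSurv, lintegral_eq_zero_iff'] at h0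
    · have : ∀ᵐ x ∂P, ¬ x < A / (1 + y) := by
        filter_upwards [h0, ae_pos_of_measure_Iic hP0] with x hx hx0 hlt
        have hlt' : (1 + y) * x < A := by
          rwa [lt_div_iff₀ (by linarith), mul_comm] at hlt
        rw [indicator_of_mem (mem_Iio.2 hlt')] at hx
        have hpos : 0 ≤ (1 + y) * x := by positivity
        exact ih hpos (h.2 _ (div_one_add_lt h.1 hpos hlt')) hx
      rw [ae_iff] at this
      simpa [Iio] using this
    · exact (((measurable_srSurv n).indicator measurableSet_Iio).comp
        (measurable_const.mul measurable_id)).aemeasurable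

lemma SRViable.srSurv_ne_zero_of_lt [IsProbabilityMeasure P] (h : SRViable A P)
    (hP0 : P (Iic 0) = 0) (n : ℕ) {y : ℝ}
    (hy : 0 ≤ y) (hyA : y < A) : srSurv A P n y ≠ 0 :=
  h.srSurv_ne_zero hP0 n hy (h.2 _ (div_one_add_lt h.1 hy hyA))

lemma srChain_dirac_univ [IsProbabilityMeasure P] (n : ℕ) (r : ℝ) :
    srChain A P (Measure.dirac r) n univ = srSurv A P n r := by
  rw [srChain_univ, lintegral_dirac' _ (measurable_srSurv n)]

/-- If the ratios are almost surely at least `z`, the chain dominates the recursion `a ↦ z * (1 +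
a)` started at `0`. -/
lemma srChain_Iio_eq_zero [IsProbabilityMeasure P] {z : ℝ} (hz0 : 0 ≤ z) (hz1 : z < 1)
    (hP0 : P (Iic 0) = 0)
    (hz : P (Iio z) = 0) (n : ℕ) :
    srChain A P (Measure.dirac 0) n (Iio (z / (1 - z) * (1 - z ^ n))) = 0 := by
  induction n with
  | zero => simp [srChain]
  | succ n ih =>
    refine nonpos_iff_eq_zero.1 ((Measure.restrict_apply_le _ _).trans ?_)
    rw [srFreeStep_apply measurableSet_Iio, nonpos_iff_eq_zero, lintegral_eq_zero_iff']
    · have hs : ∀ᵐ y ∂(srChain A P (Measure.dirac 0) n), z / (1 - z) * (1 - z ^ n) ≤ y := by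
        rw [ae_iff]
        simpa [Iio] using ih
      have hn0 := ae_nonneg_of_measure_Iio
        (srChain_Iio_zero (A := A) dirac_zero_Iio hP0 n)
      filter_upwards [hs, hn0] with y hy hy0
      refine measure_mono_null (fun x hx => ?_) hz
      simp only [mem_ofPred_eq, mem_Iio] at hx ⊢
      by_contra! hzx
      have e : z / (1 - z) * (1 - z ^ (n + 1)) = z * (1 + z / (1 - z) * (1 - z ^ n)) := by
        have : 1 - z ≠ 0 := by linarith
        field_simp
        ring
      rw [e] at hx
      nlinarith
    · exact (measurable_measure_prodMk_left (measurable_srMap measurableSet_Iio)).aemeasurable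

lemma srChain_univ_eq_zero {n : ℕ} {m : Measure ℝ} (h : srChain A P m (n + 1) (Iio A) = 0) :
    srChain A P m (n + 1) univ = 0 := by
  rw [← Iio_union_Ici (a := A)]
  exact measure_union_null h (srChain_succ_Ici n)

lemma srViable_of_srSurv_ne_zero [IsProbabilityMeasure P] (hP0 : P (Iic 0) = 0)
    (h : ∀ n, srSurv A P n 0 ≠ 0) :
    SRViable A P := by
  have hA : 0 < A := by
    by_contra! hA
    apply h 1
    rw [srSurv_one_eq le_rfl]
    refine measure_mono_null (fun x hx => ?_) hP0
    simp only [mem_Iio, add_zero, div_one] at hx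
    exact hx.le.trans hA
  refine ⟨hA, fun z hz hPz => ?_⟩
  have hA1 : A / (1 + A) < 1 := by
    rw [div_lt_one (by linarith)]
    linarith
  -- With `A / (1 + A) < w < 1`, the deterministic lower bound converges to `w / (1 - w) > A`, so no
  -- path would survive long.
  obtain ⟨w, hw1, hw2⟩ := exists_between (lt_min hz hA1)
  have hw0 : 0 < w := lt_trans (by positivity) hw1
  have hwz : P (Iio w) = 0 :=
    measure_mono_null (Iio_subset_Iio (hw2.le.trans (min_le_left _ _))) hPz
  have hw1' : w < 1 := hw2.trans_le (min_le_right _ _)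
  have hL : A < w / (1 - w) := by
    rw [lt_div_iff₀ (by linarith)]
    rw [div_lt_iff₀ (by linarith)] at hw1
    linarith
  have hlim : Tendsto (fun n : ℕ => w / (1 - w) * (1 - w ^ n)) atTop (𝓝 (w / (1 - w) * (1 - 0))) :=
    (tendsto_const_nhds.sub (tendsto_pow_atTop_nhds_zero_of_lt_one hw0.le hw1')).const_mul _
  rw [sub_zero, mul_one] at hlim
  obtain ⟨n, hn⟩ := (((tendsto_add_atTop_iff_nat 1).2 hlim).eventually_const_lt hL).exists
  apply h (n + 1)
  rw [← srChain_dirac_univ]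
  exact srChain_univ_eq_zero (measure_mono_null (Iio_subset_Iio hn.le)
    (srChain_Iio_eq_zero hw0.le hw1' hP0 hwz (n + 1)))

/-- A ratio at least `1` raises the statistic by at least `1`, so `n` of them in a row cross the
threshold with positive probability. -/
lemma indicator_srSurv_ne_one [IsProbabilityMeasure P] (h1 : P (Ici 1) ≠ 0) (n : ℕ) {y : ℝ}
    (hy : 0 ≤ y) (hn : A ≤ y + n) : (Iio A).indicator (srSurv A P n) y ≠ 1 := by
  induction n generalizing y with
  | zero =>
    rw [indicator_of_notMem (by simpa using hn)]
    exact zero_ne_one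
  | succ n ih =>
    by_cases hyA : y < A
    · rw [indicator_of_mem (mem_Iio.2 hyA)]
      intro heq
      have hle : ∀ x, (Iio A).indicator (srSurv A P n) ((1 + y) * x) ≤ 1 := fun x =>
        (indicator_le_self _ _ _).trans (srSurv_le_one n _)
      have hae : (fun x => (Iio A).indicator (srSurv A P n) ((1 + y) * x)) =ᵐ[P] fun _ => 1 := by
        refine ae_eq_of_ae_le_of_lintegral_le (ae_of_all _ hle) ?_ measurable_const.aemeasurable ?_
        · exact (heq.trans_ne ENNReal.one_ne_top)
        · refine le_of_eq_of_le ?_ heq.ge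
          simp
      apply h1
      have : ∀ᵐ x ∂P, ¬ 1 ≤ x := by
        filter_upwards [hae] with x hx h1x
        refine ih (y := (1 + y) * x) (by positivity) ?_ hx
        push_cast at hn
        nlinarith
      rw [ae_iff] at this
      simpa [Ici] using this
    · rw [indicator_of_notMem (by simpa using hyA)]
      exact zero_ne_one

lemma exists_srSurv_lt_one [IsProbabilityMeasure P] (hP0 : P (Iic 0) = 0) (h1 : P (Ici 1) ≠ 0)
    (hA : 0 < A) :
    ∃ n, ∀ y, 0 ≤ y → srSurv A P n y < 1 := by
  obtain ⟨n, hn⟩ := exists_nat_ge A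
  have h0 : srSurv A P n 0 < 1 := by
    refine lt_of_le_of_ne (srSurv_le_one n 0) ?_
    have := indicator_srSurv_ne_one (A := A) h1 n le_rfl (by simpa using hn)
    rwa [indicator_of_mem (mem_Iio.2 hA)] at this
  exact ⟨n, fun y hy => (srSurv_antitoneOn hP0 n self_mem_Ici hy hy).trans_lt h0⟩

/-- Submultiplicative because `0` is the most favourable starting point. -/
lemma srSurv_add_le [IsProbabilityMeasure P] (hP0 : P (Iic 0) = 0) (m n : ℕ) :
    srSurv A P (m + n) 0 ≤ srSurv A P m 0 * srSurv A P n 0 := by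
  have h := lintegral_srSurv_srChain (A := A) (P := P) (m := Measure.dirac 0) n m
  rw [lintegral_dirac' _ (measurable_srSurv _)] at h
  rw [← h, ← srChain_dirac_univ n 0, ← lintegral_const]
  refine lintegral_mono_ae ?_
  filter_upwards [ae_nonneg_of_measure_Iio (srChain_Iio_zero (A := A) dirac_zero_Iio hP0 n)]
    with y hy
  exact srSurv_antitoneOn hP0 m self_mem_Ici hy hy

lemma tsum_srSurv_ne_top [IsProbabilityMeasure P] (hP0 : P (Iic 0) = 0) (h1 : P (Ici 1) ≠ 0)
    (hA : 0 < A) :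
    ∑' n, srSurv A P n 0 ≠ ∞ := by
  obtain ⟨m, hm⟩ := exists_srSurv_lt_one (A := A) hP0 h1 hA
  set ρ := srSurv A P m 0 with hρ
  have hρ1 : ρ < 1 := hm 0 le_rfl
  have hS : ∀ N : ℕ, ∑ n ∈ Finset.range N, srSurv A P n 0 ≤ m / (1 - ρ) := by
    intro N
    set S := ∑ n ∈ Finset.range N, srSurv A P n 0 with hSdef
    have hSt : S ≠ ∞ := by
      rw [hSdef]
      exact ENNReal.sum_ne_top.2 fun n _ =>
        ((srSurv_le_one n 0).trans_lt ENNReal.one_lt_top).ne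
    -- Partial sums are finite, so `ρ * S` may be subtracted.
    have h2 : S ≤ m + ρ * S := by
      calc S ≤ ∑ n ∈ Finset.range (m + N), srSurv A P n 0 :=
            Finset.sum_le_sum_of_subset (Finset.range_subset_range.2 (by omega))
        _ = ∑ n ∈ Finset.range m, srSurv A P n 0
            + ∑ n ∈ Finset.range N, srSurv A P (m + n) 0 := Finset.sum_range_add _ _ _
        _ ≤ ∑ n ∈ Finset.range m, 1 + ∑ n ∈ Finset.range N, ρ * srSurv A P n 0 := by
            gcongr with n hn n hn
            · exact srSurv_le_one n 0
            · exact srSurv_add_le hP0 m n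
        _ = m + ρ * S := by
            rw [← Finset.mul_sum, ← hSdef]
            simp
    rw [ENNReal.le_div_iff_mul_le (Or.inl (tsub_pos_of_lt hρ1).ne')
      (Or.inl (ENNReal.sub_ne_top ENNReal.one_ne_top)), mul_comm,
      ENNReal.sub_mul (fun _ _ => hSt), one_mul]
    exact tsub_le_iff_right.2 h2
  refine ne_top_of_le_ne_top ?_ (ENNReal.tsum_le_of_sum_range_le hS)
  exact ENNReal.div_ne_top (ENNReal.natCast_ne_top m) (tsub_pos_of_lt hρ1).ne'

/-- Left continuity on `[0, A)`, along sequences. -/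
def LeftContOn (A : ℝ) (v : ℝ → ℝ≥0∞) : Prop :=
  ∀ (u : ℕ → ℝ) (y : ℝ), 0 ≤ y → y < A → (∀ n, 0 ≤ u n) → (∀ n, u n ≤ y) →
    Tendsto u atTop (𝓝 y) → Tendsto (fun n => v (u n)) atTop (𝓝 (v y))

/-- When `y` is approached from the left, the killing indicator fails to converge at most at `x = A
/ (1 + y)`. Viability puts mass below that point, so it is not an atom. -/
lemma SRViable.leftContOn_srSurv [IsProbabilityMeasure P] (h : SRViable A P) (hP : LogConcaveLaw P)
    (hP0 : P (Iic 0) = 0)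
    (k : ℕ) : LeftContOn A (srSurv A P k) := by
  induction k with
  | zero => exact fun _ _ _ _ _ _ _ => tendsto_const_nhds
  | succ k ih =>
    intro u y hy hyA hu0 huy hlim
    have hz : P {A / (1 + y)} = 0 := by
      obtain ⟨w, hw1, hw2⟩ := exists_between (div_one_add_lt h.1 hy hyA)
      refine hP.measure_singleton (div_pos h.1 (by linarith)) fun h0 => h.2 w hw1 ?_
      exact measure_mono_null (Iio_subset_Iio hw2.le) h0
    refine tendsto_lintegral_of_dominated_convergence (fun _ => 1) (fun n => ?_) (fun n => ?_)
      (by simp) ?_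
    · exact ((measurable_srSurv k).indicator measurableSet_Iio).comp
        (measurable_const.mul measurable_id)
    · exact ae_of_all _ fun x => (indicator_le_self _ _ _).trans (srSurv_le_one k _)
    · have hne : ∀ᵐ x ∂P, x ≠ A / (1 + y) := by
        rw [ae_iff]
        simpa using hz
      filter_upwards [hne, ae_pos_of_measure_Iic hP0] with x hx hx0
      have hlim' : Tendsto (fun n => (1 + u n) * x) atTop (𝓝 ((1 + y) * x)) :=
        (tendsto_const_nhds.add hlim).mul_const x
      have hle : ∀ n, (1 + u n) * x ≤ (1 + y) * x := fun n => by
        have := huy n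
        gcongr
      rcases lt_trichotomy ((1 + y) * x) A with hlt | heq | hgt
      · rw [indicator_of_mem (mem_Iio.2 hlt)]
        have : ∀ n, (Iio A).indicator (srSurv A P k) ((1 + u n) * x)
            = srSurv A P k ((1 + u n) * x) := fun n =>
          indicator_of_mem (mem_Iio.2 ((hle n).trans_lt hlt)) _
        simp only [this]
        exact ih _ _ (by positivity) hlt (fun n => mul_nonneg (by linarith [hu0 n]) hx0.le) hle
          hlim'
      · exact absurd (by rw [← heq]; field_simp) hx
      · rw [indicator_of_notMem (by simpa using hgt.le)]
        refine tendsto_const_nhds.congr' ?_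
        filter_upwards [hlim'.eventually_const_lt hgt] with n hn
        rw [indicator_of_notMem (by simpa using hn.le)]

end

/-! ### Convergence of integrals of left-continuous antitone functions -/

/-- Within `[0, A)` a level set of `v` is everything, empty, or `Iic x` with `x < A`, closed by left
continuity. Treating the first case apart avoids any condition at `A`. -/
lemma tendsto_measure_level {μ μ' : ℕ → Measure ℝ} [∀ n, IsProbabilityMeasure (μ n)]
    [∀ n, IsProbabilityMeasure (μ' n)] {A : ℝ} {q : ℝ → ℝ≥0∞} {v : ℝ → ℝ≥0∞}
    (hμ0 : ∀ᶠ n in atTop, μ n (Iio 0) = 0 ∧ μ n (Ici A) = 0)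
    (hμ0' : ∀ᶠ n in atTop, μ' n (Iio 0) = 0 ∧ μ' n (Ici A) = 0)
    (hμ : ∀ x, Tendsto (fun n => μ n (Iic x)) atTop (𝓝 (q x)))
    (hμ' : ∀ x, Tendsto (fun n => μ' n (Iic x)) atTop (𝓝 (q x)))
    (hanti : AntitoneOn v (Ici 0)) (hleft : LeftContOn A v) (t : ℝ≥0∞) :
    ∃ l, Tendsto (fun n => μ n {y | t ≤ v y}) atTop (𝓝 l) ∧
      Tendsto (fun n => μ' n {y | t ≤ v y}) atTop (𝓝 l) := by
  have hcongr : ∀ {η : Measure ℝ} {s s' : Set ℝ}, η (Iio 0) = 0 → η (Ici A) = 0 →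
      (∀ y, 0 ≤ y → y < A → (y ∈ s ↔ y ∈ s')) → η s = η s' := by
    intro η s s' h0 hA' hss
    refine measure_congr ?_
    have a1 : ∀ᵐ y ∂η, 0 ≤ y := ae_nonneg_of_measure_Iio h0
    have a2 : ∀ᵐ y ∂η, y < A := by
      rw [ae_iff]
      simpa [Ici] using hA'
    filter_upwards [a1, a2] with y h1 h2
    exact propext (hss y h1 h2)
  by_cases hall : ∀ y, 0 ≤ y → y < A → t ≤ v y
  · refine ⟨1, ?_, ?_⟩
    · refine tendsto_const_nhds.congr' ?_
      filter_upwards [hμ0] with n hn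
      rw [hcongr hn.1 hn.2 (s' := univ) (fun y h0 h1 => by simpa using hall y h0 h1), measure_univ]
    · refine tendsto_const_nhds.congr' ?_
      filter_upwards [hμ0'] with n hn
      rw [hcongr hn.1 hn.2 (s' := univ) (fun y h0 h1 => by simpa using hall y h0 h1), measure_univ]
  push Not at hall
  obtain ⟨y₁, hy0, hyA, hyt⟩ := hall
  by_cases hnone : v 0 < t
  · have : ∀ y, 0 ≤ y → y < A → (y ∈ {y | t ≤ v y} ↔ y ∈ (∅ : Set ℝ)) := fun y h0 _ => by
      simpa using (hanti self_mem_Ici h0 h0).trans_lt hnone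
    refine ⟨0, ?_, ?_⟩
    · refine tendsto_const_nhds.congr' ?_
      filter_upwards [hμ0] with n hn
      rw [hcongr hn.1 hn.2 this, measure_empty]
    · refine tendsto_const_nhds.congr' ?_
      filter_upwards [hμ0'] with n hn
      rw [hcongr hn.1 hn.2 this, measure_empty]
  push Not at hnone
  set E := {y | 0 ≤ y ∧ t ≤ v y} with hE
  have hEb : ∀ y ∈ E, y ≤ y₁ := by
    intro y hy
    by_contra! hlt
    exact absurd (hy.2.trans (hanti hy0 hy.1 hlt.le)) (not_le.2 hyt)
  have hEne : E.Nonempty := ⟨0, le_rfl, hnone⟩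
  have hEbdd : BddAbove E := ⟨y₁, hEb⟩
  set x := sSup E with hx
  have hx0 : 0 ≤ x := le_csSup hEbdd ⟨le_rfl, hnone⟩
  have hxA : x < A := (csSup_le hEne hEb).trans_lt hyA
  have hxE : t ≤ v x := by
    obtain ⟨u, _, hlim, hu⟩ := exists_seq_tendsto_sSup hEne hEbdd
    exact ge_of_tendsto' (hleft u x hx0 hxA (fun n => (hu n).1)
      (fun n => le_csSup hEbdd (hu n)) hlim) fun n => (hu n).2
  have hset : ∀ y, 0 ≤ y → y < A → (y ∈ {y | t ≤ v y} ↔ y ∈ Iic x) := by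
    intro y h0 _
    exact ⟨fun hy => le_csSup hEbdd ⟨h0, hy⟩, fun hy => hxE.trans (hanti h0 hx0 hy)⟩
  refine ⟨q x, (hμ x).congr' ?_, (hμ' x).congr' ?_⟩
  · filter_upwards [hμ0] with n hn
    rw [hcongr hn.1 hn.2 hset]
  · filter_upwards [hμ0'] with n hn
    rw [hcongr hn.1 hn.2 hset]

/-- Two sequences of laws on `[0, A)` whose distribution functions have the same pointwise limits
give the same limits to the integrals of antitone functions that are left continuous on
`[0, A)`. -/
lemma exists_tendsto_lintegral {μ μ' : ℕ → Measure ℝ} [∀ n, IsProbabilityMeasure (μ n)]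
    [∀ n, IsProbabilityMeasure (μ' n)] {A : ℝ} {q : ℝ → ℝ≥0∞} {v : ℝ → ℝ≥0∞}
    (hμ0 : ∀ᶠ n in atTop, μ n (Iio 0) = 0 ∧ μ n (Ici A) = 0)
    (hμ0' : ∀ᶠ n in atTop, μ' n (Iio 0) = 0 ∧ μ' n (Ici A) = 0)
    (hμ : ∀ x, Tendsto (fun n => μ n (Iic x)) atTop (𝓝 (q x)))
    (hμ' : ∀ x, Tendsto (fun n => μ' n (Iic x)) atTop (𝓝 (q x)))
    (hv : Measurable v) (hv1 : ∀ y, v y ≤ 1)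
    (hanti : AntitoneOn v (Ici 0)) (hleft : LeftContOn A v) :
    ∃ l, Tendsto (fun n => ∫⁻ y, v y ∂(μ n)) atTop (𝓝 l) ∧
      Tendsto (fun n => ∫⁻ y, v y ∂(μ' n)) atTop (𝓝 l) := by
  choose L hL hL' using fun t : ℝ => tendsto_measure_level hμ0 hμ0' hμ hμ' hanti hleft
    (ENNReal.ofReal t)
  have key : ∀ η : ℕ → Measure ℝ, (∀ n, IsProbabilityMeasure (η n)) →
      (∀ t : ℝ, Tendsto (fun n => η n {y | ENNReal.ofReal t ≤ v y}) atTop (𝓝 (L t))) →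
      Tendsto (fun n => ∫⁻ y, v y ∂(η n)) atTop (𝓝 (∫⁻ t in Ioi (0 : ℝ), L t)) := by
    intro η hη hlim
    simp_rw [lintegral_eq_lintegral_meas_le_of_le_one _ hv hv1]
    refine tendsto_lintegral_of_dominated_convergence ((Iic (1 : ℝ)).indicator 1) (fun n => ?_)
      (fun n => ae_of_all _ fun t => ?_) ?_ (ae_of_all _ hlim)
    · refine Antitone.measurable fun s t hst => measure_mono fun y hy => ?_
      exact le_trans (b := ENNReal.ofReal t) (ENNReal.ofReal_le_ofReal hst) hy
    · by_cases ht : t ≤ 1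
      · rw [indicator_of_mem (mem_Iic.2 ht)]
        exact prob_le_one
      · have : {y | ENNReal.ofReal t ≤ v y} = ∅ := by
          ext y
          simp only [mem_ofPred_eq, mem_empty_iff_false, iff_false, not_le]
          refine (hv1 y).trans_lt ?_
          rw [← ENNReal.ofReal_one]
          exact (ENNReal.ofReal_lt_ofReal_iff (by linarith)).2 (not_le.1 ht)
        simp only [this, measure_empty]
        exact zero_le
    · rw [lintegral_indicator_one measurableSet_Iic, Measure.restrict_apply measurableSet_Iic,
        Iic_inter_Ioi, Real.volume_Ioc]
      exact ENNReal.ofReal_ne_top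
  exact ⟨_, key μ inferInstance hL, key μ' inferInstance hL'⟩

lemma tendsto_tsum_ennreal {a : ℕ → ℕ → ℝ≥0∞} {l b : ℕ → ℝ≥0∞}
    (hab : ∀ᶠ n in atTop, ∀ k, a n k ≤ b k)
    (hb : ∑' k, b k ≠ ∞) (h : ∀ k, Tendsto (fun n => a n k) atTop (𝓝 (l k))) :
    Tendsto (fun n => ∑' k, a n k) atTop (𝓝 (∑' k, l k)) := by
  obtain ⟨N, hN⟩ := eventually_atTop.1 hab
  rw [← tendsto_add_atTop_iff_nat N]
  simp_rw [← lintegral_count]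
  refine tendsto_lintegral_of_dominated_convergence b (fun n => measurable_of_countable _)
    (fun n => ae_of_all _ (hN _ (by omega))) (by rwa [lintegral_count]) (ae_of_all _ fun k => ?_)
  exact (tendsto_add_atTop_iff_nat N).2 (h k)

/-! ### The conditional laws of the chain given survival -/

/-- The law of the chain after `n` steps given survival. -/
def srCond (A : ℝ) (P m : Measure ℝ) (n : ℕ) : Measure ℝ :=
  (srChain A P m n univ)⁻¹ • srChain A P m n

section

variable {A : ℝ} {F G : Measure ℝ}

lemma isProbabilityMeasure_srCond [IsProbabilityMeasure F] {m : Measure ℝ} [IsFiniteMeasure m]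
    {n : ℕ} (h : srChain A F m n univ ≠ 0) : IsProbabilityMeasure (srCond A F m n) :=
  ⟨by rw [srCond, Measure.smul_apply, smul_eq_mul, ENNReal.inv_mul_cancel h (measure_ne_top _ _)]⟩

lemma srCond_eq_zero {m : Measure ℝ} {n : ℕ} {s : Set ℝ} (h : srChain A F m n s = 0) :
    srCond A F m n s = 0 := by
  rw [srCond, Measure.smul_apply, h, smul_zero]

lemma lintegral_srCond {m : Measure ℝ} {n : ℕ} (v : ℝ → ℝ≥0∞) :
    ∫⁻ y, v y ∂(srCond A F m n)
      = (srChain A F m n univ)⁻¹ * ∫⁻ y, v y ∂(srChain A F m n) := by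
  rw [srCond, lintegral_smul_measure, smul_eq_mul]

lemma eventually_srCond_eq_zero [IsProbabilityMeasure F] (hF0 : F (Iic 0) = 0) {m : Measure ℝ}
    [IsFiniteMeasure m] (hm : m (Iio 0) = 0) :
    ∀ᶠ n in atTop, srCond A F m n (Iio 0) = 0 ∧ srCond A F m n (Ici A) = 0 := by
  filter_upwards [eventually_ge_atTop 1] with n hn
  obtain ⟨n, rfl⟩ := Nat.exists_eq_add_of_le' hn
  exact ⟨srCond_eq_zero (srChain_Iio_zero hm hF0 _), srCond_eq_zero (srChain_succ_Ici n)⟩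

/-- `l k` is the limit of the conditional probabilities to survive, after the change, `k` more
steps. -/
def SRDelayTerms (A : ℝ) (F G m : Measure ℝ) (l : ℕ → ℝ≥0∞) : Prop :=
  ∀ k, Tendsto (fun n => ∫⁻ y, srSurv A G k y ∂(srCond A F m n)) atTop (𝓝 (l k))

variable [IsProbabilityMeasure F] [IsProbabilityMeasure G]

/-- The two initial laws share their limiting distribution function, and post-change survival is
antitone and left continuous, so the limits forget the initial law. -/
lemma exists_srDelayTerms (hF0 : F (Iic 0) = 0) (hG0 : G (Iic 0) = 0) (hG : LogConcaveLaw G)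
    (hvG : SRViable A G) {m m' : Measure ℝ} [IsFiniteMeasure m] [IsFiniteMeasure m']
    (hm : m (Iio 0) = 0) (hm' : m' (Iio 0) = 0)
    (hs : ∀ n, srChain A F m n univ ≠ 0) (hs' : ∀ n, srChain A F m' n univ ≠ 0)
    {q : ℝ → ℝ≥0∞} (hq : ∀ x, Tendsto (fun n => srCond A F m n (Iic x)) atTop (𝓝 (q x)))
    (hq' : ∀ x, Tendsto (fun n => srCond A F m' n (Iic x)) atTop (𝓝 (q x))) :
    ∃ l, SRDelayTerms A F G m l ∧ SRDelayTerms A F G m' l := by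
  have i1 := fun n => isProbabilityMeasure_srCond (hs n)
  have i2 := fun n => isProbabilityMeasure_srCond (hs' n)
  choose l h1 h2 using fun k => exists_tendsto_lintegral
    (eventually_srCond_eq_zero hF0 hm) (eventually_srCond_eq_zero hF0 hm') hq hq'
    (measurable_srSurv (A := A) (P := G) k) (srSurv_le_one k) (srSurv_antitoneOn hG0 k)
    (hvG.leftContOn_srSurv hG hG0 k)
  exact ⟨l, h1, h2⟩

omit [IsProbabilityMeasure G] in
lemma lintegral_srSurv_srCond_le (hF0 : F (Iic 0) = 0) (hG0 : G (Iic 0) = 0) {m : Measure ℝ}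
    [IsFiniteMeasure m] (hm : m (Iio 0) = 0) {n : ℕ} (hs : srChain A F m n univ ≠ 0) (k : ℕ) :
    ∫⁻ y, srSurv A G k y ∂(srCond A F m n) ≤ srSurv A G k 0 := by
  have := isProbabilityMeasure_srCond hs
  calc ∫⁻ y, srSurv A G k y ∂(srCond A F m n) ≤ ∫⁻ _, srSurv A G k 0 ∂(srCond A F m n) := by
        refine lintegral_mono_ae ?_
        filter_upwards [ae_nonneg_of_measure_Iio
          (srCond_eq_zero (srChain_Iio_zero (A := A) hm hF0 n))] with y hy
        exact srSurv_antitoneOn hG0 k self_mem_Ici hy hy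
    _ = srSurv A G k 0 := by simp

omit [IsProbabilityMeasure G] in
lemma SRDelayTerms.le (hF0 : F (Iic 0) = 0) (hG0 : G (Iic 0) = 0) {m : Measure ℝ}
    [IsFiniteMeasure m] (hm : m (Iio 0) = 0) (hs : ∀ n, srChain A F m n univ ≠ 0)
    {l : ℕ → ℝ≥0∞} (h : SRDelayTerms A F G m l) (k : ℕ) : l k ≤ srSurv A G k 0 :=
  le_of_tendsto' (h k) fun n => lintegral_srSurv_srCond_le hF0 hG0 hm (hs n) k

lemma SRDelayTerms.tsum_ne_top (hF0 : F (Iic 0) = 0) (hG0 : G (Iic 0) = 0) (hG1 : G (Ici 1) ≠ 0)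
    (hA : 0 < A) {m : Measure ℝ} [IsFiniteMeasure m] (hm : m (Iio 0) = 0)
    (hs : ∀ n, srChain A F m n univ ≠ 0) {l : ℕ → ℝ≥0∞} (h : SRDelayTerms A F G m l) :
    ∑' k, l k ≠ ∞ :=
  ne_top_of_le_ne_top (tsum_srSurv_ne_top hG0 hG1 hA)
    (ENNReal.tsum_le_tsum fun k => h.le hF0 hG0 hm hs k)

lemma SRDelayTerms.tendsto_tsum (hF0 : F (Iic 0) = 0) (hG0 : G (Iic 0) = 0)
    (hG1 : G (Ici 1) ≠ 0) (hA : 0 < A) {m : Measure ℝ} [IsFiniteMeasure m] (hm : m (Iio 0) = 0)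
    (hs : ∀ n, srChain A F m n univ ≠ 0) {l : ℕ → ℝ≥0∞} (h : SRDelayTerms A F G m l) :
    Tendsto (fun n => ∑' k, (srChain A F m n univ)⁻¹ *
      ∫⁻ y, srSurv A G k y ∂(srChain A F m n)) atTop (𝓝 (∑' k, l k)) := by
  simp_rw [← lintegral_srCond]
  exact tendsto_tsum_ennreal
    (Eventually.of_forall fun n k => lintegral_srSurv_srCond_le hF0 hG0 hm (hs n) k)
    (tsum_srSurv_ne_top hG0 hG1 hA) h

/-! ### Comparison of thresholds -/

omit [IsProbabilityMeasure F] [IsProbabilityMeasure G] in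
-- Letting the larger level tend to infinity turns the reversed hazard rate order into stochastic
-- order of the normalised laws.
lemma RevHazardScaledLE.univ_mul_le {m m' : Measure ℝ} {c : ℝ} (h : RevHazardScaledLE c m m')
    (s : ℝ) [IsFiniteMeasure m'] : m univ * m' (Iio (s / c)) ≤ m (Iio s) * m' univ := by
  refine le_of_tendsto (ENNReal.Tendsto.mul_const (tendsto_measure_Iio_nat m)
    (Or.inr (measure_ne_top _ _))) ?_
  filter_upwards [tendsto_natCast_atTop_atTop.eventually_ge_atTop s] with n hn
  exact (h s n hn).trans (by gcongr; exact subset_univ _)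

omit [IsProbabilityMeasure F] [IsProbabilityMeasure G] in
lemma inv_mul_le_inv_mul {a b a' b' : ℝ≥0∞} (ha : a ≠ 0) (ha' : a' ≠ 0) (hat : a ≠ ∞)
    (hat' : a' ≠ ∞) (h : a * b' ≤ b * a') : a'⁻¹ * b' ≤ a⁻¹ * b := by
  rw [mul_comm, ← div_eq_mul_inv, mul_comm a⁻¹, ← div_eq_mul_inv,
    ENNReal.div_le_iff ha' hat', mul_comm, ← mul_div_assoc,
    ENNReal.le_div_iff_mul_le (Or.inl ha) (Or.inl hat), mul_comm b', mul_comm a' b]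
  exact h

lemma srCond_Iio_div_le (hF : LogConcaveLaw F) (hF0 : F (Iic 0) = 0) {A' : ℝ} (hA' : 0 < A')
    (hA : A' ≤ A) {n : ℕ} (hs : srChain A F (Measure.dirac 0) n univ ≠ 0)
    (hs' : srChain A' F (Measure.dirac 0) n univ ≠ 0) (s : ℝ) :
    srCond A' F (Measure.dirac 0) n (Iio (s / (A / A')))
      ≤ srCond A F (Measure.dirac 0) n (Iio s) := by
  have h := (revHazardScaledLE_srChain hF hF0 ((one_le_div hA').2 hA) hA'.le
    (div_mul_cancel₀ A hA'.ne').ge n).univ_mul_le s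
  simp only [srCond, Measure.smul_apply, smul_eq_mul]
  exact inv_mul_le_inv_mul hs hs' (measure_ne_top _ _) (measure_ne_top _ _) h

lemma lintegral_srCond_mul_le (hF : LogConcaveLaw F) (hF0 : F (Iic 0) = 0)
    {A' : ℝ} (hA' : 0 < A') (hA : A' ≤ A) {n : ℕ}
    (hs : srChain A F (Measure.dirac 0) n univ ≠ 0)
    (hs' : srChain A' F (Measure.dirac 0) n univ ≠ 0) {v : ℝ → ℝ≥0∞}
    (hv : AntitoneOn v (Ici 0)) (hv1 : ∀ y, v y ≤ 1) :
    ∫⁻ y, v (A / A' * y) ∂(srCond A' F (Measure.dirac 0) n)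
      ≤ ∫⁻ y, v y ∂(srCond A F (Measure.dirac 0) n) := by
  have i1 := isProbabilityMeasure_srCond hs
  have i2 := isProbabilityMeasure_srCond hs'
  have hc : 0 < A / A' := div_pos (hA'.trans_le hA) hA'
  set ρ : ℝ → ℝ≥0∞ := fun y => v (max y 0) with hρ
  have hanti : Antitone ρ := fun x y hxy =>
    hv (mem_Ici.2 (le_max_right x 0)) (mem_Ici.2 (le_max_right y 0)) (max_le_max_right 0 hxy)
  calc ∫⁻ y, v (A / A' * y) ∂(srCond A' F (Measure.dirac 0) n)
      = ∫⁻ y, ρ (A / A' * y) ∂(srCond A' F (Measure.dirac 0) n) := by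
        refine lintegral_congr_ae ?_
        filter_upwards [ae_nonneg_of_measure_Iio
          (srCond_eq_zero (srChain_Iio_zero (A := A') dirac_zero_Iio hF0 n))] with y hy
        rw [hρ]
        simp only
        rw [max_eq_left (by positivity)]
    _ = ∫⁻ y, ρ y ∂((srCond A' F (Measure.dirac 0) n).map fun y => A / A' * y) := by
        rw [lintegral_map hanti.measurable (by fun_prop)]
    _ ≤ ∫⁻ y, ρ y ∂(srCond A F (Measure.dirac 0) n) := by
        have : IsFiniteMeasure ((srCond A' F (Measure.dirac 0) n).map fun y => A / A' * y) := by
          infer_instance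
        refine lintegral_antitone_le (fun s => ?_) hanti fun y => hv1 _
        rw [Measure.map_apply (by fun_prop) measurableSet_Iio]
        refine le_of_eq_of_le ?_ (srCond_Iio_div_le hF hF0 hA' hA hs hs' s)
        congr 1
        ext y
        rw [mem_preimage, mem_Iio, mem_Iio, lt_div_iff₀ hc, mul_comm]
    _ = ∫⁻ y, v y ∂(srCond A F (Measure.dirac 0) n) := by
        refine lintegral_congr_ae ?_
        filter_upwards [ae_nonneg_of_measure_Iio
          (srCond_eq_zero (srChain_Iio_zero (A := A) dirac_zero_Iio hF0 n))] with y hy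
        rw [hρ]
        simp only
        rw [max_eq_left hy]

/-- Two effects with the same sign: the rescaled conditional law for `A'` lies higher, and from
matching positions the coupling gives less survival below `A'`. -/
lemma lintegral_srSurv_srCond_mono (hF : LogConcaveLaw F) (hF0 : F (Iic 0) = 0)
    (hG0 : G (Iic 0) = 0) {A' : ℝ} (hA' : 0 < A') (hA : A' ≤ A) {n : ℕ}
    (hs : srChain A F (Measure.dirac 0) n univ ≠ 0)
    (hs' : srChain A' F (Measure.dirac 0) n univ ≠ 0) (k : ℕ) :
    ∫⁻ y, srSurv A' G k y ∂(srCond A' F (Measure.dirac 0) n)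
      ≤ ∫⁻ y, srSurv A G k y ∂(srCond A F (Measure.dirac 0) n) := by
  refine le_trans (lintegral_mono_ae ?_) (lintegral_srCond_mul_le hF hF0 hA' hA hs hs'
    (srSurv_antitoneOn hG0 k) (srSurv_le_one k))
  have hc : 0 < A / A' := div_pos (hA'.trans_le hA) hA'
  filter_upwards [ae_nonneg_of_measure_Iio
    (srCond_eq_zero (srChain_Iio_zero (A := A') dirac_zero_Iio hF0 n))] with y hy
  exact srSurv_le_srSurv hG0 ((one_le_div hA').2 hA) (div_mul_cancel₀ A hA'.ne').le k hy
    (by positivity) le_rfl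

omit [IsProbabilityMeasure F] [IsProbabilityMeasure G] in
lemma srChain_dirac_zero_Ici (hA : 0 < A) (n : ℕ) :
    srChain A F (Measure.dirac 0) n (Ici A) = 0 := by
  cases n with
  | zero =>
    simp only [srChain]
    rw [Measure.dirac_apply' _ measurableSet_Ici]
    simpa using hA
  | succ n => exact srChain_succ_Ici n

/-- The conditional laws of the chain charge, uniformly in time, a half-line on which the
probability of an alarm is bounded away from `0`. -/
lemma exists_srCond_Ici_ge (hF : LogConcaveLaw F) (hF0 : F (Iic 0) = 0) (hF1 : F (Ici 1) ≠ 0)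
    (hGF : ∀ z, G (Ici z) = 0 → F (Ici z) = 0) (hvF : SRViable A F) :
    ∃ y, 0 ≤ y ∧ y < A ∧ G (Iio (A / (1 + y))) ≠ 1 ∧ ∃ η : ℝ≥0∞, η ≠ 0 ∧
      ∀ᶠ n in atTop, η ≤ srCond A F (Measure.dirac 0) n (Ici y) := by
  have hs : ∀ n, srChain A F (Measure.dirac 0) n univ ≠ 0 := fun n => by
    rw [srChain_dirac_univ]
    exact hvF.srSurv_ne_zero_of_lt hF0 n le_rfl hvF.1
  obtain ⟨N, hN⟩ : ∃ N, srSurv A F (N + 1) 0 ≠ srSurv A F N 0 := by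
    by_contra! hall
    have h1 : ∀ n, srSurv A F n 0 = 1 := by
      intro n
      induction n with
      | zero => rfl
      | succ n ih => rw [hall, ih]
    obtain ⟨n, hn⟩ := exists_srSurv_lt_one (A := A) hF0 hF1 hvF.1
    exact (hn 0 le_rfl).ne (h1 n)
  set M := srChain A F (Measure.dirac 0) N with hM
  have hM0 : ∀ᵐ y ∂M, 0 ≤ y := ae_nonneg_of_measure_Iio (srChain_Iio_zero dirac_zero_Iio hF0 N)
  have hMA : ∀ᵐ y ∂M, y < A := by
    rw [ae_iff]
    simpa [Ici] using srChain_dirac_zero_Ici (F := F) hvF.1 N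
  set U : Set ℝ := {y | srSurv A G 1 y ≠ 1} ∩ Ico 0 A with hU
  have hUm : MeasurableSet U :=
    ((measurable_srSurv 1) (measurableSet_singleton 1)).compl.inter measurableSet_Ico
  have hMU : 0 < M U := by
    rw [pos_iff_ne_zero]
    intro h0
    apply hN
    have hU' : ∀ᵐ y ∂M, y ∉ U := measure_eq_zero_iff_ae_notMem.1 h0
    have h1 : ∀ᵐ y ∂M, srSurv A F 1 y = 1 := by
      filter_upwards [hU', hM0, hMA] with y hy hy0 hyA
      have hG1 : srSurv A G 1 y = 1 := by
        by_contra hne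
        exact hy ⟨hne, hy0, hyA⟩
      rw [srSurv_one_eq hy0] at hG1 ⊢
      have h2 : F (Ici (A / (1 + y))) = 0 := by
        apply hGF
        rw [← compl_Iio, prob_compl_eq_zero_iff measurableSet_Iio]
        exact hG1
      rwa [← compl_Iio, prob_compl_eq_zero_iff measurableSet_Iio] at h2
    rw [← srChain_dirac_univ (N + 1), ← srChain_dirac_univ N, srChain, srStep_univ,
      lintegral_congr_ae h1]
    simp [hM]
  -- Inner regularity supplies a least point that still belongs to `U`; `U` itself need not contain
  -- its infimum.
  obtain ⟨K, hKU, hKc, hMK⟩ := hUm.exists_lt_isCompact hMU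
  have hKne : K.Nonempty := by
    rw [nonempty_iff_ne_empty]
    rintro rfl
    simp at hMK
  obtain ⟨y, hyK, hy⟩ := hKc.exists_isLeast hKne
  have hyU := hKU hyK
  refine ⟨y, hyU.2.1, hyU.2.2, ?_, srCond A F (Measure.dirac 0) N (Ici y), ?_, ?_⟩
  · rw [← srSurv_one_eq hyU.2.1]
    exact hyU.1
  · rw [srCond, Measure.smul_apply, smul_eq_mul]
    refine mul_ne_zero (ENNReal.inv_ne_zero.2 (measure_ne_top _ _)) ?_
    exact (hMK.trans_le (measure_mono fun x hx => hy hx)).ne'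
  · filter_upwards [eventually_ge_atTop N] with n hn
    induction n, hn using Nat.le_induction with
    | base => exact le_rfl
    | succ n _ ih =>
      refine ih.trans ?_
      have i1 := isProbabilityMeasure_srCond (hs n)
      have i2 := isProbabilityMeasure_srCond (hs (n + 1))
      rw [← compl_Iio, prob_compl_eq_one_sub measurableSet_Iio,
        prob_compl_eq_one_sub measurableSet_Iio]
      refine tsub_le_tsub_left ?_ 1
      have h := (revHazardScaledLE_one.2
        (revHazardLE_srChain_succ hF hF0 hvF.1.le n)).univ_mul_le y
      rw [div_one] at h
      simp only [srCond, Measure.smul_apply, smul_eq_mul]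
      exact inv_mul_le_inv_mul (hs n) (hs (n + 1)) (measure_ne_top _ _) (measure_ne_top _ _) h

/-- Log-concavity makes `G (Iio s) / G (Iio (θ * s))` nondecreasing in `s`, so on `y ≥ y₀` its
largest value is at `y₀`, where it is less than one. -/
lemma exists_srSurv_one_gap (hG : LogConcaveLaw G) {A' : ℝ} (hvG : SRViable A' G) (hA : A' < A)
    {y₀ : ℝ} (hy₀ : 0 ≤ y₀) (hyA : y₀ < A') (h1 : G (Iio (A' / (1 + y₀))) ≠ 1) :
    ∃ Δ : ℝ≥0∞, Δ ≠ 0 ∧ ∀ y, y₀ ≤ y → y < A' →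
      srSurv A' G 1 y + Δ ≤ srSurv A G 1 (A / A' * y) := by
  have hA' := hvG.1
  have hA0 : 0 < A := hA'.trans hA
  set c := A / A' with hc
  have hc1 : 1 < c := (one_lt_div hA').2 hA
  have hcA : c * A' = A := div_mul_cancel₀ A hA'.ne'
  -- The least ratio of the one-step levels `A / (1 + c * y)` and `A' / (1 + y)` over `0 ≤ y ≤ A'`,
  -- attained at `y = A'`.
  set θ := c * (1 + A') / (1 + A) with hθ
  have hθ1 : 1 < θ := by
    rw [hθ, one_lt_div (by linarith)]
    nlinarith
  set g := G (Iio (A / (1 + A))) with hg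
  have hg0 : g ≠ 0 := by
    refine hvG.2 _ ?_
    rw [div_lt_div_iff₀ (by linarith) (by linarith)]
    nlinarith
  have hgle : ∀ y, 0 ≤ y → y < A' → g ≤ G (Iio (θ * (A' / (1 + y)))) := by
    intro y hy0 hy
    refine measure_mono (Iio_subset_Iio ?_)
    have e : A / (1 + A) = θ * (A' / (1 + A')) := by
      rw [hθ, ← hcA]
      field_simp
    rw [e]
    gcongr
  set s₁ := A' / (1 + y₀) with hs₁
  have hs₁0 : 0 < s₁ := div_pos hA' (by linarith)
  set a := G (Iio s₁) with ha
  set b := G (Iio (θ * s₁)) with hb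
  have hb0 : b ≠ 0 := fun h0 => hg0 (nonpos_iff_eq_zero.1 (h0 ▸ hgle y₀ hy₀ hyA))
  have hbt : b ≠ ∞ := measure_ne_top _ _
  have hab : a < b := hG.measure_Iio_lt hs₁0 (by nlinarith) hb0 h1
  have hab1 : a / b < 1 := by
    rw [ENNReal.div_lt_iff (Or.inl hb0) (Or.inl hbt), one_mul]
    exact hab
  refine ⟨(1 - a / b) * g, mul_ne_zero (tsub_pos_of_lt hab1).ne' hg0, fun y hy hyA' => ?_⟩
  have hy0 : 0 ≤ y := hy₀.trans hy
  have hcy : 0 ≤ c * y := by positivity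
  rw [srSurv_one_eq hy0, srSurv_one_eq hcy]
  set s := A' / (1 + y) with hs
  have hss : s ≤ s₁ := div_le_div_of_nonneg_left hA'.le (by linarith) (by linarith)
  have hlc := hG θ hθ1.le (θ * s) (θ * s₁) (by nlinarith)
  rw [mul_div_cancel_left₀ _ (by linarith : θ ≠ 0), mul_div_cancel_left₀ _ (by linarith : θ ≠ 0)]
    at hlc
  have hle : G (Iio s) ≤ a / b * G (Iio (θ * s)) := by
    rw [mul_comm, ← mul_div_assoc, ENNReal.le_div_iff_mul_le (Or.inl hb0) (Or.inl hbt), mul_comm]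
    exact hlc
  calc G (Iio s) + (1 - a / b) * g
      ≤ a / b * G (Iio (θ * s)) + (1 - a / b) * G (Iio (θ * s)) := by
        gcongr
        exact hgle y hy0 hyA'
    _ = G (Iio (θ * s)) := by
        rw [← add_mul, add_tsub_cancel_of_le hab1.le, one_mul]
    _ ≤ G (Iio (A / (1 + c * y))) := by
        refine measure_mono (Iio_subset_Iio ?_)
        rw [hθ, hs, div_mul_div_comm, div_le_div_iff₀ (by positivity) (by positivity), ← hcA]
        have : 0 < A' * c := by positivity
        nlinarith [mul_nonneg (mul_nonneg this.le (sub_nonneg.2 hc1.le)) (sub_nonneg.2 hyA'.le)]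

/-- The limiting average delay is a strictly increasing function of the threshold. -/
lemma SRDelayTerms.tsum_lt_tsum (hF : LogConcaveLaw F) (hF0 : F (Iic 0) = 0)
    (hF1 : F (Ici 1) ≠ 0) (hG : LogConcaveLaw G) (hG0 : G (Iic 0) = 0) (hG1 : G (Ici 1) ≠ 0)
    (hGF : ∀ z, G (Ici z) = 0 → F (Ici z) = 0) {A' : ℝ} (hvF : SRViable A F)
    (hvF' : SRViable A' F) (hvG' : SRViable A' G) (hA : A' < A) {l l' : ℕ → ℝ≥0∞}
    (hl : SRDelayTerms A F G (Measure.dirac 0) l)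
    (hl' : SRDelayTerms A' F G (Measure.dirac 0) l') : ∑' k, l' k < ∑' k, l k := by
  have hs : ∀ n, srChain A F (Measure.dirac 0) n univ ≠ 0 := fun n => by
    rw [srChain_dirac_univ]
    exact hvF.srSurv_ne_zero_of_lt hF0 n le_rfl hvF.1
  have hs' : ∀ n, srChain A' F (Measure.dirac 0) n univ ≠ 0 := fun n => by
    rw [srChain_dirac_univ]
    exact hvF'.srSurv_ne_zero_of_lt hF0 n le_rfl hvF'.1
  have hA' := hvF'.1
  obtain ⟨y₀, hy₀, hyA, hy1, η, hη0, hη⟩ := exists_srCond_Ici_ge hF hF0 hF1 hGF hvF'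
  obtain ⟨Δ, hΔ0, hΔ⟩ := exists_srSurv_one_gap (A := A) hG hvG' hA hy₀ hyA hy1
  have hfin := hl'.tsum_ne_top hF0 hG0 hG1 hA' dirac_zero_Iio hs'
  -- At `k = 0` both terms are `1`; the strict gain is obtained at `k = 1`.
  refine ENNReal.tsum_lt_tsum hfin (i := 1) (fun k => le_of_tendsto_of_tendsto' (hl' k) (hl k)
    fun n => lintegral_srSurv_srCond_mono hF hF0 hG0 hA' hA.le (hs n) (hs' n) k) ?_
  have hle : l' 1 + Δ * η ≤ l 1 := by
    refine le_of_tendsto_of_tendsto ((hl' 1).add tendsto_const_nhds) (hl 1) ?_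
    filter_upwards [hη] with n hn
    refine le_trans ?_ (lintegral_srCond_mul_le hF hF0 hA' hA.le (hs n) (hs' n)
      (srSurv_antitoneOn hG0 1) (srSurv_le_one 1))
    calc ∫⁻ y, srSurv A' G 1 y ∂(srCond A' F (Measure.dirac 0) n) + Δ * η
        ≤ ∫⁻ y, srSurv A' G 1 y ∂(srCond A' F (Measure.dirac 0) n)
          + ∫⁻ y, (Ici y₀).indicator (fun _ => Δ) y ∂(srCond A' F (Measure.dirac 0) n) := by
          rw [lintegral_indicator_const measurableSet_Ici]
          gcongr
      _ = ∫⁻ y, srSurv A' G 1 y + (Ici y₀).indicator (fun _ => Δ) y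
            ∂(srCond A' F (Measure.dirac 0) n) := by
          rw [lintegral_add_left (measurable_srSurv 1)]
      _ ≤ _ := by
          refine lintegral_mono_ae ?_
          have hlt : ∀ᵐ y ∂(srCond A' F (Measure.dirac 0) n), y < A' := by
            rw [ae_iff]
            simpa [Ici] using srCond_eq_zero (srChain_dirac_zero_Ici (F := F) hA' n)
          filter_upwards [hlt, ae_nonneg_of_measure_Iio
            (srCond_eq_zero (srChain_Iio_zero (A := A') dirac_zero_Iio hF0 n))] with y hyA' hy0
          by_cases hyy : y₀ ≤ y
          · rw [indicator_of_mem (mem_Ici.2 hyy)]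
            exact hΔ y hyy hyA'
          · rw [indicator_of_notMem (by simpa using hyy), add_zero]
            exact srSurv_le_srSurv hG0 ((one_le_div hA').2 hA.le)
              (div_mul_cancel₀ A hA'.ne').le 1 hy0
              (mul_nonneg (div_pos hvF.1 hA').le hy0) le_rfl
  refine lt_of_lt_of_le (ENNReal.lt_add_right ?_ (mul_ne_zero hΔ0 hη0)) hle
  exact ENNReal.ne_top_of_tsum_ne_top hfin 1

end

/-! ### The threshold as a function of the head start -/

section

variable {A : ℝ} {P : Measure ℝ} [IsProbabilityMeasure P]

/-- Equality of the survival probabilities would make the integrands agree almost everywhere. If the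
first step from `y'` is always survived, induction makes all later survival certain, against `hk`;
otherwise some ratios stop the chain from `y'` but not the one from `y`. -/
lemma SRViable.srSurv_lt_srSurv (h : SRViable A P) (hP : LogConcaveLaw P) (hP0 : P (Iic 0) = 0)
    (k : ℕ) {y y' : ℝ} (hy : 0 ≤ y) (hyy : y < y') (hy' : P (Iio (A / (1 + y'))) ≠ 0)
    (hk : srSurv A P k y' ≠ 1) : srSurv A P k y' < srSurv A P k y := by
  induction k generalizing y y' with
  | zero => exact absurd rfl hk
  | succ k ih =>
    have hy0' : 0 ≤ y' := hy.trans hyy.le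
    refine lt_of_le_of_ne (srSurv_antitoneOn hP0 _ hy hy0' hyy.le) fun heq => ?_
    have hss : A / (1 + y') < A / (1 + y) := div_lt_div_of_pos_left h.1 (by linarith) (by linarith)
    have hmeas : ∀ z : ℝ, Measurable fun x => (Iio A).indicator (srSurv A P k) ((1 + z) * x) :=
      fun z => ((measurable_srSurv k).indicator measurableSet_Iio).comp
        (measurable_const.mul measurable_id)
    have hae : (fun x => (Iio A).indicator (srSurv A P k) ((1 + y') * x))
        =ᵐ[P] fun x => (Iio A).indicator (srSurv A P k) ((1 + y) * x) := by
      refine ae_eq_of_ae_le_of_lintegral_le ?_ ?_ (hmeas y).aemeasurable heq.ge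
      · filter_upwards [ae_pos_of_measure_Iic hP0] with x hx
        have hlt : (1 + y) * x ≤ (1 + y') * x := by gcongr
        by_cases hA : (1 + y') * x < A
        · rw [indicator_of_mem (mem_Iio.2 hA), indicator_of_mem (mem_Iio.2 (hlt.trans_lt hA))]
          exact srSurv_antitoneOn hP0 k (mul_nonneg (by linarith) hx.le)
            (mul_nonneg (by linarith) hx.le) hlt
        · rw [indicator_of_notMem (by simpa using hA)]
          exact zero_le
      · exact ((srSurv_le_one (k + 1) y').trans_lt ENNReal.one_lt_top).ne
    by_cases h1 : P (Iio (A / (1 + y'))) = 1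
    · apply hk
      have hone : (fun x => (Iio A).indicator (srSurv A P k) ((1 + y') * x)) =ᵐ[P] fun _ => 1 := by
        have hlt : ∀ᵐ x ∂P, x < A / (1 + y') := by
          rw [ae_iff]
          have := (prob_compl_eq_zero_iff (μ := P) (measurableSet_Iio (a := A / (1 + y')))).2 h1
          simpa [Iio, compl_def] using this
        filter_upwards [hae, hlt, ae_pos_of_measure_Iic hP0] with x hx hxlt hx0
        have hxA : (1 + y') * x < A := by
          rwa [lt_div_iff₀ (by linarith), mul_comm] at hxlt
        have hlt : (1 + y) * x < (1 + y') * x := by gcongr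
        rw [indicator_of_mem (mem_Iio.2 hxA)] at hx ⊢
        rw [indicator_of_mem (mem_Iio.2 (hlt.trans hxA))] at hx
        by_contra hne
        have hpos : 0 ≤ (1 + y') * x := by positivity
        exact (ih (by positivity) hlt (h.2 _ (div_one_add_lt h.1 hpos hxA)) hne).ne hx
      refine (lintegral_congr_ae hone).trans ?_
      simp
    · have hlt := hP.measure_Iio_lt (div_pos h.1 (by linarith)) hss
        (fun h0 => hy' (measure_mono_null (Iio_subset_Iio hss.le) h0)) h1
      have hzero : P (Ico (A / (1 + y')) (A / (1 + y))) = 0 := by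
        have : ∀ᵐ x ∂P, x ∉ Ico (A / (1 + y')) (A / (1 + y)) := by
          filter_upwards [hae, ae_pos_of_measure_Iic hP0] with x hx hx0 hxI
          have h2 : ¬ (1 + y') * x < A := by
            have := hxI.1
            rw [div_le_iff₀ (by linarith)] at this
            linarith
          have h3 : (1 + y) * x < A := by
            have := hxI.2
            rw [lt_div_iff₀ (by linarith)] at this
            linarith
          rw [indicator_of_notMem (by simpa using h2), indicator_of_mem (mem_Iio.2 h3)] at hx
          exact h.srSurv_ne_zero_of_lt hP0 k (by positivity) h3 hx.symm
        exact measure_eq_zero_iff_ae_notMem.2 this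
      have hsub : P (Iio (A / (1 + y))) ≤ P (Iio (A / (1 + y'))) := by
        rw [← Iio_union_Ico_eq_Iio hss.le]
        refine (measure_union_le _ _).trans ?_
        rw [hzero, add_zero]
      exact absurd hlt (not_lt.2 hsub)

lemma tsum_srSurv_of_one_eq_zero {r : ℝ} (h : srSurv A P 1 r = 0) : ∑' n, srSurv A P n r = 1 := by
  rw [tsum_eq_single 0]
  · rfl
  · intro n hn
    exact nonpos_iff_eq_zero.1 (h ▸ srSurv_anti r (Nat.one_le_iff_ne_zero.2 hn))

/-- Equal average run lengths: the larger head start has the larger threshold. -/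
lemma SRViable.threshold_lt (h : SRViable A P) (hP : LogConcaveLaw P) (hP0 : P (Iic 0) = 0)
    {A' r r' : ℝ} {γ : ℝ≥0∞} (hγ1 : 1 < γ) (hγ : γ ≠ ∞) (hr : 0 ≤ r) (hrr : r < r')
    (hA : ∑' n, srSurv A P n r = γ) (hA' : ∑' n, srSurv A' P n r' = γ) : A < A' := by
  by_contra! hle
  have hr' : 0 ≤ r' := hr.trans hrr.le
  -- If `A' ≤ A`, the run length from `r'` at threshold `A` is squeezed between two equal values,
  -- against strict monotonicity in the head start.
  have h1 : ∀ n, srSurv A' P n r' ≤ srSurv A P n r' := fun n =>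
    srSurv_le_srSurv hP0 le_rfl (by simpa using hle) n hr' hr' (one_mul _).ge
  have h2 : ∀ n, srSurv A P n r' ≤ srSurv A P n r := fun n =>
    srSurv_antitoneOn hP0 n hr hr' hrr.le
  have h3 : ∑' n, srSurv A P n r' = γ :=
    le_antisymm (hA ▸ ENNReal.tsum_le_tsum h2) (hA' ▸ ENNReal.tsum_le_tsum h1)
  have hs : P (Iio (A / (1 + r'))) ≠ 0 := by
    intro h0
    rw [← srSurv_one_eq hr'] at h0
    rw [tsum_srSurv_of_one_eq_zero h0] at h3
    exact hγ1.ne h3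
  obtain ⟨k, hk⟩ : ∃ k, srSurv A P k r' ≠ 1 := by
    by_contra! hall
    simp only [hall] at h3
    apply hγ
    rw [← h3]
    simp
  have := ENNReal.tsum_lt_tsum (h3 ▸ hγ) h2 (h.srSurv_lt_srSurv hP hP0 k hr hrr hs hk)
  rw [h3, hA] at this
  exact lt_irrefl _ this

end

/-! ### The quasi-stationary distribution -/

section

variable {A : ℝ} {P Q : Measure ℝ} [IsProbabilityMeasure P]

lemma quasiStationary_Iic_zero (hP0 : P (Iic 0) = 0)
    (hq : ∀ x, Tendsto (fun n => srCond A P (Measure.dirac 0) n (Iic x)) atTop (𝓝 (Q (Iic x)))) :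
    Q (Iic 0) = 0 := by
  refine tendsto_nhds_unique (hq 0) (tendsto_const_nhds.congr' ?_)
  filter_upwards [eventually_ge_atTop 1] with n hn
  obtain ⟨n, rfl⟩ := Nat.exists_eq_add_of_le' hn
  exact (srCond_eq_zero (srChain_succ_Iic_zero dirac_zero_Iio hP0 n)).symm

lemma SRViable.srChain_dirac_zero_ne_zero (h : SRViable A P) (hP0 : P (Iic 0) = 0) (n : ℕ) :
    srChain A P (Measure.dirac 0) n univ ≠ 0 := by
  rw [srChain_dirac_univ]
  exact h.srSurv_ne_zero_of_lt hP0 n le_rfl h.1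

lemma quasiStationary_Ioi [IsProbabilityMeasure Q] (h : SRViable A P) (hP0 : P (Iic 0) = 0)
    (hq : ∀ x, Tendsto (fun n => srCond A P (Measure.dirac 0) n (Iic x)) atTop (𝓝 (Q (Iic x)))) :
    Q (Ioi A) = 0 := by
  rw [← compl_Iic, prob_compl_eq_zero_iff measurableSet_Iic]
  refine tendsto_nhds_unique (hq A) (tendsto_const_nhds.congr fun n => ?_)
  have := isProbabilityMeasure_srCond (h.srChain_dirac_zero_ne_zero hP0 n)
  symm
  rw [← prob_compl_eq_zero_iff measurableSet_Iic, compl_Iic]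
  exact measure_mono_null Ioi_subset_Ici_self
    (srCond_eq_zero (srChain_dirac_zero_Ici h.1 n))

/-- In the boundary case the quasi-stationary distribution is concentrated at the threshold. -/
lemma quasiStationary_Iio_eq_zero (h : SRViable A P) (hP0 : P (Iic 0) = 0)
    (hz : P (Iio (A / (1 + A))) = 0)
    (hq : ∀ x, Tendsto (fun n => srCond A P (Measure.dirac 0) n (Iic x)) atTop (𝓝 (Q (Iic x)))) :
    Q (Iio A) = 0 := by
  have hA := h.1
  set z := A / (1 + A) with hzdef
  have hz0 : 0 < z := by positivity
  have hz1 : z < 1 := by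
    rw [hzdef, div_lt_one (by linarith)]
    linarith
  have hL : z / (1 - z) = A := by
    rw [hzdef]
    field_simp
    ring
  have hlim : Tendsto (fun n : ℕ => z / (1 - z) * (1 - z ^ n)) atTop (𝓝 (z / (1 - z) * (1 - 0))) :=
    (tendsto_const_nhds.sub (tendsto_pow_atTop_nhds_zero_of_lt_one hz0.le hz1)).const_mul _
  rw [sub_zero, mul_one, hL] at hlim
  have hx : ∀ x, x < A → Q (Iic x) = 0 := by
    intro x hxA
    refine tendsto_nhds_unique (hq x) (tendsto_const_nhds.congr' ?_)
    filter_upwards [hlim.eventually_const_lt hxA] with n hn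
    refine (srCond_eq_zero (measure_mono_null (fun y hy => lt_of_le_of_lt hy hn) ?_)).symm
    have := srChain_Iio_eq_zero (A := A) hz0.le hz1 hP0 hz n
    rwa [hL] at this
  have hlim2 : Tendsto (fun n : ℕ => A - 1 / ((n : ℝ) + 1)) atTop (𝓝 (A - 0)) :=
    tendsto_const_nhds.sub tendsto_one_div_add_atTop_nhds_zero_nat
  rw [sub_zero] at hlim2
  have hlt : ∀ n : ℕ, A - 1 / ((n : ℝ) + 1) < A := fun n => by
    have : 0 < 1 / ((n : ℝ) + 1) := by positivity
    linarith
  refine tendsto_nhds_unique (tendsto_measure_Iic_left Q ?_ hlt hlim2)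
    (tendsto_const_nhds.congr fun n => (hx _ (hlt n)).symm)
  intro i j hij
  have : 1 / ((j : ℝ) + 1) ≤ 1 / ((i : ℝ) + 1) :=
    one_div_le_one_div_of_le (by positivity) (by gcongr)
  simp only
  linarith

lemma setOf_mul_le {y s : ℝ} (hy : 0 ≤ y) : {x : ℝ | (1 + y) * x ≤ s} = Iic (s / (1 + y)) := by
  ext x
  rw [mem_ofPred_eq, mem_Iic, le_div_iff₀ (by linarith), mul_comm]

/-- As `u n` approaches `y` from below, the indicators of the closed conditions converge at every
positive `z`, so atoms do no harm here. -/
lemma leftContOn_measure_mul_le (x : ℝ) {B : ℝ} (hP0 : P (Iic 0) = 0) :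
    LeftContOn B fun y => P {z | (1 + y) * z ≤ x} := by
  intro u y hy _ hu0 huy hlim
  have hms : ∀ w : ℝ, MeasurableSet {z : ℝ | (1 + w) * z ≤ x} := fun w =>
    measurableSet_le (by fun_prop) measurable_const
  have hint : ∀ w : ℝ, P {z | (1 + w) * z ≤ x}
      = ∫⁻ z, (Iic x).indicator 1 ((1 + w) * z) ∂P := by
    intro w
    rw [← lintegral_indicator_one (hms w)]
    exact lintegral_congr fun z => by simp only [indicator, mem_Iic, mem_ofPred_eq, Pi.one_apply]
  simp only [hint]
  refine tendsto_lintegral_of_dominated_convergence (fun _ => 1) (fun n => ?_) (fun n => ?_)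
    (by simp) ?_
  · exact (measurable_const.indicator measurableSet_Iic).comp (measurable_const.mul measurable_id)
  · exact ae_of_all _ fun z => indicator_le_self _ _ _
  · filter_upwards [ae_pos_of_measure_Iic hP0] with z hz
    have hlim' : Tendsto (fun n => (1 + u n) * z) atTop (𝓝 ((1 + y) * z)) :=
      (tendsto_const_nhds.add hlim).mul_const z
    refine tendsto_const_nhds.congr' ?_
    rcases le_or_gt ((1 + y) * z) x with h | h
    · refine Eventually.of_forall fun n => ?_
      have h' : (1 + u n) * z ≤ x := le_trans (by have := huy n; gcongr) h
      simp only [indicator_of_mem (mem_Iic.2 h), indicator_of_mem (mem_Iic.2 h'), Pi.one_apply]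
    · filter_upwards [hlim'.eventually_const_lt h] with n hn
      rw [indicator_of_notMem (by simpa using h), indicator_of_notMem (by simpa using hn)]

lemma measurable_measure_mul_le (x : ℝ) : Measurable fun y : ℝ => P {z | (1 + y) * z ≤ x} :=
  measurable_measure_prodMk_left (measurable_srMap measurableSet_Iic)

lemma tendsto_lintegral_measure_mul_le [IsProbabilityMeasure Q] (h : SRViable A P)
    (hP0 : P (Iic 0) = 0)
    (hq : ∀ x, Tendsto (fun n => srCond A P (Measure.dirac 0) n (Iic x)) atTop (𝓝 (Q (Iic x))))
    (x : ℝ) :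
    Tendsto (fun n => ∫⁻ y, P {z | (1 + y) * z ≤ x} ∂(srCond A P (Measure.dirac 0) n)) atTop
      (𝓝 (∫⁻ y, P {z | (1 + y) * z ≤ x} ∂Q)) := by
  have i1 := fun n => isProbabilityMeasure_srCond (h.srChain_dirac_zero_ne_zero hP0 n)
  have hQ0 : Q (Iio 0) = 0 :=
    measure_mono_null Iio_subset_Iic_self (quasiStationary_Iic_zero hP0 hq)
  have hμ0 : ∀ᶠ n in atTop, srCond A P (Measure.dirac 0) n (Iio 0) = 0
      ∧ srCond A P (Measure.dirac 0) n (Ici (A + 1)) = 0 := by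
    filter_upwards [eventually_srCond_eq_zero (A := A) hP0 dirac_zero_Iio] with n hn
    exact ⟨hn.1, measure_mono_null (Ici_subset_Ici.2 (by linarith)) hn.2⟩
  have hQA : Q (Ici (A + 1)) = 0 :=
    measure_mono_null (fun y (hy : A + 1 ≤ y) => (by linarith : A < y))
      (quasiStationary_Ioi h hP0 hq)
  have hanti : AntitoneOn (fun y => P {z | (1 + y) * z ≤ x}) (Ici 0) := by
    intro y hy y' _ hyy
    refine measure_mono_ae ?_
    filter_upwards [ae_pos_of_measure_Iic hP0] with z hz hz'
    exact le_trans (b := (1 + y') * z) (by gcongr) hz'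
  -- The bound `A + 1` is used because `Q` is so far only known to live on `[0, A]` and may charge
  -- `A`.
  obtain ⟨l, h1, h2⟩ := exists_tendsto_lintegral (A := A + 1) (μ' := fun _ => Q) hμ0
    (Eventually.of_forall fun _ => ⟨hQ0, hQA⟩) hq (fun x => tendsto_const_nhds)
    (measurable_measure_mul_le x) (fun _ => prob_le_one) hanti (leftContOn_measure_mul_le x hP0)
  rwa [tendsto_nhds_unique tendsto_const_nhds h2]

lemma lintegral_srSurv_one_eq (h : SRViable A P) (hP : LogConcaveLaw P)
    {m : Measure ℝ} (hm0 : ∀ᵐ y ∂m, 0 ≤ y) (hm : ∀ᵐ y ∂m, P (Iio (A / (1 + y))) ≠ 0) :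
    ∫⁻ y, P {z | (1 + y) * z ≤ A} ∂m = ∫⁻ y, srSurv A P 1 y ∂m := by
  refine lintegral_congr_ae ?_
  filter_upwards [hm0, hm] with y hy0 hy
  rw [srSurv_one_eq hy0, setOf_mul_le hy0, ← Iio_union_right,
    measure_union (by simp) (measurableSet_singleton _),
    hP.measure_singleton (div_pos h.1 (by linarith)) hy, add_zero]

/-- Outside the boundary case the quasi-stationary distribution lives below the threshold and is
an eigenmeasure of the killed chain. -/
lemma quasiStationary_srStep [IsProbabilityMeasure Q] (h : SRViable A P) (hP : LogConcaveLaw P)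
    (hP0 : P (Iic 0) = 0)
    (hz : P (Iio (A / (1 + A))) ≠ 0)
    (hq : ∀ x, Tendsto (fun n => srCond A P (Measure.dirac 0) n (Iic x)) atTop (𝓝 (Q (Iic x)))) :
    Q (Ici A) = 0 ∧ ∃ κ : ℝ≥0∞, κ ≠ 0 ∧ κ ≠ ∞ ∧ srStep A P Q = κ • Q := by
  have hA := h.1
  have hs := h.srChain_dirac_zero_ne_zero hP0
  have hQ0 : ∀ᵐ y ∂Q, 0 ≤ y := ae_nonneg_of_measure_Iio
    (measure_mono_null Iio_subset_Iic_self (quasiStationary_Iic_zero hP0 hq))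
  have hQA : ∀ᵐ y ∂Q, y ≤ A := by
    rw [ae_iff]
    simpa [Ioi] using quasiStationary_Ioi h hP0 hq
  have hne : ∀ y, 0 ≤ y → y ≤ A → P (Iio (A / (1 + A))) ≤ P (Iio (A / (1 + y))) := by
    intro y hy0 hyA
    refine measure_mono (Iio_subset_Iio ?_)
    exact div_le_div_of_nonneg_left hA.le (by linarith) (by linarith)
  have hpos : ∀ y, 0 ≤ y → y ≤ A → P (Iio (A / (1 + y))) ≠ 0 := fun y hy0 hyA h0 =>
    hz (nonpos_iff_eq_zero.1 (h0 ▸ hne y hy0 hyA))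
  set κ := ∫⁻ y, P {z | (1 + y) * z ≤ A} ∂Q with hκ
  have hκS : κ = ∫⁻ y, srSurv A P 1 y ∂Q := by
    refine lintegral_srSurv_one_eq h hP hQ0 ?_
    filter_upwards [hQ0, hQA] with y h1 h2 using hpos y h1 h2
  have hκ0 : κ ≠ 0 := by
    have : P (Iio (A / (1 + A))) ≤ κ := by
      calc P (Iio (A / (1 + A))) = ∫⁻ _, P (Iio (A / (1 + A))) ∂Q := by simp
        _ ≤ κ := by
          rw [hκS]
          refine lintegral_mono_ae ?_
          filter_upwards [hQ0, hQA] with y h1 h2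
          rw [srSurv_one_eq h1]
          exact hne y h1 h2
    exact fun h0 => hz (nonpos_iff_eq_zero.1 (h0 ▸ this))
  have hκt : κ ≠ ∞ := by
    rw [hκS, ← srStep_univ]
    exact measure_ne_top _ _
  set κn : ℕ → ℝ≥0∞ := fun n => ∫⁻ y, srSurv A P 1 y ∂(srCond A P (Measure.dirac 0) n) with hκn
  have hnn : ∀ n, ∀ᵐ y ∂(srCond A P (Measure.dirac 0) n), 0 ≤ y := fun n =>
    ae_nonneg_of_measure_Iio (srCond_eq_zero (srChain_Iio_zero (A := A) dirac_zero_Iio hP0 n))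
  have hnA : ∀ n, ∀ᵐ y ∂(srCond A P (Measure.dirac 0) n), y < A := fun n => by
    rw [ae_iff]
    simpa [Ici] using srCond_eq_zero (srChain_dirac_zero_Ici (F := P) hA n)
  have hκlim : Tendsto κn atTop (𝓝 κ) := by
    refine (tendsto_lintegral_measure_mul_le h hP0 hq A).congr fun n => ?_
    refine lintegral_srSurv_one_eq h hP (hnn n) ?_
    filter_upwards [hnn n, hnA n] with y h1 h2 using hpos y h1 h2.le
  -- One step of the conditional law is the next conditional law times the one-step survival
  -- probability; the limit of this identity is the eigenvalue equation below `A`.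
  have hstep : ∀ x, x < A → ∀ n, ∫⁻ y, P {z | (1 + y) * z ≤ x} ∂(srCond A P (Measure.dirac 0) n)
      = κn n * srCond A P (Measure.dirac 0) (n + 1) (Iic x) := by
    intro x hxA n
    have e1 : srChain A P (Measure.dirac 0) (n + 1) (Iic x)
        = ∫⁻ y, P {z | (1 + y) * z ≤ x} ∂(srChain A P (Measure.dirac 0) n) := by
      rw [srChain, srStep, Measure.restrict_apply measurableSet_Iic,
        inter_eq_left.2 (Iic_subset_Iio.2 hxA),
        srFreeStep_apply measurableSet_Iic]
      rfl
    have e2 : ∫⁻ y, srSurv A P 1 y ∂(srChain A P (Measure.dirac 0) n)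
        = srChain A P (Measure.dirac 0) (n + 1) univ := srStep_univ.symm
    rw [hκn]
    simp only
    rw [lintegral_srCond, lintegral_srCond, e2, ← e1, srCond, Measure.smul_apply, smul_eq_mul,
      mul_assoc, ← mul_assoc (srChain A P (Measure.dirac 0) (n + 1) univ),
      ENNReal.mul_inv_cancel (hs (n + 1)) (measure_ne_top _ _), one_mul]
  have hinv : ∀ x, x < A → srFreeStep P Q (Iic x) = κ * Q (Iic x) := by
    intro x hxA
    have h1 := tendsto_lintegral_measure_mul_le h hP0 hq x
    simp only [hstep x hxA] at h1
    have h2 := ENNReal.Tendsto.mul hκlim (Or.inl hκ0)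
      ((tendsto_add_atTop_iff_nat 1).2 (hq x)) (Or.inr hκt)
    rw [srFreeStep_apply measurableSet_Iic]
    exact tendsto_nhds_unique h1 h2
  have hfree : srFreeStep P Q (Iio A) = κ := by
    rw [hκS, ← srStep_univ, srStep, Measure.restrict_apply_univ]
  have hlim : Tendsto (fun n : ℕ => A - 1 / ((n : ℝ) + 1)) atTop (𝓝 (A - 0)) :=
    tendsto_const_nhds.sub tendsto_one_div_add_atTop_nhds_zero_nat
  rw [sub_zero] at hlim
  have hlt : ∀ n : ℕ, A - 1 / ((n : ℝ) + 1) < A := fun n => by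
    have : 0 < 1 / ((n : ℝ) + 1) := by positivity
    linarith
  have hmono : Monotone fun n : ℕ => A - 1 / ((n : ℝ) + 1) := by
    intro i j hij
    have : 1 / ((j : ℝ) + 1) ≤ 1 / ((i : ℝ) + 1) :=
      one_div_le_one_div_of_le (by positivity) (by gcongr)
    simp only
    linarith
  -- Letting `x` increase to `A` gives `κ = κ * Q (Iio A)`, so no mass sits at the threshold.
  have hQ1 : Q (Iio A) = 1 := by
    have h1 := tendsto_measure_Iic_left (srFreeStep P Q) hmono hlt hlim
    simp only [fun n => hinv _ (hlt n)] at h1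
    have h2 := ENNReal.Tendsto.const_mul (tendsto_measure_Iic_left Q hmono hlt hlim)
      (Or.inr hκt)
    have h3 := tendsto_nhds_unique h1 h2
    rw [hfree] at h3
    have h4 : κ * 1 = κ * Q (Iio A) := by rw [mul_one]; exact h3
    exact ((ENNReal.mul_right_inj hκ0 hκt).1 h4).symm
  refine ⟨?_, κ, hκ0, hκt, ?_⟩
  · rw [← compl_Iio, prob_compl_eq_zero_iff measurableSet_Iio]
    exact hQ1
  · refine Measure.ext_of_Iic _ _ fun x => ?_
    rw [srStep, Measure.restrict_apply measurableSet_Iic, Measure.smul_apply, smul_eq_mul]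
    rcases lt_or_ge x A with hxA | hxA
    · rw [inter_eq_left.2 (Iic_subset_Iio.2 hxA), hinv x hxA]
    · rw [inter_eq_right.2 (Iio_subset_Iic hxA), hfree,
        le_antisymm prob_le_one (hQ1.ge.trans (measure_mono (Iio_subset_Iic hxA))), mul_one]

lemma srChain_eq_pow_smul {m : Measure ℝ} [IsFiniteMeasure m] {κ : ℝ≥0∞} (hκ : κ ≠ ∞)
    (h : srStep A P m = κ • m) (n : ℕ) : srChain A P m n = κ ^ n • m := by
  induction n with
  | zero => simp [srChain]
  | succ n ih =>
    have : srStep A P (κ ^ n • m) = κ ^ n • srStep A P m := by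
      have i : IsFiniteMeasure (κ ^ n • m) := Measure.smul_finite m (ENNReal.pow_ne_top hκ)
      ext s hs
      rw [srStep, Measure.smul_apply, srStep, Measure.restrict_apply hs, Measure.restrict_apply hs,
        srFreeStep_apply (hs.inter measurableSet_Iio),
        srFreeStep_apply (hs.inter measurableSet_Iio), lintegral_smul_measure]
    rw [srChain, ih, this, h, smul_smul, pow_succ]

lemma srCond_eq_of_srStep_eq_smul [IsProbabilityMeasure Q] {κ : ℝ≥0∞} (hκ0 : κ ≠ 0) (hκ : κ ≠ ∞)
    (h : srStep A P Q = κ • Q) (n : ℕ) : srCond A P Q n = Q := by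
  rw [srCond, srChain_eq_pow_smul hκ h, Measure.smul_apply, measure_univ, smul_smul, smul_eq_mul,
    mul_one, ENNReal.inv_mul_cancel (pow_ne_zero n hκ0) (ENNReal.pow_ne_top hκ), one_smul]

end

/-! ### The likelihood ratio of densities -/

section

variable {𝓧 : Type*} [MeasurableSpace 𝓧] {lam : Measure 𝓧} {f g : 𝓧 → ℝ}

lemma densityLaw_eq_zero_iff {h : 𝓧 → ℝ} (hh : Measurable h) {s : Set 𝓧} (hs : MeasurableSet s) :
    densityLaw lam h s = 0 ↔ ∀ᵐ x ∂lam, x ∈ s → h x ≤ 0 := by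
  rw [densityLaw, withDensity_apply _ hs, lintegral_eq_zero_iff hh.ennreal_ofReal,
    EventuallyEq, ae_restrict_iff' hs]
  simp only [Pi.zero_apply, ENNReal.ofReal_eq_zero]

lemma likLaw_eq_zero_iff {h : 𝓧 → ℝ} (hf : Measurable f) (hg : Measurable g) (hh : Measurable h)
    {s : Set ℝ} (hs : MeasurableSet s) :
    likLaw lam f g h s = 0 ↔ ∀ᵐ x ∂lam, likRatio f g x ∈ s → h x ≤ 0 := by
  rw [likLaw, Measure.map_apply (measurable_likRatio hf hg) hs,
    densityLaw_eq_zero_iff hh (measurable_likRatio hf hg hs)]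
  rfl

lemma likLaw_null_iff (hf : Measurable f) (hg : Measurable g)
    (hfg : ∀ᵐ x ∂lam, 0 < f x ↔ 0 < g x) {s : Set ℝ} (hs : MeasurableSet s) :
    likLaw lam f g g s = 0 ↔ likLaw lam f g f s = 0 := by
  rw [likLaw_eq_zero_iff hf hg hg hs, likLaw_eq_zero_iff hf hg hf hs]
  constructor
  · intro h
    filter_upwards [h, hfg] with x hx hxfg hxs
    exact not_lt.1 fun h0 => absurd (hx hxs) (not_le.2 (hxfg.1 h0))
  · intro h
    filter_upwards [h, hfg] with x hx hxfg hxs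
    exact not_lt.1 fun h0 => absurd (hx hxs) (not_le.2 (hxfg.2 h0))

lemma likLaw_Iic_zero (hf : Measurable f) (hg : Measurable g)
    (hfg : ∀ᵐ x ∂lam, 0 < f x ↔ 0 < g x) : likLaw lam f g f (Iic 0) = 0 := by
  rw [likLaw_eq_zero_iff hf hg hf measurableSet_Iic]
  filter_upwards [hfg] with x hx hxs
  by_contra! h0
  exact absurd (div_pos (hx.1 h0) h0) (not_lt.2 hxs)

/-- Otherwise `g < f` almost everywhere on `{f > 0}`, impossible for two densities with equal
integrals. -/
lemma likLaw_Ici_one_ne_zero (hf : Measurable f) (hg : Measurable g) (hf0 : ∀ x, 0 ≤ f x)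
    (hf1 : ∫⁻ x, ENNReal.ofReal (f x) ∂lam = 1) (hg1 : ∫⁻ x, ENNReal.ofReal (g x) ∂lam = 1)
    (hfg : ∀ᵐ x ∂lam, 0 < f x ↔ 0 < g x) : likLaw lam f g f (Ici 1) ≠ 0 := by
  rw [Ne, likLaw_eq_zero_iff hf hg hf measurableSet_Ici]
  intro h
  have hlt : ∀ᵐ x ∂lam, 0 < f x → g x < f x := by
    filter_upwards [h] with x hx h0
    by_contra! hle
    exact absurd (hx ((one_le_div h0).2 hle)) (not_le.2 h0)
  have hae : (fun x => ENNReal.ofReal (g x)) =ᵐ[lam] fun x => ENNReal.ofReal (f x) := by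
    refine ae_eq_of_ae_le_of_lintegral_le ?_ (hg1.trans_ne ENNReal.one_ne_top)
      hf.ennreal_ofReal.aemeasurable (hf1.trans hg1.symm).le
    filter_upwards [hlt, hfg] with x hx hxfg
    rcases (hf0 x).eq_or_lt with h0 | h0
    · have : g x ≤ 0 := not_lt.1 fun hg0 => absurd (hxfg.2 hg0) (by rw [← h0]; exact lt_irrefl _)
      rw [ENNReal.ofReal_of_nonpos this]
      exact zero_le
    · exact ENNReal.ofReal_le_ofReal (hx h0).le
  have hzero : (fun x => ENNReal.ofReal (f x)) =ᵐ[lam] fun _ => 0 := by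
    filter_upwards [hae, hlt] with x hx hxl
    rw [ENNReal.ofReal_eq_zero]
    by_contra! h0
    exact absurd hx ((ENNReal.ofReal_lt_ofReal_iff h0).2 (hxl h0)).ne
  rw [lintegral_congr_ae hzero, lintegral_zero] at hf1
  exact zero_ne_one hf1

lemma logConcaveLaw_likLaw {h : 𝓧 → ℝ} (hf : Measurable f) (hg : Measurable g)
    (h1 : ∫⁻ x, ENNReal.ofReal (h x) ∂lam = 1) (h0 : likLaw lam f g h (Iic 0) = 0)
    (hc : LogConcaveCdf (logLikRatioCdf f g (densityLaw lam h))) :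
    LogConcaveLaw (likLaw lam f g h) := by
  have hL := measurable_likRatio hf hg
  have hlog : Measurable fun x => Real.log (likRatio f g x) := Real.measurable_log.comp hL
  have i1 := isProbabilityMeasure_densityLaw h1
  have i2 := isProbabilityMeasure_likLaw (f := f) (g := g) hf hg h1
  have i3 : IsProbabilityMeasure ((densityLaw lam h).map fun x => Real.log (likRatio f g x)) :=
    Measure.isProbabilityMeasure_map hlog.aemeasurable
  refine logConcaveLaw_of_concaveOn h0 (logLikRatioCdf f g (densityLaw lam h)) (fun t => ?_)
    (fun t => cdf_nonneg _ t) hc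
  rw [logLikRatioCdf, cdf_eq_real, ofReal_measureReal, Measure.map_apply hlog measurableSet_Iic,
    likLaw,
    Measure.map_apply hL measurableSet_Iic]
  refine measure_congr ?_
  have hpos : ∀ᵐ x ∂(densityLaw lam h), 0 < likRatio f g x := by
    rw [likLaw, Measure.map_apply hL measurableSet_Iic] at h0
    rw [ae_iff]
    simpa [Iic, preimage] using h0
  filter_upwards [hpos] with x hx
  exact propext (Real.log_le_iff_le_exp hx).symm

/-- The quasi-stationary distribution in terms of the killed chain. -/
lemma IsQuasiStationary.srViable_and_tendsto (hf : Measurable f) (hg : Measurable g)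
    (hf1 : ∫⁻ x, ENNReal.ofReal (f x) ∂lam = 1) (hg1 : ∫⁻ x, ENNReal.ofReal (g x) ∂lam = 1)
    (hP0 : likLaw lam f g f (Iic 0) = 0) {A : ℝ} {Q : Measure ℝ}
    (hQ : IsQuasiStationary lam f g A Q) :
    SRViable A (likLaw lam f g f) ∧ ∀ r, 0 ≤ r → (∀ n, srSurv A (likLaw lam f g f) n r ≠ 0) →
      ∀ x, Tendsto (fun n => srCond A (likLaw lam f g f) (Measure.dirac r) n (Iic x)) atTop
        (𝓝 (Q (Iic x))) := by
  have i2 := isProbabilityMeasure_likLaw (f := f) (g := g) hf hg hf1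
  constructor
  · refine srViable_of_srSurv_ne_zero hP0 fun n => ?_
    rw [← changeLaw_top_lt_srTime hf hg hf1 hg1]
    exact hQ.survives n
  · intro r hr hs x
    refine (hQ.tendsto r hr (fun n => ?_) x).congr fun n => ?_
    · rw [changeLaw_top_lt_srTime hf hg hf1 hg1]
      exact hs n
    · rw [cond_apply (measurableSet_lt_srTime hf hg A r n),
        changeLaw_top_lt_srTime hf hg hf1 hg1, ← srChain_dirac_univ, srCond, Measure.smul_apply,
        smul_eq_mul, ← changeLaw_top_inter_eq hf hg hf1 hg1 n measurableSet_Iic]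
      rfl

end

/-! ### Delays and thresholds of the original procedures. -/

lemma dirac_Iio_zero {r : ℝ} (hr : 0 ≤ r) : Measure.dirac r (Iio 0) = 0 := by
  rw [Measure.dirac_apply' _ measurableSet_Iio]
  simpa using hr

section

variable {𝓧 : Type*} [MeasurableSpace 𝓧] {lam : Measure 𝓧} {f g : 𝓧 → ℝ} {A : ℝ}

/-- The delay at infinity exists for every head start that survives, and is a sum of terms that
do not depend on the head start. -/
lemma exists_isSRDelayAtInfinity (hf : Measurable f) (hg : Measurable g)
    (hf1 : ∫⁻ x, ENNReal.ofReal (f x) ∂lam = 1) (hg1 : ∫⁻ x, ENNReal.ofReal (g x) ∂lam = 1)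
    (hF0 : likLaw lam f g f (Iic 0) = 0) (hG0 : likLaw lam f g g (Iic 0) = 0)
    (hG1 : likLaw lam f g g (Ici 1) ≠ 0) (hG : LogConcaveLaw (likLaw lam f g g))
    (hvF : SRViable A (likLaw lam f g f)) (hvG : SRViable A (likLaw lam f g g))
    {Q : Measure ℝ} (hQ : IsQuasiStationary lam f g A Q) {r : ℝ} (hr : 0 ≤ r)
    (hs : ∀ n, srSurv A (likLaw lam f g f) n r ≠ 0) :
    ∃ l, SRDelayTerms A (likLaw lam f g f) (likLaw lam f g g) (Measure.dirac 0) l ∧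
      ∑' k, l k ≠ ∞ ∧ IsSRDelayAtInfinity lam f g A r (∑' k, l k).toNNReal := by
  have iF := isProbabilityMeasure_likLaw (f := f) (g := g) hf hg hf1
  have iG := isProbabilityMeasure_likLaw (f := f) (g := g) hf hg hg1
  have hlim := (hQ.srViable_and_tendsto hf hg hf1 hg1 hF0).2
  have hs0 := hvF.srChain_dirac_zero_ne_zero hF0
  have hsr : ∀ n, srChain A (likLaw lam f g f) (Measure.dirac r) n univ ≠ 0 := fun n => by
    rw [srChain_dirac_univ]
    exact hs n
  obtain ⟨l, hl0, hlr⟩ := exists_srDelayTerms hF0 hG0 hG hvG dirac_zero_Iio (dirac_Iio_zero hr)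
    hs0 hsr (hlim 0 le_rfl fun n => by rw [← srChain_dirac_univ]; exact hs0 n) (hlim r hr hs)
  have hfin := hl0.tsum_ne_top hF0 hG0 hG1 hvF.1 dirac_zero_Iio hs0
  refine ⟨l, hl0, hfin, ?_⟩
  rw [IsSRDelayAtInfinity, ENNReal.coe_toNNReal hfin]
  simp_rw [srMeanDelay_eq_tsum hf hg hf1 hg1]
  exact hlr.tendsto_tsum hF0 hG0 hG1 hvF.1 (dirac_Iio_zero hr) hsr

/-- The delay at infinity of the procedure started from the quasi-stationary distribution is the
same as that of the procedure started from `0`. -/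
lemma exists_isSRPDelayAtInfinity (hf : Measurable f) (hg : Measurable g)
    (hf1 : ∫⁻ x, ENNReal.ofReal (f x) ∂lam = 1) (hg1 : ∫⁻ x, ENNReal.ofReal (g x) ∂lam = 1)
    (hF0 : likLaw lam f g f (Iic 0) = 0) (hG0 : likLaw lam f g g (Iic 0) = 0)
    (hG1 : likLaw lam f g g (Ici 1) ≠ 0) (hF : LogConcaveLaw (likLaw lam f g f))
    (hG : LogConcaveLaw (likLaw lam f g g))
    (hvF : SRViable A (likLaw lam f g f)) (hvG : SRViable A (likLaw lam f g g))
    {Q : Measure ℝ} (hQ : IsQuasiStationary lam f g A Q) {γ : ℝ} (hγ : 1 < γ)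
    (hARL : srpARL lam f g A Q = ENNReal.ofReal γ) :
    ∃ l, SRDelayTerms A (likLaw lam f g f) (likLaw lam f g g) (Measure.dirac 0) l ∧
      ∑' k, l k ≠ ∞ ∧ IsSRPDelayAtInfinity lam f g A Q (∑' k, l k).toNNReal := by
  have iF := isProbabilityMeasure_likLaw (f := f) (g := g) hf hg hf1
  have iG := isProbabilityMeasure_likLaw (f := f) (g := g) hf hg hg1
  have iQ := hQ.isProbabilityMeasure
  have hs0 := hvF.srChain_dirac_zero_ne_zero hF0
  have hlim := (hQ.srViable_and_tendsto hf hg hf1 hg1 hF0).2 0 le_rfl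
    fun n => by rw [← srChain_dirac_univ]; exact hs0 n
  have hQ0 : Q (Iio 0) = 0 :=
    measure_mono_null Iio_subset_Iic_self (quasiStationary_Iic_zero hF0 hlim)
  -- In the boundary case `Q` charges only head starts at or above `A`; from these the alarm comes
  -- at time `1`, against `γ > 1`.
  have hz : likLaw lam f g f (Iio (A / (1 + A))) ≠ 0 := by
    intro hz
    have hQA := quasiStationary_Iio_eq_zero hvF hF0 hz hlim
    have hone : ∀ᵐ r ∂Q, srARL lam f g A r = 1 := by
      have hAe : ∀ᵐ r ∂Q, A ≤ r := by
        rw [ae_iff]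
        simpa [Iio] using hQA
      filter_upwards [hAe] with r hAr
      have hA := hvF.1
      rw [srARL_eq_tsum hf hg hf1 hg1]
      refine tsum_srSurv_of_one_eq_zero ?_
      rw [srSurv_one_eq (hA.le.trans hAr)]
      refine measure_mono_null (Iio_subset_Iio ?_) hz
      exact div_le_div_of_nonneg_left hA.le (by linarith) (by linarith)
    rw [srpARL_eq_lintegral hf hg hf1 hg1, lintegral_congr_ae hone, lintegral_const, measure_univ,
      mul_one, ← ENNReal.ofReal_one] at hARL
    exact absurd hARL ((ENNReal.ofReal_lt_ofReal_iff (by linarith)).2 hγ).ne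
  obtain ⟨hQA, κ, hκ0, hκ, hstep⟩ := quasiStationary_srStep hvF hF hF0 hz hlim
  have hcond := srCond_eq_of_srStep_eq_smul hκ0 hκ hstep
  have hsQ : ∀ n, srChain A (likLaw lam f g f) Q n univ ≠ 0 := fun n => by
    rw [srChain_eq_pow_smul hκ hstep, Measure.smul_apply, measure_univ, smul_eq_mul, mul_one]
    exact pow_ne_zero n hκ0
  obtain ⟨l, hl0, hlQ⟩ := exists_srDelayTerms (m' := Q) hF0 hG0 hG hvG dirac_zero_Iio hQ0
    hs0 hsQ hlim (fun x => by simp only [hcond]; exact tendsto_const_nhds)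
  have hfin := hl0.tsum_ne_top hF0 hG0 hG1 hvF.1 dirac_zero_Iio hs0
  refine ⟨l, hl0, hfin, ?_⟩
  rw [IsSRPDelayAtInfinity, ENNReal.coe_toNNReal hfin]
  simp_rw [srpMeanDelay_eq_tsum hf hg hf1 hg1]
  exact hlQ.tendsto_tsum hF0 hG0 hG1 hvF.1 hQ0 hsQ

/-- If the average run length from the quasi-stationary distribution is that of the procedure
started at `0` with another threshold, then the latter threshold is smaller. -/
lemma IsQuasiStationary.threshold_lt (hf : Measurable f) (hg : Measurable g)
    (hf1 : ∫⁻ x, ENNReal.ofReal (f x) ∂lam = 1) (hg1 : ∫⁻ x, ENNReal.ofReal (g x) ∂lam = 1)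
    (hF0 : likLaw lam f g f (Iic 0) = 0) (hF : LogConcaveLaw (likLaw lam f g f))
    {Q : Measure ℝ} (hQ : IsQuasiStationary lam f g A Q) {γ : ℝ} (hγ : 1 < γ)
    (hARL : srpARL lam f g A Q = ENNReal.ofReal γ) {A₀ : ℝ}
    (hv₀ : SRViable A₀ (likLaw lam f g f)) (hA₀ : srARL lam f g A₀ 0 = ENNReal.ofReal γ) :
    A₀ < A := by
  have iF := isProbabilityMeasure_likLaw (f := f) (g := g) hf hg hf1
  have iQ := hQ.isProbabilityMeasure
  obtain ⟨hvF, hlim⟩ := hQ.srViable_and_tendsto hf hg hf1 hg1 hF0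
  have hs0 := hvF.srChain_dirac_zero_ne_zero hF0
  have hQ0 : ∀ᵐ y ∂Q, 0 < y := ae_pos_of_measure_Iic (quasiStationary_Iic_zero hF0
    (hlim 0 le_rfl fun n => by rw [← srChain_dirac_univ]; exact hs0 n))
  by_contra! hle
  -- If `A ≤ A₀`, the run length is at most `γ` for almost every head start and averages to `γ`, so
  -- it equals `γ` at some positive one, which reduces to deterministic head starts.
  have hle' : ∀ᵐ y ∂Q, srARL lam f g A y ≤ ENNReal.ofReal γ := by
    filter_upwards [hQ0] with y hy
    rw [← hA₀, srARL_eq_tsum hf hg hf1 hg1, srARL_eq_tsum hf hg hf1 hg1]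
    exact ENNReal.tsum_le_tsum fun n =>
      srSurv_le_srSurv hF0 le_rfl (by simpa using hle) n hy.le le_rfl (by simpa using hy.le)
  have hae : (fun y => srARL lam f g A y) =ᵐ[Q] fun _ => ENNReal.ofReal γ := by
    refine ae_eq_of_ae_le_of_lintegral_le hle' ?_ measurable_const.aemeasurable ?_
    · rw [← srpARL_eq_lintegral hf hg hf1 hg1, hARL]
      exact ENNReal.ofReal_ne_top
    · rw [← srpARL_eq_lintegral hf hg hf1 hg1, hARL]
      simp
  obtain ⟨y, hy0, hy⟩ := (hQ0.and hae).exists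
  have h1 : 1 < ENNReal.ofReal γ := by
    rw [← ENNReal.ofReal_one]
    exact (ENNReal.ofReal_lt_ofReal_iff (by linarith)).2 hγ
  simp only [srARL_eq_tsum hf hg hf1 hg1] at hy hA₀
  exact absurd (hv₀.threshold_lt hF hF0 h1 ENNReal.ofReal_ne_top le_rfl hy0 hA₀ hy) (not_lt.2 hle)

end

end

theorem theorem5 {𝓧 : Type*} [MeasurableSpace 𝓧] (lam : Measure 𝓧) (f g : 𝓧 → ℝ)
    -- `f` and `g` are probability densities, and the log-likelihood ratio is a.s. finite
    -- both before and after the change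
    (hf : Measurable f) (hg : Measurable g) (hf0 : ∀ x, 0 ≤ f x) (hg0 : ∀ x, 0 ≤ g x)
    (hf1 : ∫⁻ x, ENNReal.ofReal (f x) ∂lam = 1) (hg1 : ∫⁻ x, ENNReal.ofReal (g x) ∂lam = 1)
    (hfg : ∀ᵐ x ∂lam, 0 < f x ↔ 0 < g x)
    -- log-concavity of the distribution functions before and after the change
    (hpre : LogConcaveCdf (logLikRatioCdf f g (densityLaw lam f)))
    (hpost : LogConcaveCdf (logLikRatioCdf f g (densityLaw lam g)))
    -- a set `S` of head starts, with thresholds that give the same average run length `γ`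
    (γ : ℝ) (hγ : 1 < γ) (S : Set ℝ) (hS : ∀ r ∈ S, 0 ≤ r) (A : ℝ → ℝ)
    (hA : ∀ r ∈ S, srARL lam f g (A r) r = ENNReal.ofReal γ)
    (hQ : ∀ r ∈ S, ∃ Q : Measure ℝ, IsQuasiStationary lam f g (A r) Q) :
    ∃ D : ℝ → ℝ≥0,
      (∀ r ∈ S, IsSRDelayAtInfinity lam f g (A r) r (D r)) ∧
      StrictMonoOn D S ∧
      (0 ∈ S →
        IsLeast (D '' S) (D 0) ∧
        ∀ (AQ : ℝ) (Q : Measure ℝ), IsQuasiStationary lam f g AQ Q →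
          srpARL lam f g AQ Q = ENNReal.ofReal γ →
          ∃ dQ : ℝ≥0, IsSRPDelayAtInfinity lam f g AQ Q dQ ∧ D 0 < dQ) := by
  have iF := isProbabilityMeasure_likLaw (f := f) (g := g) hf hg hf1
  have iG := isProbabilityMeasure_likLaw (f := f) (g := g) hf hg hg1
  have hnull : ∀ {s : Set ℝ}, MeasurableSet s →
      (likLaw lam f g g s = 0 ↔ likLaw lam f g f s = 0) := likLaw_null_iff hf hg hfg
  have hF0 : likLaw lam f g f (Set.Iic 0) = 0 := likLaw_Iic_zero hf hg hfg
  have hG0 : likLaw lam f g g (Set.Iic 0) = 0 := (hnull measurableSet_Iic).2 hF0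
  have hF1 : likLaw lam f g f (Set.Ici 1) ≠ 0 := likLaw_Ici_one_ne_zero hf hg hf0 hf1 hg1 hfg
  have hG1 : likLaw lam f g g (Set.Ici 1) ≠ 0 := fun h => hF1 ((hnull measurableSet_Ici).1 h)
  have hF := logConcaveLaw_likLaw hf hg hf1 hF0 hpre
  have hG := logConcaveLaw_likLaw hf hg hg1 hG0 hpost
  have hvFG : ∀ {B : ℝ}, SRViable B (likLaw lam f g f) → SRViable B (likLaw lam f g g) :=
    fun h => ⟨h.1, fun z hz h0 => h.2 z hz ((hnull measurableSet_Iio).1 h0)⟩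
  have hvF : ∀ r ∈ S, SRViable (A r) (likLaw lam f g f) := fun r hr => by
    obtain ⟨Q, hQr⟩ := hQ r hr
    exact (hQr.srViable_and_tendsto hf hg hf1 hg1 hF0).1
  have hγ1 : 1 < ENNReal.ofReal γ := by
    rw [← ENNReal.ofReal_one]
    exact (ENNReal.ofReal_lt_ofReal_iff (by linarith)).2 hγ
  have hARL : ∀ r ∈ S, ∑' n, srSurv (A r) (likLaw lam f g f) n r = ENNReal.ofReal γ :=
    fun r hr => by rw [← srARL_eq_tsum hf hg hf1 hg1, hA r hr]
  have hsurv : ∀ r ∈ S, ∀ n, srSurv (A r) (likLaw lam f g f) n r ≠ 0 := by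
    intro r hr n
    -- A head start that cannot survive the first step has run length `1 < γ`. Head starts above the
    -- threshold are thus covered too.
    refine (hvF r hr).srSurv_ne_zero hF0 n (hS r hr) fun h0 => ?_
    rw [← srSurv_one_eq (hS r hr)] at h0
    exact hγ1.ne ((tsum_srSurv_of_one_eq_zero h0).symm.trans (hARL r hr))
  have hmonoA : ∀ r ∈ S, ∀ r' ∈ S, r < r' → A r < A r' := fun r hr r' hr' hrr =>
    (hvF r hr).threshold_lt hF hF0 hγ1 ENNReal.ofReal_ne_top (hS r hr) hrr (hARL r hr)
      (hARL r' hr')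
  -- The terms refer to the chain started at `0`, whatever `r` is, so that different head starts are
  -- compared through their thresholds alone.
  have hdelay : ∀ r, ∃ l : ℕ → ℝ≥0∞, r ∈ S →
      SRDelayTerms (A r) (likLaw lam f g f) (likLaw lam f g g) (Measure.dirac 0) l ∧
      ∑' k, l k ≠ ∞ ∧ IsSRDelayAtInfinity lam f g (A r) r (∑' k, l k).toNNReal := by
    intro r
    by_cases hr : r ∈ S
    · obtain ⟨Q, hQr⟩ := hQ r hr
      obtain ⟨l, hl⟩ := exists_isSRDelayAtInfinity hf hg hf1 hg1 hF0 hG0 hG1 hG (hvF r hr)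
        (hvFG (hvF r hr)) hQr (hS r hr) (hsurv r hr)
      exact ⟨l, fun _ => hl⟩
    · exact ⟨0, fun h => absurd h hr⟩
  choose l hl using hdelay
  have hmono : StrictMonoOn (fun r => (∑' k, l r k).toNNReal) S := by
    intro r hr r' hr' hrr
    have h := (hl r' hr').1.tsum_lt_tsum hF hF0 hF1 hG hG0 hG1
      (fun z hz => (hnull measurableSet_Ici).1 hz) (hvF r' hr') (hvF r hr) (hvFG (hvF r hr))
      (hmonoA r hr r' hr' hrr) (hl r hr).1
    exact (ENNReal.toNNReal_lt_toNNReal (hl r hr).2.1 (hl r' hr').2.1).2 h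
  refine ⟨fun r => (∑' k, l r k).toNNReal, fun r hr => (hl r hr).2.2, hmono,
    fun h0 => ⟨⟨?_, ?_⟩, ?_⟩⟩
  · exact Set.mem_image_of_mem _ h0
  · rintro _ ⟨r, hr, rfl⟩
    exact hmono.monotoneOn h0 hr (hS r hr)
  · intro AQ Q hQQ hARLQ
    have hvQ := (hQQ.srViable_and_tendsto hf hg hf1 hg1 hF0).1
    obtain ⟨lQ, hlQ, hfin, hlim⟩ := exists_isSRPDelayAtInfinity hf hg hf1 hg1 hF0 hG0 hG1 hF hG
      hvQ (hvFG hvQ) hQQ hγ hARLQ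
    refine ⟨_, hlim, (ENNReal.toNNReal_lt_toNNReal (hl 0 h0).2.1 hfin).2 ?_⟩
    exact hlQ.tsum_lt_tsum hF hF0 hF1 hG hG0 hG1 (fun z hz => (hnull measurableSet_Ici).1 hz) hvQ
      (hvF 0 h0) (hvFG (hvF 0 h0))
      (hQQ.threshold_lt hf hg hf1 hg1 hF0 hF hγ hARLQ (hvF 0 h0) (hA 0 h0)) (hl 0 h0).1
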